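/- **Setting.** Write $x=(x_1,x_2)\in\mathbb R^{d_1}\times\mathbb R^{d_2}$ and $w=(w_1,w_2)$ likewise. Target data $(x,y)$: $y$ is uniform on $\{\pm1\}$, $x_1$ given $y$ has an arbitrary law $\mathcal D(\cdot\mid y)$, and $x_2\sim N(0,\Sigma_2)$ with $\Sigma_2\succ0$ is independent of $(x_1,y)$. Let $\ell(t)=e^{-|t|}$ and $L(w)=\mathbb E\,\ell(w^\top x)$. A distribution on $\mathbb R^d$ is *sliced $\alpha$-log-concave and $\beta$-log-smooth* if for each unit vector $v$ the variable $v^\top x$ has a positive density $p$ with $\log p$ twice differentiable, $(\log p)''\le-\alpha$ and $|(\log p)''|\le\beta$. Define $$p^\star(\rho,\nu)=\frac{\sqrt\nu}{2\sqrt\pi}\min\Big\{1,\frac{\sqrt\nu}{\sqrt\rho}\Big(\frac{\sqrt\pi}{44\sqrt{2\rho}}\Big)^{8\rho/\nu}\Big\},$$ $$\tilde\kappa(\rho,\nu)=\min\Big\{\frac{\sqrt\pi}{4\sqrt\rho}\,p^\star(\rho,\nu)^{1-\frac{\nu}{4\rho}}\Big(\frac{\nu}{2\sqrt\pi}\Big)^{\frac{\nu}{4\rho}},\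 \frac{\sqrt\nu}{8\sqrt{2\pi}(\sqrt\rho+\sqrt2)}\exp\Big(-\Big(\frac{\sqrt\rho+4}{2\sqrt\nu}\Big)^2\Big)\Big\},$$ and $\kappa=\min_{a\in[1,4]}\tilde\kappa(a\beta,a\alpha)$. **Assumption 1.** With $\alpha>0$, the law of $x_1$ is a mixture, with weights $\tau_1,\dots,\tau_K$, of $K$ sliced $\alpha$-log-concave and $\beta$-log-smooth probability distributions, and with $\tau=\min_i\tau_i$ there is $v\in\mathbb R^{d_1}$ with $L((v,0))\le\tau\kappa$. **Assumption 2 (on a source classifier $w^{s}$).** $\|w^s\|_2\le1$, $\|w^s_1\|_2\ge\frac12$, $\;{w^s_2}^\top\Sigma_2w^s_2\le 0.03\cdot\min\{1,\alpha/\beta^2,\beta^{-1}\}$, and $L(w^s)\le\tau\kappa$. **Algorithm.** $w^0=w^s$, $\;w^{t+1}=\dfrac{w^t-\eta\nabla L(w^t)}{\|w^t-\eta\nabla L(w^t)\|_2}$. With $n$ i.i.d. unlabeled samples $X_1,\dots,X_n$ of $x$, the empirical algorithm replaces $\nabla L$ by $\nabla\hat L(w)=\frac1n\sum_i\ell'(w^\top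 X_i)X_i$, where $\ell'(t)=-\mathrm{sign}(t)e^{-|t|}$ and $\mathrm{sign}(0)=0$. **Theorem 1.** Suppose Assumption 1 holds and $L$ is smooth away from the origin (differentiable on $\{w\ne0\}$ with locally Lipschitz gradient there). There is $\eta_0>0$, depending only on the target distribution, $\alpha$, $\beta$ and the mixture, such that for every step size $0<\eta\le\eta_0$ there is a constant $C>0$, depending only on these data and on $\eta$, such that for every $w^s$ satisfying Assumption 2: 1. for all $\epsilon\in(0,\frac12]$ and all $t\ge C\log\frac1\epsilon$, the population iterates satisfy $\|w^t_2\|_2\le\epsilon$; 2. for all $\epsilon,\delta\in(0,\frac12]$ and all $n\ge C\epsilon^{-4}\log\frac1\delta$, with probability at least $1-\delta$ over the $n$ samples, the iterates of the empirical algorithm satisfy $\|w^t_2\|_2\le\epsilon$ for all $t\ge C\log\frac1\epsilon$. -/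

import Mathlib

open MeasureTheory ProbabilityTheory
open scoped ENNReal

noncomputable section

namespace SelfTraining

/-- The Euclidean space `ℝ^d`. -/
abbrev Euc (d : ℕ) : Type := EuclideanSpace ℝ (Fin d)

/-- Classifiers `w = (w₁, w₂)` in `ℝ^{d₁ + d₂}`, with the Euclidean norm and inner product. -/
abbrev Weights (d₁ d₂ : ℕ) : Type := WithLp 2 (Euc d₁ × Euc d₂)

/-! ### Sliced log-concave and log-smooth distributions -/

/-- `p` is a positive function on the line whose logarithm is twice differentiable. -/
def HasLogHessian (p : ℝ → ℝ) : Prop :=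
  (∀ t, 0 < p t) ∧ Differentiable ℝ (fun t => Real.log (p t)) ∧
    Differentiable ℝ (deriv fun t => Real.log (p t))

/-- `α`-log-concavity of a density on the line: `(log p)'' ≤ -α`. -/
def LogConcaveDensity (α : ℝ) (p : ℝ → ℝ) : Prop :=
  HasLogHessian p ∧ ∀ t, deriv (deriv fun s => Real.log (p s)) t ≤ -α

/-- `β`-log-smoothness of a density on the line: `|(log p)''| ≤ β`. -/
def LogSmoothDensity (β : ℝ) (p : ℝ → ℝ) : Prop :=
  HasLogHessian p ∧ ∀ t, |deriv (deriv fun s => Real.log (p s)) t| ≤ β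

/-- A distribution `μ` on `ℝ^d` is sliced `α`-log-concave and sliced `β`-log-smooth: for every unit
vector `v`, the law of `vᵀx`, `x ∼ μ`, has a density that is `α`-log-concave and `β`-log-smooth. -/
def SlicedLogConcaveSmooth {d : ℕ} (α β : ℝ) (μ : Measure (Euc d)) : Prop :=
  ∀ v : Euc d, ‖v‖ = 1 → ∃ p : ℝ → ℝ,
    μ.map (fun x => inner ℝ v x) = volume.withDensity (fun t => ENNReal.ofReal (p t)) ∧
      LogConcaveDensity α p ∧ LogSmoothDensity β p

/-! ### The target distribution -/

/-- The law of a labelled target example `((x₁, x₂), y)`: `y` is uniform on `{1, -1}`, given `y` the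
signal `x₁` has law `Dpos` (if `y = 1`) or `Dneg` (if `y = -1`), and `x₂ ∼ N(0, Σ₂)` is independent
of `(x₁, y)`. -/
def targetLaw {d₁ d₂ : ℕ} (Dpos Dneg : Measure (Euc d₁)) (S₂ : Matrix (Fin d₂) (Fin d₂) ℝ) :
    Measure ((Euc d₁ × Euc d₂) × ℝ) :=
  (2⁻¹ : ℝ≥0∞) • (Dpos.prod (multivariateGaussian 0 S₂)).prod (Measure.dirac (1 : ℝ)) +
    (2⁻¹ : ℝ≥0∞) • (Dneg.prod (multivariateGaussian 0 S₂)).prod (Measure.dirac (-1 : ℝ))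

/-- The law of an unlabelled target example `x = (x₁, x₂)`. -/
def inputLaw {d₁ d₂ : ℕ} (Dpos Dneg : Measure (Euc d₁)) (S₂ : Matrix (Fin d₂) (Fin d₂) ℝ) :
    Measure (Euc d₁ × Euc d₂) :=
  (targetLaw Dpos Dneg S₂).map Prod.fst

/-! ### The unlabelled loss and the algorithm -/

/-- `ℓ(t) = exp(-|t|)`. -/
def expLoss (t : ℝ) : ℝ := Real.exp (-|t|)

/-- `ℓ'(t) = -sign(t) exp(-|t|)`, with the value `0` at the kink `t = 0`. -/
def expLossDeriv (t : ℝ) : ℝ := -(SignType.sign t : ℝ) * Real.exp (-|t|)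

/-- The prediction `wᵀx = w₁ᵀx₁ + w₂ᵀx₂`. -/
def predict {d₁ d₂ : ℕ} (w : Weights d₁ d₂) (x : Euc d₁ × Euc d₂) : ℝ :=
  inner ℝ w (WithLp.toLp 2 x)

/-- The population loss `L(w) = E ℓ(wᵀx)` when `x` has law `P`. -/
def popLoss {d₁ d₂ : ℕ} (P : Measure (Euc d₁ × Euc d₂)) (w : Weights d₁ d₂) : ℝ :=
  ∫ x, expLoss (predict w x) ∂P

/-- The empirical loss on the unlabelled samples `X₁, …, Xₙ`. -/
def empLoss {d₁ d₂ n : ℕ} (X : Fin n → Euc d₁ × Euc d₂) (w : Weights d₁ d₂) : ℝ :=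
  (n : ℝ)⁻¹ * ∑ i, expLoss (predict w (X i))

/-- The gradient of the empirical loss, `(1/n) ∑ᵢ ℓ'(wᵀXᵢ) Xᵢ` (a supergradient at a kink). -/
def empGrad {d₁ d₂ n : ℕ} (X : Fin n → Euc d₁ × Euc d₂) (w : Weights d₁ d₂) : Weights d₁ d₂ :=
  (n : ℝ)⁻¹ • ∑ i, expLossDeriv (predict w (X i)) • WithLp.toLp 2 (X i)

theorem hasDerivAt_expLoss {t : ℝ} (ht : t ≠ 0) : HasDerivAt expLoss (expLossDeriv t) t := by
  have h := ((hasDerivAt_abs ht).neg).exp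
  have e : expLossDeriv t = Real.exp (-|t|) * -(SignType.sign t : ℝ) := by
    unfold expLossDeriv; ring
  rw [e]
  exact h

/-- `empGrad` is the gradient of the empirical loss wherever no prediction sits at the kink. -/
theorem hasGradientAt_empLoss {d₁ d₂ n : ℕ} (X : Fin n → Euc d₁ × Euc d₂) (w : Weights d₁ d₂)
    (hw : ∀ i, predict w (X i) ≠ 0) : HasGradientAt (empLoss X) (empGrad X w) w := by
  rw [hasGradientAt_iff_hasFDerivAt]
  have hpred : ∀ i, HasFDerivAt (fun u : Weights d₁ d₂ => predict u (X i))
      (InnerProductSpace.toDual ℝ (Weights d₁ d₂) (WithLp.toLp 2 (X i))) w := by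
    intro i
    have h := (InnerProductSpace.toDual ℝ (Weights d₁ d₂) (WithLp.toLp 2 (X i))).hasFDerivAt (x := w)
    refine h.congr_of_eventuallyEq (Filter.Eventually.of_forall fun u => ?_)
    simp [predict, real_inner_comm]
  have hsum : HasFDerivAt (fun u : Weights d₁ d₂ => ∑ i, expLoss (predict u (X i)))
      (∑ i, expLossDeriv (predict w (X i)) •
        InnerProductSpace.toDual ℝ (Weights d₁ d₂) (WithLp.toLp 2 (X i))) w :=
    HasFDerivAt.fun_sum fun i _ =>
      HasDerivAt.comp_hasFDerivAt (h₂ := expLoss) w (hasDerivAt_expLoss (hw i)) (hpred i)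
  have h := hsum.const_mul ((n : ℝ)⁻¹)
  have e : InnerProductSpace.toDual ℝ (Weights d₁ d₂) (empGrad X w) = (n : ℝ)⁻¹ •
      ∑ i, expLossDeriv (predict w (X i)) •
        InnerProductSpace.toDual ℝ (Weights d₁ d₂) (WithLp.toLp 2 (X i)) := by
    simp [empGrad, map_sum, map_smul]
  rw [e]
  exact h

/-- One step of projected gradient descent with gradient field `g` and step size `η`. -/
def projStep {d₁ d₂ : ℕ} (g : Weights d₁ d₂ → Weights d₁ d₂) (η : ℝ) (w : Weights d₁ d₂) :
    Weights d₁ d₂ :=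
  ‖w - η • g w‖⁻¹ • (w - η • g w)

/-- The iterate `wᵗ` of projected gradient descent started at `w⁰ = ws`. -/
def iterate {d₁ d₂ : ℕ} (g : Weights d₁ d₂ → Weights d₁ d₂) (η : ℝ) (ws : Weights d₁ d₂) :
    ℕ → Weights d₁ d₂
  | 0 => ws
  | t + 1 => projStep g η (iterate g η ws t)

/-- Smoothness of a loss away from the origin: it is differentiable there, with a locally Lipschitz
gradient. (`L` itself always has a kink at the origin, like `w ↦ 1 - E|wᵀx|`.) -/
def SmoothLoss {d₁ d₂ : ℕ} (L : Weights d₁ d₂ → ℝ) : Prop :=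
  (∀ w, w ≠ 0 → DifferentiableAt ℝ L w) ∧ LocallyLipschitzOn {0}ᶜ (gradient L)

/-! ### The threshold `κ` -/

/-- `p⋆(ρ, ν)`. -/
def pStar (ρ ν : ℝ) : ℝ :=
  √ν / (2 * √Real.pi) *
    min 1 (√ν / √ρ * (√Real.pi / (44 * √(2 * ρ))) ^ (8 * ρ / ν))

/-- `κ̃(ρ, ν)`. -/
def kappaTilde (ρ ν : ℝ) : ℝ :=
  min (√Real.pi / (4 * √ρ) * pStar ρ ν ^ (1 - ν / (4 * ρ)) *
      (ν / (2 * √Real.pi)) ^ (ν / (4 * ρ)))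
    (√ν / (8 * √(2 * Real.pi) * (√ρ + √2)) *
      Real.exp (-((√ρ + 4) / (2 * √ν)) ^ 2))

/-- `κ(β, α) = min_{a ∈ [1, 4]} κ̃(aβ, aα)`. -/
def kappa (β α : ℝ) : ℝ :=
  sInf ((fun a : ℝ => kappaTilde (a * β) (a * α)) '' Set.Icc 1 4)

/-! ### The assumptions -/

/-- `P`, the law of `(x₁, x₂)`, satisfies the separation assumption: `x₁` is a mixture, with
weights `τ i`, of `K` sliced `α`-log-concave and `β`-log-smooth distributions `μ i`, and some
classifier `(v, 0)` has loss at most `(min_i τ i) κ`. -/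
structure SeparationAssumption {d₁ d₂ K : ℕ} (P : Measure (Euc d₁ × Euc d₂)) (α β : ℝ)
    (τ : Fin K → ℝ) (μ : Fin K → Measure (Euc d₁)) : Prop where
  weight_nonneg : ∀ i, 0 ≤ τ i
  weight_sum : ∑ i, τ i = 1
  prob : ∀ i, IsProbabilityMeasure (μ i)
  sliced : ∀ i, SlicedLogConcaveSmooth α β (μ i)
  mixture : P.map Prod.fst = ∑ i, ENNReal.ofReal (τ i) • μ i
  separated : ∃ v : Euc d₁, popLoss P (WithLp.toLp 2 (v, 0)) ≤ (⨅ i, τ i) * kappa β α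

/-- The assumption on the source classifier `ws`, which lies in the unit ball: it puts significant
mass on the signal, its output has small variance coming from `x₂`, and its loss is small.
Here `τmin` is the smallest mixture weight. -/
structure SourceAssumption {d₁ d₂ : ℕ} (P : Measure (Euc d₁ × Euc d₂))
    (S₂ : Matrix (Fin d₂) (Fin d₂) ℝ) (α β τmin : ℝ) (ws : Weights d₁ d₂) : Prop where
  norm_le : ‖ws‖ ≤ 1
  signal : 1 / 2 ≤ ‖ws.fst‖
  variance : dotProduct ws.snd.ofLp (S₂.mulVec ws.snd.ofLp) ≤
    3 / 100 * min 1 (min (α / β ^ 2) β⁻¹)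
  loss : popLoss P ws ≤ τmin * kappa β α

end SelfTraining

end

/-! The spurious coordinates enter the population loss only through σ = ‖B w₂‖, where B is the
square root of Σ₂. Since ℓ'' = ℓ - 2δ₀, Gaussian integration by parts gives ∇₂L(w) = r(w) Σ₂ w₂,
where for σ > 0 the factor r(w) is the loss minus twice the density of wᵀx at 0
(`integral_expLossDeriv_mul_gaussian`, `gradient_snd_popLoss`). A gradient step therefore contracts
w₂ by a fixed factor as long as r is bounded below by a positive constant.

The bound on r is a statement about densities on the line (`smoothed_zero_le_loss`). If the loss of
a mixture component is small, its mode is far from 0, so the score b at 0 is large. Log-concavity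
bounds the smoothed density at 0 by p(0) exp(b²σ²/2), with σ² small; log-smoothness forces p to grow
away from 0 almost like p(0) exp(|bx|), so the loss is at least p(0) times a much larger
exponential. Summing over components gives r ≥ L/11 (`loss_le_shrinkRate`), and L is bounded below
on the unit ball.

The conditions behind this bound persist along the iteration. The loss ℓ is semiconcave, its kink
being concave, and it decreases along rays. Hence projected steps do not increase the loss, and
unnormalized steps do not shrink the norm (`IsDescentField`). As ⟨g, w⟩ ≤ 0 while the spurious part
of this product is nonnegative, the signal part of the gradient can only push w₁ outwards
(`norm_fst_le_step`). So the region where the signal dominates is invariant (`InRegion.step`).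

For samples, the same dynamics is run with a gradient error of order ε. The empirical loss is not
smooth, but supergradients of a semiconcave function are within O(θ) of the gradient of a smooth one
once increments of the two functions agree up to θ(‖u‖ + θ) (`IsDescentField.norm_sub_le`). This
holds uniformly for n of order θ⁻⁴ log(1/δ), by a Chernoff bound on pairs and a net
(`exists_uniform_deviation`). The contraction then stops at a multiple of θ, and θ is taken
proportional to ε. -/

noncomputable section

namespace SelfTraining

open Filter Topology
open scoped RealInnerProductSpace

section

/-! ### Strongly log-concave and log-smooth densities on the line -/

section LogConcave

variable {ν ρ : ℝ} {p : ℝ → ℝ}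

theorem HasLogHessian.continuous (h : HasLogHessian p) : Continuous p := by
  have e : p = fun t => Real.exp (Real.log (p t)) := funext fun t => (Real.exp_log (h.1 t)).symm
  rw [e]
  exact Real.continuous_exp.comp h.2.1.continuous

theorem le_tangent_of_concave {φ : ℝ → ℝ} (hφ : Differentiable ℝ φ)
    (hφ' : Differentiable ℝ (deriv φ)) (h : ∀ t, deriv (deriv φ) t ≤ 0) (x y : ℝ) :
    φ x ≤ φ y + deriv φ y * (x - y) := by
  have hc : ConcaveOn ℝ Set.univ φ := concaveOn_univ_of_deriv2_nonpos hφ hφ' (by simpa using h)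
  rcases lt_trichotomy x y with hxy | hxy | hxy
  · have := hc.le_slope_of_hasDerivAt (Set.mem_univ x) (Set.mem_univ y) hxy (hφ y).hasDerivAt
    rw [slope_def_field, le_div_iff₀ (by linarith)] at this
    linarith
  · simp [hxy]
  · have := hc.slope_le_of_hasDerivAt (Set.mem_univ y) (Set.mem_univ x) hxy (hφ y).hasDerivAt
    rw [slope_def_field, div_le_iff₀ (by linarith)] at this
    linarith

theorem le_quadratic_of_deriv2_le {φ : ℝ → ℝ} {c : ℝ} (hφ : Differentiable ℝ φ)
    (hφ' : Differentiable ℝ (deriv φ)) (h : ∀ t, deriv (deriv φ) t ≤ c) (x y : ℝ) :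
    φ x ≤ φ y + deriv φ y * (x - y) + c / 2 * (x - y) ^ 2 := by
  have hd : deriv (fun t => φ t - c / 2 * t ^ 2) = fun t => deriv φ t - c * t := by
    funext t
    have h1 : HasDerivAt (fun t => φ t - c / 2 * t ^ 2) (deriv φ t - c / 2 * (2 * t)) t := by
      simpa using (hφ t).hasDerivAt.fun_sub (((hasDerivAt_pow 2 t)).const_mul (c / 2))
    rw [h1.deriv]; ring
  have hdd : ∀ t, deriv (fun t => deriv φ t - c * t) t = deriv (deriv φ) t - c := fun t => by
    have h1 : HasDerivAt (fun t => deriv φ t - c * t) (deriv (deriv φ) t - c * 1) t :=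
      (hφ' t).hasDerivAt.sub ((hasDerivAt_id t).const_mul c)
    rw [h1.deriv]; ring
  have := le_tangent_of_concave (φ := fun t => φ t - c / 2 * t ^ 2) (by fun_prop)
    (by rw [hd]; fun_prop) (fun t => by rw [hd, hdd]; linarith [h t]) x y
  rw [hd] at this
  simp only at this
  nlinarith [this]

/-- Second-order expansion of log p at y. With y the mode it yields Gaussian tails; with y = 0 it
compares p with an exponential tilt. -/
theorem LogConcaveDensity.le_exp (h : LogConcaveDensity ν p) (x y : ℝ) :
    p x ≤ p y * Real.exp (deriv (fun t => Real.log (p t)) y * (x - y) - ν / 2 * (x - y) ^ 2) := by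
  have := le_quadratic_of_deriv2_le h.1.2.1 h.1.2.2 h.2 x y
  calc p x = Real.exp (Real.log (p x)) := (Real.exp_log (h.1.1 x)).symm
    _ ≤ Real.exp (Real.log (p y) +
        (deriv (fun t => Real.log (p t)) y * (x - y) - ν / 2 * (x - y) ^ 2)) := by
        rw [Real.exp_le_exp]; linarith
    _ = _ := by rw [Real.exp_add, Real.exp_log (h.1.1 y)]

theorem LogSmoothDensity.exp_le (h : LogSmoothDensity ρ p) (x y : ℝ) :
    p y * Real.exp (deriv (fun t => Real.log (p t)) y * (x - y) - ρ / 2 * (x - y) ^ 2) ≤ p x := by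
  have hd : deriv (fun t => -Real.log (p t)) = fun t => -deriv (fun t => Real.log (p t)) t :=
    funext fun t => deriv.fun_neg
  have hdd : ∀ t, deriv (fun t => -deriv (fun t => Real.log (p t)) t) t =
      -deriv (deriv (fun t => Real.log (p t))) t := fun t => deriv.fun_neg
  have := le_quadratic_of_deriv2_le (φ := fun t => -Real.log (p t)) (c := ρ) h.1.2.1.neg
    (by rw [hd]; exact h.1.2.2.neg) (fun t => by
      rw [hd, hdd]; linarith [(abs_le.1 (h.2 t)).1]) x y
  rw [hd] at this
  have e : Real.log (p y) + (deriv (fun t => Real.log (p t)) y * (x - y) - ρ / 2 * (x - y) ^ 2) ≤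
    Real.log (p x) := by simp only at this; linarith
  calc _ = Real.exp (Real.log (p y) +
        (deriv (fun t => Real.log (p t)) y * (x - y) - ρ / 2 * (x - y) ^ 2)) := by
        rw [Real.exp_add, Real.exp_log (h.1.1 y)]
    _ ≤ Real.exp (Real.log (p x)) := Real.exp_le_exp.2 e
    _ = p x := Real.exp_log (h.1.1 x)

/-- A strongly log-concave density has a mode `m`, and its score at `0` is at least `ν |m|`. -/
theorem LogConcaveDensity.exists_mode (h : LogConcaveDensity ν p) (hν : 0 < ν) :
    ∃ m : ℝ, deriv (fun t => Real.log (p t)) m = 0 ∧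
      ν * |m| ≤ |deriv (fun t => Real.log (p t)) 0| := by
  set s := deriv (fun t => Real.log (p t)) with hs
  -- The score decreases at rate at least ν, so it changes sign within distance |s 0| / ν of the
  -- origin.
  have hanti : Antitone fun t => s t + ν * t := by
    apply antitone_of_deriv_nonpos
    · exact h.1.2.2.add (by fun_prop)
    · intro t
      have h1 : HasDerivAt (fun t => s t + ν * t) (deriv s t + ν * 1) t :=
        (h.1.2.2 t).hasDerivAt.add ((hasDerivAt_id t).const_mul ν)
      rw [h1.deriv]
      linarith [h.2 t]
  have hc : Continuous s := h.1.2.2.continuous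
  obtain ⟨m, hm⟩ : ∃ m, s m = 0 := by
    apply mem_range_of_exists_le_of_exists_ge hc
    · refine ⟨|s 0| / ν, ?_⟩
      have := hanti (show (0 : ℝ) ≤ |s 0| / ν by positivity)
      simp only at this
      rw [mul_div_cancel₀ _ hν.ne'] at this
      linarith [le_abs_self (s 0)]
    · refine ⟨-(|s 0| / ν), ?_⟩
      have := hanti (show -(|s 0| / ν) ≤ 0 by have : 0 ≤ |s 0| / ν := by positivity
                                              linarith)
      simp only [mul_neg] at this
      rw [mul_div_cancel₀ _ hν.ne'] at this
      linarith [neg_abs_le (s 0)]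
  refine ⟨m, hm, ?_⟩
  rcases le_total 0 m with h0 | h0
  · have := hanti h0
    simp only [hm] at this
    rw [abs_of_nonneg h0]
    linarith [le_abs_self (s 0)]
  · have := hanti h0
    simp only [hm] at this
    rw [abs_of_nonpos h0]
    linarith [neg_abs_le (s 0)]

theorem integral_exp_neg_sub_sq (m : ℝ) :
    ∫ x, Real.exp (-(ν / 2) * (x - m) ^ 2) = √(2 * Real.pi / ν) := by
  rw [integral_sub_right_eq_self (fun x => Real.exp (-(ν / 2) * x ^ 2)), integral_gaussian]
  congr 1
  field_simp

/-- The density lies below p(m) times an unnormalized Gaussian of variance 1/ν centred at the mode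
m, and has total mass 1. -/
theorem LogConcaveDensity.mode_ge (h : LogConcaveDensity ν p) (hν : 0 < ν)
    (hint : ∫ t, p t = 1) {m : ℝ} (hm : deriv (fun t => Real.log (p t)) m = 0) :
    √ν / √(2 * Real.pi) ≤ p m := by
  have hb : ∀ x, p x ≤ p m * Real.exp (-(ν / 2) * (x - m) ^ 2) := fun x => by
    refine (h.le_exp x m).trans_eq ?_
    rw [hm]; congr 2; ring
  have hI : Integrable fun x => Real.exp (-(ν / 2) * (x - m) ^ 2) :=
    (integrable_exp_neg_mul_sq (half_pos hν)).comp_sub_right m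
  have h1 : (1 : ℝ) ≤ p m * √(2 * Real.pi / ν) := by
    rw [← hint, ← integral_exp_neg_sub_sq m, ← integral_const_mul]
    exact integral_mono (integrable_of_integral_eq_one hint) (hI.const_mul _) hb
  have h2 : √(2 * Real.pi / ν) = √(2 * Real.pi) / √ν := Real.sqrt_div' _ hν.le
  have h3 : 0 < √ν := Real.sqrt_pos.2 hν
  have h4 : 0 < √(2 * Real.pi) := by positivity
  rw [div_le_iff₀ h4]
  rw [h2, ← mul_div_assoc, le_div_iff₀ h3] at h1
  linarith

end LogConcave

/-! ### Gaussian smoothing of the loss -/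

section Smoothing

/-- `E ℓ(x + σ Z)` for a standard normal variable `Z`. -/
def smoothedLoss (σ x : ℝ) : ℝ := ∫ z, expLoss (x + σ * z) ∂gaussianReal 0 1

/-- The density at `x` of `σ Z` for a standard normal variable `Z`. -/
def gaussKernel (σ x : ℝ) : ℝ := σ⁻¹ * gaussianPDFReal 0 1 (σ⁻¹ * x)

theorem continuous_expLoss : Continuous expLoss := by unfold expLoss; fun_prop

theorem expLoss_pos (t : ℝ) : 0 < expLoss t := Real.exp_pos _

theorem expLoss_le_one (t : ℝ) : expLoss t ≤ 1 := by
  unfold expLoss; rw [Real.exp_le_one_iff]; linarith [abs_nonneg t]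

theorem abs_expLoss_le_one (t : ℝ) : |expLoss t| ≤ 1 := by
  rw [abs_of_pos (expLoss_pos t)]; exact expLoss_le_one t

theorem integrable_expLoss_comp {X : Type*} [MeasurableSpace X] {Q : Measure X} [IsFiniteMeasure Q]
    {f : X → ℝ} (hf : Measurable f) : Integrable (fun x => expLoss (f x)) Q :=
  Integrable.of_bound (continuous_expLoss.measurable.comp hf).aestronglyMeasurable 1
    (ae_of_all _ fun _ => abs_expLoss_le_one _)

theorem integral_sq_gaussian : ∫ z, z ^ 2 ∂gaussianReal 0 1 = 1 := by
  have := variance_fun_id_gaussianReal (μ := 0) (v := 1)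
  rw [variance_eq_integral (by fun_prop)] at this
  simpa using this

theorem integrable_sq_gaussian : Integrable (fun z : ℝ => z ^ 2) (gaussianReal 0 1) :=
  (memLp_id_gaussianReal' (μ := 0) (v := 1) 2 (by simp)).integrable_sq

theorem integrable_abs_gaussian : Integrable (fun z : ℝ => |z|) (gaussianReal 0 1) :=
  ((memLp_id_gaussianReal' (μ := 0) (v := 1) 1 (by simp)).integrable le_rfl).abs

theorem integral_abs_gaussian_le : ∫ z, |z| ∂gaussianReal 0 1 ≤ 1 := by
  calc ∫ z, |z| ∂gaussianReal 0 1 ≤ ∫ z, (1 / 2 + 1 / 2 * z ^ 2) ∂gaussianReal 0 1 := by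
        refine integral_mono integrable_abs_gaussian
          ((integrable_const _).add (integrable_sq_gaussian.const_mul _)) fun z => ?_
        simp only
        nlinarith [sq_nonneg (|z| - 1), sq_abs z]
    _ = 1 := by
        rw [integral_add (integrable_const _) (integrable_sq_gaussian.const_mul _),
          integral_const_mul, integral_sq_gaussian]
        simp; norm_num

/-- The triangle inequality gives ℓ(x + σz) ≥ ℓ(x) exp(-σ|z|) ≥ ℓ(x)(1 - σ|z|), and E|Z| ≤ 1.
Smoothing thus costs only a constant factor. -/
theorem mul_expLoss_le_smoothedLoss {σ : ℝ} (hσ : 0 ≤ σ) (x : ℝ) :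
    (1 - σ) * expLoss x ≤ smoothedLoss σ x := by
  have hI : Integrable (fun z : ℝ => 1 - σ * |z|) (gaussianReal 0 1) :=
    (integrable_const _).sub (integrable_abs_gaussian.const_mul _)
  calc (1 - σ) * expLoss x ≤ (∫ z, (1 - σ * |z|) ∂gaussianReal 0 1) * expLoss x := by
        refine mul_le_mul_of_nonneg_right ?_ (expLoss_pos x).le
        rw [integral_sub (integrable_const _) (integrable_abs_gaussian.const_mul _),
          integral_const_mul]
        simp only [integral_const, probReal_univ, smul_eq_mul, one_mul, sub_le_sub_iff_left]
        nlinarith [integral_abs_gaussian_le]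
    _ = ∫ z, (1 - σ * |z|) * expLoss x ∂gaussianReal 0 1 := by rw [integral_mul_const]
    _ ≤ smoothedLoss σ x := by
        refine integral_mono (hI.mul_const _) (integrable_expLoss_comp (by fun_prop)) fun z => ?_
        simp only
        have h1 : 1 - σ * |z| ≤ Real.exp (-(σ * |z|)) := by
          linarith [Real.add_one_le_exp (-(σ * |z|))]
        refine (mul_le_mul_of_nonneg_right h1 (expLoss_pos x).le).trans ?_
        unfold expLoss
        rw [← Real.exp_add, Real.exp_le_exp]
        have := abs_add_le x (σ * z)
        rw [abs_mul, abs_of_nonneg hσ] at this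
        linarith

theorem smoothedLoss_nonneg (σ x : ℝ) : 0 ≤ smoothedLoss σ x :=
  integral_nonneg fun _ => (expLoss_pos _).le

theorem smoothedLoss_le_one (σ x : ℝ) : smoothedLoss σ x ≤ 1 := by
  calc smoothedLoss σ x ≤ ∫ _, 1 ∂gaussianReal 0 1 :=
        integral_mono (integrable_expLoss_comp (by fun_prop)) (integrable_const _)
          fun z => expLoss_le_one _
    _ = 1 := by simp

theorem measurable_smoothedLoss (σ : ℝ) : Measurable (smoothedLoss σ) := by
  have : StronglyMeasurable fun q : ℝ × ℝ => expLoss (q.1 + σ * q.2) :=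
    (continuous_expLoss.comp (by fun_prop : Continuous fun q : ℝ × ℝ => q.1 + σ * q.2)).stronglyMeasurable
  exact this.integral_prod_right'.measurable

theorem integrable_exp_mul_gaussKernel {σ : ℝ} (hσ : 0 < σ) (b : ℝ) :
    Integrable (fun x => Real.exp (b * x) * gaussKernel σ x) ∧
    ∫ x, Real.exp (b * x) * gaussKernel σ x = Real.exp (b ^ 2 * σ ^ 2 / 2) := by
  have e : (fun x => Real.exp (b * x) * gaussKernel σ x) = fun x => σ⁻¹ *
      (fun z => gaussianPDFReal 0 1 z * Real.exp (b * σ * z)) (σ⁻¹ * x) := by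
    funext x
    simp only [gaussKernel]
    rw [show b * σ * (σ⁻¹ * x) = b * x by field_simp]
    ring
  have hI : Integrable fun z => gaussianPDFReal 0 1 z * Real.exp (b * σ * z) := by
    have h := integrable_exp_mul_gaussianReal (μ := 0) (v := 1) (b * σ)
    rw [gaussianReal_of_var_ne_zero 0 one_ne_zero,
      integrable_withDensity_iff_integrable_smul' (measurable_gaussianPDF 0 1)
      (ae_of_all _ fun _ => gaussianPDF_lt_top)] at h
    simpa [toReal_gaussianPDF] using h
  have hv : ∫ z, gaussianPDFReal 0 1 z * Real.exp (b * σ * z) = Real.exp (b ^ 2 * σ ^ 2 / 2) := by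
    have h := congrFun (mgf_fun_id_gaussianReal (μ := 0) (v := 1)) (b * σ)
    rw [mgf, integral_gaussianReal_eq_integral_smul one_ne_zero] at h
    simp only [smul_eq_mul] at h
    rw [h]
    congr 1
    simp; ring
  rw [e]
  refine ⟨(hI.comp_mul_left' (inv_ne_zero hσ.ne')).const_mul _, ?_⟩
  rw [integral_const_mul, Measure.integral_comp_mul_left
    (fun z => gaussianPDFReal 0 1 z * Real.exp (b * σ * z)), hv]
  rw [inv_inv, abs_of_pos hσ, smul_eq_mul, ← mul_assoc, inv_mul_cancel₀ hσ.ne', one_mul]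

theorem gaussKernel_nonneg {σ : ℝ} (hσ : 0 ≤ σ) (x : ℝ) : 0 ≤ gaussKernel σ x :=
  mul_nonneg (inv_nonneg.2 hσ) (gaussianPDFReal_nonneg _ _ _)

theorem measurable_gaussKernel (σ : ℝ) : Measurable (gaussKernel σ) :=
  ((measurable_gaussianPDFReal 0 1).comp (measurable_const_mul _)).const_mul _

end Smoothing

end

/-! ### Small loss dominates the smoothed density at the origin -/

section

theorem mul_le_integral_of_le_on_interval {f : ℝ → ℝ} (hf : Integrable f) (h0 : ∀ x, 0 ≤ f x)
    {a r c : ℝ} (hr : 0 ≤ r) (h : ∀ x, |x - a| ≤ r → c ≤ f x) : 2 * r * c ≤ ∫ x, f x := by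
  calc 2 * r * c = ∫ _ in Set.Icc (a - r) (a + r), c := by
        rw [setIntegral_const]
        simp only [Measure.real, Real.volume_Icc, smul_eq_mul]
        rw [ENNReal.toReal_ofReal (by linarith)]; ring
    _ ≤ ∫ x in Set.Icc (a - r) (a + r), f x := by
        refine setIntegral_mono_on (integrableOn_const (by simp)) hf.integrableOn
          measurableSet_Icc fun x hx => h x ?_
        rw [abs_le]; constructor <;> linarith [hx.1, hx.2]
    _ ≤ ∫ x, f x := setIntegral_le_integral hf (ae_of_all _ h0)

/-- The numerical core of the comparison, with s = √ρ and b the absolute score at 0. In terms of y =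
b/s ≥ 4 the exponents are 0.06 y² and about 9/32 y²; the surplus absorbs the prefactor s ≤ 4y - 8.
-/
theorem exp_gap {s b : ℝ} (hs : 0 < s) (hb : (s + 4) ^ 2 / 4 ≤ b) :
    2.2 * Real.exp (0.06 * (b / s) ^ 2) ≤
      0.65 * (2 * s⁻¹ * Real.exp ((b - 1) ^ 2 / (2 * s ^ 2) - 1 / 2)) := by
  set y := b / s with hy
  have hby : b = y * s := by rw [hy]; field_simp
  have h1 : s + 8 ≤ 4 * y := by
    have : (s + 4) ^ 2 ≤ 4 * (y * s) := by rw [← hby]; linarith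
    nlinarith
  have h2 : 4 ≤ y := by
    have : (s + 4) ^ 2 ≤ 4 * (y * s) := by rw [← hby]; linarith
    nlinarith [sq_nonneg (s - 4)]
  have h3 : 4 ≤ b := by nlinarith [sq_nonneg s]
  have h4 : 9 / 32 * y ^ 2 ≤ (b - 1) ^ 2 / (2 * s ^ 2) := by
    rw [le_div_iff₀ (by positivity)]
    have : 9 / 32 * y ^ 2 * (2 * s ^ 2) = 9 / 16 * b ^ 2 := by rw [hby]; ring
    rw [this]; nlinarith
  -- The quadratic (9/32 - 0.06) y² - 1/2 is bounded below by a line near its tangent at y = 4. The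
  -- exponential of that line is then replaced by a linear function, enough to beat s.
  have h5 : Real.exp 3 * (1 + 1.76 * (y - 4)) * Real.exp (0.06 * y ^ 2) ≤
      Real.exp ((b - 1) ^ 2 / (2 * s ^ 2) - 1 / 2) := by
    calc Real.exp 3 * (1 + 1.76 * (y - 4)) * Real.exp (0.06 * y ^ 2) ≤
        Real.exp 3 * Real.exp (1.76 * (y - 4)) * Real.exp (0.06 * y ^ 2) := by
          gcongr; linarith [Real.add_one_le_exp (1.76 * (y - 4))]
      _ = Real.exp (3 + 1.76 * (y - 4) + 0.06 * y ^ 2) := by rw [Real.exp_add, Real.exp_add]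
      _ ≤ _ := by
          rw [Real.exp_le_exp]; nlinarith [sq_nonneg (y - 4)]
  have h6 : (19 : ℝ) ≤ Real.exp 3 := by
    have h : Real.exp 3 = Real.exp 1 ^ 3 := by rw [← Real.exp_nat_mul]; norm_num
    rw [h]
    calc (19 : ℝ) ≤ 2.7 ^ 3 := by norm_num
      _ ≤ _ := by gcongr; linarith [Real.exp_one_gt_d9]
  have h7 : 2.2 * s * Real.exp (0.06 * y ^ 2) ≤
      1.3 * Real.exp ((b - 1) ^ 2 / (2 * s ^ 2) - 1 / 2) := by
    refine le_trans ?_ (mul_le_mul_of_nonneg_left h5 (by norm_num))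
    rw [← mul_assoc]
    refine mul_le_mul_of_nonneg_right ?_ (Real.exp_pos _).le
    have : 19 * (1 + 1.76 * (y - 4)) ≤ Real.exp 3 * (1 + 1.76 * (y - 4)) :=
      mul_le_mul_of_nonneg_right h6 (by linarith)
    nlinarith
  have e : 0.65 * (2 * s⁻¹ * Real.exp ((b - 1) ^ 2 / (2 * s ^ 2) - 1 / 2)) =
      1.3 * Real.exp ((b - 1) ^ 2 / (2 * s ^ 2) - 1 / 2) / s := by
    field_simp; norm_num
  rw [e, le_div_iff₀ hs]
  linarith

variable {ν ρ σ : ℝ} {p : ℝ → ℝ}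

theorem integrable_mul_expLoss (hint : ∫ t, p t = 1) :
    Integrable fun x => p x * expLoss x :=
  (integrable_of_integral_eq_one hint).mul_bdd (c := 1)
    continuous_expLoss.aestronglyMeasurable (ae_of_all _ abs_expLoss_le_one)

theorem integrable_mul_smoothedLoss (hint : ∫ t, p t = 1) :
    Integrable fun x => p x * smoothedLoss σ x :=
  (integrable_of_integral_eq_one hint).mul_bdd (c := 1)
    (measurable_smoothedLoss σ).aestronglyMeasurable (ae_of_all _ fun x => by
      rw [Real.norm_eq_abs, abs_of_nonneg (smoothedLoss_nonneg _ _)]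
      exact smoothedLoss_le_one _ _)

theorem mul_integral_expLoss_le (hp : HasLogHessian p) (hσ : 0 ≤ σ) (hint : ∫ t, p t = 1) :
    (1 - σ) * ∫ x, p x * expLoss x ≤ ∫ x, p x * smoothedLoss σ x := by
  rw [← integral_const_mul]
  refine integral_mono ((integrable_mul_expLoss hint).const_mul _)
    (integrable_mul_smoothedLoss hint) fun x => ?_
  simp only
  rw [mul_left_comm]
  exact mul_le_mul_of_nonneg_left (mul_expLoss_le_smoothedLoss hσ x) (hp.1 x).le

/-- The loss of a log-smooth density is at least of the order of `exp (-|m|)`, `m` the mode. -/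
theorem LogSmoothDensity.mode_le_loss (h : LogSmoothDensity ρ p) (hρ : 0 < ρ)
    (hint : ∫ t, p t = 1) {m : ℝ} (hm : deriv (fun t => Real.log (p t)) m = 0) :
    2 * (1 + √ρ)⁻¹ * (p m * Real.exp (-|m| - 1)) ≤ ∫ x, p x * expLoss x := by
  have hs : 0 < √ρ := Real.sqrt_pos.2 hρ
  -- On the interval of radius k = 1/(1 + √ρ) around the mode, p and ℓ together lose a factor at
  -- most e: the exponent (1 - k)²/2 + k is at most 1.
  refine mul_le_integral_of_le_on_interval (a := m) (integrable_mul_expLoss hint)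
    (fun x => mul_nonneg (h.1.1 x).le (expLoss_pos x).le) (by positivity) fun x hx => ?_
  have h1 := h.exp_le x m
  rw [hm, zero_mul, zero_sub] at h1
  refine le_trans ?_ (mul_le_mul_of_nonneg_right h1 (expLoss_pos x).le)
  rw [mul_assoc]
  refine mul_le_mul_of_nonneg_left ?_ (h.1.1 m).le
  unfold expLoss
  rw [← Real.exp_add, Real.exp_le_exp]
  set k := (1 + √ρ)⁻¹ with hk
  have hk0 : 0 < k := by positivity
  have hsk : √ρ * k = 1 - k := by rw [hk]; field_simp; ring
  have hk1 : k ≤ 1 := by have : 0 < √ρ * k := by positivity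
                         linarith
  have h2 : ρ * (x - m) ^ 2 ≤ (1 - k) ^ 2 := by
    rw [← hsk, mul_pow, Real.sq_sqrt hρ.le, ← sq_abs (x - m)]
    gcongr
  have h3 : |x| ≤ |m| + k := by
    have := abs_add_le m (x - m)
    rw [add_sub_cancel] at this
    linarith
  nlinarith

/-- Away from the mode, the loss of a log-smooth density dominates its value at `0`. -/
theorem LogSmoothDensity.zero_le_loss (h : LogSmoothDensity ρ p) (hρ : 0 < ρ)
    (hint : ∫ t, p t = 1) (hb : 1 + √ρ ≤ |deriv (fun t => Real.log (p t)) 0|) :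
    2 * (√ρ)⁻¹ * (p 0 * Real.exp ((|deriv (fun t => Real.log (p t)) 0| - 1) ^ 2 / (2 * √ρ ^ 2) - 1 / 2))
      ≤ ∫ x, p x * expLoss x := by
  set b := deriv (fun t => Real.log (p t)) 0 with hbdef
  have hs : 0 < √ρ := Real.sqrt_pos.2 hρ
  obtain ⟨s, hs1, hsb⟩ : ∃ s : ℝ, s ^ 2 = 1 ∧ b = s * |b| := by
    rcases le_total 0 b with h0 | h0
    · exact ⟨1, by norm_num, by rw [abs_of_nonneg h0]; ring⟩
    · exact ⟨-1, by norm_num, by rw [abs_of_nonpos h0]; ring⟩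
  have habs : |s| = 1 := by rw [← sq_eq_sq₀ (abs_nonneg s) zero_le_one, sq_abs, hs1, one_pow]
  -- The centre maximizes bx - ρx²/2 - |x|, and a deviation of 1/√ρ costs at most 1/2 in the
  -- exponent. The hypothesis |b| ≥ 1 + √ρ keeps the interval on one side of 0, where |x| is linear.
  refine mul_le_integral_of_le_on_interval (a := s * ((|b| - 1) / ρ))
    (integrable_mul_expLoss hint)
    (fun x => mul_nonneg (h.1.1 x).le (expLoss_pos x).le) (by positivity) fun x hx => ?_
  have h1 := h.exp_le x 0
  rw [← hbdef] at h1
  refine le_trans ?_ (mul_le_mul_of_nonneg_right h1 (expLoss_pos x).le)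
  rw [mul_assoc]
  refine mul_le_mul_of_nonneg_left ?_ (h.1.1 0).le
  unfold expLoss
  rw [← Real.exp_add, Real.exp_le_exp]
  have hxy : x = s * (s * x) := by rw [← mul_assoc, ← sq, hs1, one_mul]
  set y := s * x with hy
  have hyx : |y - (|b| - 1) / ρ| ≤ (√ρ)⁻¹ := by
    refine le_trans (le_of_eq ?_) hx
    rw [hxy, ← mul_sub, abs_mul, habs, one_mul]
  have hy0 : 0 ≤ y := by
    have h2 := (abs_le.1 hyx).1
    have h3 : (√ρ)⁻¹ ≤ (|b| - 1) / ρ := by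
      rw [le_div_iff₀ hρ]
      nth_rewrite 2 [← Real.mul_self_sqrt hρ.le]
      rw [inv_mul_cancel_left₀ hs.ne']
      linarith
    linarith
  have hxa : |x| = y := by rw [hxy, abs_mul, habs, one_mul, abs_of_nonneg hy0]
  have hbx : b * x = |b| * y := by
    rw [hy, ← mul_assoc, mul_comm |b| s, ← hsb]
  have hsq : ρ * (y - (|b| - 1) / ρ) ^ 2 ≤ 1 := by
    calc ρ * (y - (|b| - 1) / ρ) ^ 2 ≤ ρ * ((√ρ)⁻¹) ^ 2 := by
          rw [← sq_abs (y - _)]; gcongr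
      _ = 1 := by rw [inv_pow, Real.sq_sqrt hρ.le, mul_inv_cancel₀ hρ.ne']
  have e : (|b| - 1) ^ 2 / (2 * √ρ ^ 2) =
      ρ / 2 * (y - (|b| - 1) / ρ) ^ 2 + (|b| - 1) * y - ρ / 2 * y ^ 2 := by
    rw [Real.sq_sqrt hρ.le]; field_simp; ring
  have hx2 : x ^ 2 = y ^ 2 := by rw [← hxa, sq_abs]
  rw [e, sub_zero, hbx, hxa, hx2]
  linarith

/-- A smoothed log-concave density is at most `p(0) exp(b² σ² / 2)` at `0`, `b` the score at `0`. -/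
theorem LogConcaveDensity.smoothed_zero_le (h : LogConcaveDensity ν p) (hν : 0 ≤ ν) (hσ : 0 < σ) :
    ∫ x, p x * gaussKernel σ x ≤
      p 0 * Real.exp (deriv (fun t => Real.log (p t)) 0 ^ 2 * σ ^ 2 / 2) := by
  set b := deriv (fun t => Real.log (p t)) 0 with hbdef
  obtain ⟨hI, hv⟩ := integrable_exp_mul_gaussKernel hσ b
  rw [← hv, ← integral_const_mul]
  have hle : ∀ x, p x * gaussKernel σ x ≤ p 0 * (Real.exp (b * x) * gaussKernel σ x) := fun x => by
    rw [← mul_assoc]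
    refine mul_le_mul_of_nonneg_right ((h.le_exp x 0).trans ?_) (gaussKernel_nonneg hσ.le x)
    refine mul_le_mul_of_nonneg_left ?_ (h.1.1 0).le
    rw [Real.exp_le_exp, sub_zero, ← hbdef]
    nlinarith [sq_nonneg x]
  refine integral_mono ((hI.const_mul (p 0)).mono' ?_ (ae_of_all _ fun x => ?_)) (hI.const_mul _) hle
  · exact (h.1.continuous.measurable.mul (measurable_gaussKernel σ)).aestronglyMeasurable
  · rw [Real.norm_eq_abs, abs_of_nonneg (mul_nonneg (h.1.1 x).le (gaussKernel_nonneg hσ.le x))]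
    exact hle x

/-- If the loss of the smoothing of a log-concave, log-smooth density is below the threshold, then
it dominates the value at `0` of the smoothed density. -/
theorem smoothed_zero_le_loss (hc : LogConcaveDensity ν p) (hl : LogSmoothDensity ρ p) (hν : 0 < ν)
    (hρ : 0 < ρ) (hint : ∫ t, p t = 1) (hσ : 0 < σ) (hσ1 : σ ^ 2 ≤ 0.12)
    (hσ2 : σ ^ 2 ≤ 0.12 * ρ⁻¹) (hloss : ∫ x, p x * smoothedLoss σ x ≤ 2 * kappaTilde ρ ν) :
    2.2 * ∫ x, p x * gaussKernel σ x ≤ ∫ x, p x * smoothedLoss σ x := by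
  obtain ⟨m, hm, hmb⟩ := hc.exists_mode hν
  set b := deriv (fun t => Real.log (p t)) 0 with hbdef
  have hs : 0 < √ρ := Real.sqrt_pos.2 hρ
  have hsν : 0 < √ν := Real.sqrt_pos.2 hν
  -- The bound σ² ≤ 0.12 gives σ ≤ 0.35.
  have hσ3 : 0.65 ≤ 1 - σ := by nlinarith
  have hJ := mul_integral_expLoss_le hl.1 hσ.le hint
  have hL0 : 0 ≤ ∫ x, p x * expLoss x :=
    integral_nonneg fun x => mul_nonneg (hc.1.1 x).le (expLoss_pos x).le
  have hJ' : 0.65 * ∫ x, p x * expLoss x ≤ ∫ x, p x * smoothedLoss σ x :=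
    (mul_le_mul_of_nonneg_right hσ3 hL0).trans hJ
  -- The loss is at least a constant times exp(-|m|), whereas the exponential branch of the minimum
  -- defining κ̃ is the same constant, up to a numerical factor, times exp(-A). Comparing the two
  -- pushes the mode away from 0.
  have hmA : ((√ρ + 4) / (2 * √ν)) ^ 2 ≤ |m| := by
    set A := ((√ρ + 4) / (2 * √ν)) ^ 2 with hA
    have h1 := hl.mode_le_loss hρ hint hm
    have h2 := hc.mode_ge hν hint hm
    have h3 : kappaTilde ρ ν ≤ √ν / (8 * √(2 * Real.pi) * (√ρ + √2)) * Real.exp (-A) :=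
      min_le_right _ _
    set q := √ν / √(2 * Real.pi) with hq
    have hq0 : 0 < q := by positivity
    have h4 : 2 * (1 + √ρ)⁻¹ * (q * Real.exp (-|m| - 1)) ≤
        2 * (1 + √ρ)⁻¹ * (p m * Real.exp (-|m| - 1)) := by gcongr
    have e1 : √ν / (8 * √(2 * Real.pi) * (√ρ + √2)) = q * (8 * (√ρ + √2))⁻¹ := by
      rw [hq]; field_simp
    rw [e1] at h3
    have h5 : (8 * (√ρ + √2))⁻¹ ≤ (8 * (1 + √ρ))⁻¹ := by
      have : (1 : ℝ) ≤ √2 := Real.one_le_sqrt.2 (by norm_num)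
      exact inv_anti₀ (by positivity) (by linarith)
    have h6 : q * (8 * (√ρ + √2))⁻¹ * Real.exp (-A) ≤ q * (8 * (1 + √ρ))⁻¹ * Real.exp (-A) := by
      gcongr
    have h7 : 0.65 * (2 * (1 + √ρ)⁻¹ * (q * Real.exp (-|m| - 1))) ≤
        2 * (q * (8 * (1 + √ρ))⁻¹ * Real.exp (-A)) := by linarith
    have h8 : 0.65 * (2 * (1 + √ρ)⁻¹ * (q * Real.exp (-|m| - 1))) =
        q * (1 + √ρ)⁻¹ * (1.3 * Real.exp (-|m| - 1)) := by ring
    have h9 : 2 * (q * (8 * (1 + √ρ))⁻¹ * Real.exp (-A)) =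
        q * (1 + √ρ)⁻¹ * (1 / 4 * Real.exp (-A)) := by rw [mul_inv]; ring
    rw [h8, h9] at h7
    have h10 := le_of_mul_le_mul_left h7 (by positivity)
    rw [sub_eq_add_neg, Real.exp_add] at h10
    have h11 : (1 / 4 : ℝ) ≤ Real.exp (-1) := by
      rw [Real.exp_neg, ← one_div]
      gcongr
      linarith [Real.exp_one_lt_d9]
    have h12 : Real.exp (-|m|) ≤ Real.exp (-A) := by
      nlinarith [Real.exp_pos (-|m|), Real.exp_pos (-A)]
    linarith [Real.exp_le_exp.1 h12]
  have hbA : (√ρ + 4) ^ 2 / 4 ≤ |b| := by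
    refine le_trans ?_ hmb
    have e : (√ρ + 4) ^ 2 / 4 = ν * ((√ρ + 4) / (2 * √ν)) ^ 2 := by
      rw [div_pow, mul_pow, Real.sq_sqrt hν.le]; field_simp; norm_num
    rw [e]; gcongr
  have h1 := hl.zero_le_loss hρ hint (by rw [← hbdef]; nlinarith)
  have h2 := hc.smoothed_zero_le hν.le hσ
  rw [← hbdef] at h1 h2
  have hgap := exp_gap hs hbA
  -- Here σ² ≤ 0.12/ρ enters: half of 0.12 is the constant 0.06 of `exp_gap`.
  have h3 : b ^ 2 * σ ^ 2 / 2 ≤ 0.06 * (|b| / √ρ) ^ 2 := by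
    rw [div_pow, sq_abs, Real.sq_sqrt hρ.le, div_eq_mul_inv (b ^ 2)]
    nlinarith [mul_le_mul_of_nonneg_left hσ2 (sq_nonneg b)]
  calc 2.2 * ∫ x, p x * gaussKernel σ x
      ≤ 2.2 * (p 0 * Real.exp (0.06 * (|b| / √ρ) ^ 2)) := by
        refine mul_le_mul_of_nonneg_left (h2.trans ?_) (by norm_num)
        exact mul_le_mul_of_nonneg_left (Real.exp_le_exp.2 h3) (hc.1.1 0).le
    _ = p 0 * (2.2 * Real.exp (0.06 * (|b| / √ρ) ^ 2)) := by ring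
    _ ≤ p 0 * _ := mul_le_mul_of_nonneg_left hgap (hc.1.1 0).le
    _ = 0.65 * (2 * (√ρ)⁻¹ * (p 0 * Real.exp ((|b| - 1) ^ 2 / (2 * √ρ ^ 2) - 1 / 2))) := by ring
    _ ≤ 0.65 * ∫ x, p x * expLoss x := by gcongr
    _ ≤ _ := hJ'

end

/-! ### Gaussian integration by parts and the derivative in the noise level -/

section

theorem integrable_gaussianReal_iff {f : ℝ → ℝ} :
    Integrable f (gaussianReal 0 1) ↔ Integrable fun z => gaussianPDFReal 0 1 z * f z := by
  rw [gaussianReal_of_var_ne_zero 0 one_ne_zero,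
    integrable_withDensity_iff_integrable_smul' (measurable_gaussianPDF 0 1)
      (ae_of_all _ fun _ => gaussianPDF_lt_top)]
  simp [toReal_gaussianPDF]

theorem hasDerivAt_gaussianPDFReal (z : ℝ) :
    HasDerivAt (gaussianPDFReal 0 1) (-z * gaussianPDFReal 0 1 z) z := by
  have e : gaussianPDFReal 0 1 = fun z => (√(2 * Real.pi))⁻¹ * Real.exp (-z ^ 2 / 2) := by
    funext z; simp [gaussianPDFReal]
  rw [e]
  have h : HasDerivAt (fun z : ℝ => -z ^ 2 / 2) (-z) z := by
    refine (((hasDerivAt_pow 2 z).fun_neg).div_const 2).congr_deriv ?_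
    simp; ring
  refine (h.exp.const_mul (√(2 * Real.pi))⁻¹).congr_deriv ?_
  ring

theorem integrable_exp_gaussianPDF (c d : ℝ) :
    Integrable (fun z => Real.exp (c + d * z) * gaussianPDFReal 0 1 z) ∧
    Integrable (fun z => Real.exp (c + d * z) * (z * gaussianPDFReal 0 1 z)) := by
  have h1 : ∀ c d : ℝ, Integrable (fun z => Real.exp (c + d * z) * gaussianPDFReal 0 1 z) := by
    intro c d
    have h := integrable_gaussianReal_iff.1 (integrable_exp_mul_gaussianReal (μ := 0) (v := 1) d)
    refine (h.const_mul (Real.exp c)).congr (ae_of_all _ fun z => ?_)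
    simp only [Real.exp_add]; ring
  refine ⟨h1 c d, ((h1 c (d + 1)).add (h1 c (d - 1))).mono' ?_ (ae_of_all _ fun z => ?_)⟩
  · have := measurable_gaussianPDFReal 0 1
    fun_prop
  · have hφ := gaussianPDFReal_nonneg 0 1 z
    rw [norm_mul, norm_mul, Real.norm_eq_abs, Real.norm_eq_abs, Real.norm_eq_abs, Real.abs_exp,
      abs_of_nonneg hφ, Pi.add_apply, ← mul_assoc, ← add_mul]
    refine mul_le_mul_of_nonneg_right ?_ hφ
    rw [show c + (d + 1) * z = c + d * z + z by ring, show c + (d - 1) * z = c + d * z + -z by ring,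
      Real.exp_add _ z, Real.exp_add _ (-z), ← mul_add]
    refine mul_le_mul_of_nonneg_left ?_ (Real.exp_pos _).le
    rcases abs_cases z with h | h <;>
      linarith [Real.add_one_le_exp z, Real.add_one_le_exp (-z), Real.exp_pos z, Real.exp_pos (-z)]

theorem hasDerivAt_exp_mul_gaussianPDF (c d z : ℝ) :
    HasDerivAt (fun z => Real.exp (c + d * z) * gaussianPDFReal 0 1 z)
      (d * (Real.exp (c + d * z) * gaussianPDFReal 0 1 z) -
        Real.exp (c + d * z) * (z * gaussianPDFReal 0 1 z)) z := by
  have h : HasDerivAt (fun z : ℝ => c + d * z) d z := by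
    simpa using ((hasDerivAt_id z).const_mul d).const_add c
  refine (h.exp.fun_mul (hasDerivAt_gaussianPDFReal z)).congr_deriv ?_
  ring

theorem integrable_deriv_exp_mul_gaussianPDF (c d : ℝ) :
    Integrable (fun z => d * (Real.exp (c + d * z) * gaussianPDFReal 0 1 z) -
        Real.exp (c + d * z) * (z * gaussianPDFReal 0 1 z)) :=
  ((integrable_exp_gaussianPDF c d).1.const_mul d).sub (integrable_exp_gaussianPDF c d).2

theorem integral_Ioi_exp_mul_gaussianPDF (c d a : ℝ) :
    ∫ z in Set.Ioi a, (d * (Real.exp (c + d * z) * gaussianPDFReal 0 1 z) -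
        Real.exp (c + d * z) * (z * gaussianPDFReal 0 1 z)) =
      -(Real.exp (c + d * a) * gaussianPDFReal 0 1 a) := by
  have hd := hasDerivAt_exp_mul_gaussianPDF c d
  have hI := (integrable_deriv_exp_mul_gaussianPDF c d).integrableOn (s := Set.Ioi a)
  rw [integral_Ioi_of_hasDerivAt_of_tendsto' (fun z _ => hd z) hI
    (tendsto_zero_of_hasDerivAt_of_integrableOn_Ioi (fun z _ => hd z) hI
      (integrable_exp_gaussianPDF c d).1.integrableOn), zero_sub]

theorem integral_Iic_exp_mul_gaussianPDF (c d a : ℝ) :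
    ∫ z in Set.Iic a, (d * (Real.exp (c + d * z) * gaussianPDFReal 0 1 z) -
        Real.exp (c + d * z) * (z * gaussianPDFReal 0 1 z)) =
      Real.exp (c + d * a) * gaussianPDFReal 0 1 a := by
  have hd := hasDerivAt_exp_mul_gaussianPDF c d
  have hI := (integrable_deriv_exp_mul_gaussianPDF c d).integrableOn (s := Set.Iic a)
  rw [integral_Iic_of_hasDerivAt_of_tendsto' (fun z _ => hd z) hI
    (tendsto_zero_of_hasDerivAt_of_integrableOn_Iic (fun z _ => hd z) hI
      (integrable_exp_gaussianPDF c d).1.integrableOn), sub_zero]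

theorem expLossDeriv_of_pos {t : ℝ} (ht : 0 < t) : expLossDeriv t = -Real.exp (-t) := by
  simp [expLossDeriv, sign_pos ht, abs_of_pos ht]

theorem expLossDeriv_of_neg {t : ℝ} (ht : t < 0) : expLossDeriv t = Real.exp t := by
  simp [expLossDeriv, sign_neg ht, abs_of_neg ht]

theorem measurable_expLossDeriv : Measurable expLossDeriv := by
  have e : expLossDeriv = fun t => if 0 < t then -Real.exp (-t) else if t < 0 then Real.exp t else 0 := by
    funext t
    rcases lt_trichotomy t 0 with h | h | h
    · rw [expLossDeriv_of_neg h, if_neg (by linarith), if_pos h]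
    · simp [h, expLossDeriv]
    · rw [expLossDeriv_of_pos h, if_pos h]
  rw [e]
  exact Measurable.ite measurableSet_Ioi (by fun_prop)
    (Measurable.ite measurableSet_Iio (by fun_prop) measurable_const)

theorem abs_expLossDeriv_le (t : ℝ) : |expLossDeriv t| ≤ 1 := by
  rcases lt_trichotomy t 0 with h | h | h
  · rw [expLossDeriv_of_neg h, Real.abs_exp, Real.exp_le_one_iff]; exact h.le
  · simp [h, expLossDeriv]
  · rw [expLossDeriv_of_pos h, abs_neg, Real.abs_exp, Real.exp_le_one_iff]; linarith

/-- Gaussian integration by parts for `ℓ`, whose second derivative is `ℓ - 2 δ₀`. -/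
theorem integral_expLossDeriv_mul_gaussian {σ : ℝ} (hσ : 0 < σ) (x : ℝ) :
    ∫ z, expLossDeriv (x + σ * z) * z ∂gaussianReal 0 1 =
      σ * (smoothedLoss σ x - 2 * gaussKernel σ x) := by
  -- The kink of ℓ(x + σz) sits at z = a. On each side the integrand is a pure exponential times the
  -- Gaussian density, and each half-line contributes one boundary term at a; together they form the
  -- δ₀ part of ℓ''.
  set a := -(σ⁻¹ * x) with ha
  have hxa : x + σ * a = 0 := by rw [ha]; field_simp; ring
  have hφ : gaussianPDFReal 0 1 a = gaussianPDFReal 0 1 (σ⁻¹ * x) := by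
    simp [gaussianPDFReal, ha]
  unfold smoothedLoss gaussKernel
  rw [integral_gaussianReal_eq_integral_smul one_ne_zero,
    integral_gaussianReal_eq_integral_smul one_ne_zero]
  simp only [smul_eq_mul]
  have hI1 : Integrable fun z => gaussianPDFReal 0 1 z * expLoss (x + σ * z) :=
    integrable_gaussianReal_iff.1 (integrable_expLoss_comp (by fun_prop))
  have hI2 : Integrable fun z => gaussianPDFReal 0 1 z * (expLossDeriv (x + σ * z) * z) := by
    refine integrable_gaussianReal_iff.1 ?_
    refine integrable_abs_gaussian.mono' ?_ (ae_of_all _ fun z => ?_)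
    · exact ((measurable_expLossDeriv.comp (by fun_prop)).mul measurable_id).aestronglyMeasurable
    · rw [norm_mul, Real.norm_eq_abs, Real.norm_eq_abs]
      exact mul_le_of_le_one_left (abs_nonneg z) (abs_expLossDeriv_le _)
  rw [← intervalIntegral.integral_Iic_add_Ioi (b := a) hI1.integrableOn hI1.integrableOn,
    ← intervalIntegral.integral_Iic_add_Ioi (b := a) hI2.integrableOn hI2.integrableOn]
  have h1 : ∫ z in Set.Ioi a, gaussianPDFReal 0 1 z * (expLossDeriv (x + σ * z) * z) =
      -gaussianPDFReal 0 1 a + σ * ∫ z in Set.Ioi a, gaussianPDFReal 0 1 z * expLoss (x + σ * z) := by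
    have h := integral_Ioi_exp_mul_gaussianPDF (-x) (-σ) a
    rw [show -x + -σ * a = 0 by linarith, Real.exp_zero, one_mul] at h
    rw [← h, ← integral_const_mul, ← integral_add]
    · refine setIntegral_congr_fun measurableSet_Ioi fun z hz => ?_
      have hp : 0 < x + σ * z := by
        have := mul_lt_mul_of_pos_left (Set.mem_Ioi.1 hz) hσ
        linarith
      simp only [expLossDeriv_of_pos hp, expLoss, abs_of_pos hp]
      rw [show -x + -σ * z = -(x + σ * z) by ring]; ring
    · exact (integrable_deriv_exp_mul_gaussianPDF _ _).integrableOn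
    · exact (hI1.const_mul σ).integrableOn
  have h2 : ∫ z in Set.Iic a, gaussianPDFReal 0 1 z * (expLossDeriv (x + σ * z) * z) =
      -gaussianPDFReal 0 1 a + σ * ∫ z in Set.Iic a, gaussianPDFReal 0 1 z * expLoss (x + σ * z) := by
    have h := integral_Iic_exp_mul_gaussianPDF x σ a
    rw [hxa, Real.exp_zero, one_mul] at h
    rw [← h, ← integral_const_mul, ← integral_neg, ← integral_add]
    · rw [integral_Iic_eq_integral_Iio, integral_Iic_eq_integral_Iio]
      refine setIntegral_congr_fun measurableSet_Iio fun z hz => ?_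
      have hp : x + σ * z < 0 := by
        have := mul_lt_mul_of_pos_left (Set.mem_Iio.1 hz) hσ
        linarith
      simp only [expLossDeriv_of_neg hp, expLoss, abs_of_neg hp, neg_neg]
      ring
    · exact (integrable_deriv_exp_mul_gaussianPDF _ _).neg.integrableOn
    · exact (hI1.const_mul σ).integrableOn
  rw [h1, h2, hφ]
  field_simp
  ring

theorem expLoss_sub_le (s t : ℝ) : |expLoss s - expLoss t| ≤ |s - t| := by
  have key : ∀ s t : ℝ, expLoss s - expLoss t ≤ |s - t| := by
    intro s t
    unfold expLoss
    have h1 := abs_sub_abs_le_abs_sub t s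
    rw [abs_sub_comm] at h1
    have h2 := Real.add_one_le_exp (-|t| - -|s|)
    have h3 : Real.exp (-|t|) = Real.exp (-|s|) * Real.exp (-|t| - -|s|) := by
      rw [← Real.exp_add]; ring_nf
    have h4 : Real.exp (-|s|) ≤ 1 := expLoss_le_one s
    rw [h3]
    have h5 := Real.exp_pos (-|s|)
    rcases le_total |t| |s| with h | h
    · have : 0 ≤ -|t| - -|s| := by linarith
      nlinarith [abs_nonneg (s - t)]
    · nlinarith [abs_nonneg (s - t)]
  rw [abs_le]
  have := key t s
  rw [abs_sub_comm] at this
  exact ⟨by linarith, key s t⟩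

theorem integral_prod_smoothedLoss (Q : Measure ℝ) [IsProbabilityMeasure Q] (σ : ℝ) :
    ∫ q, expLoss (q.1 + σ * q.2) ∂(Q.prod (gaussianReal 0 1)) = ∫ x, smoothedLoss σ x ∂Q :=
  integral_prod _ (integrable_expLoss_comp (by fun_prop))

theorem integrable_smoothedLoss (Q : Measure ℝ) [IsFiniteMeasure Q] (σ : ℝ) :
    Integrable (smoothedLoss σ) Q := by
  refine Integrable.of_bound (measurable_smoothedLoss σ).aestronglyMeasurable 1
    (ae_of_all _ fun x => ?_)
  rw [Real.norm_eq_abs, abs_of_nonneg (smoothedLoss_nonneg _ _)]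
  exact smoothedLoss_le_one _ _

theorem integrable_gaussKernel (Q : Measure ℝ) [IsFiniteMeasure Q] {σ : ℝ} (hσ : 0 < σ) :
    Integrable (gaussKernel σ) Q := by
  refine Integrable.of_bound (measurable_gaussKernel σ).aestronglyMeasurable
    (σ⁻¹ * (√(2 * Real.pi))⁻¹) (ae_of_all _ fun x => ?_)
  rw [Real.norm_eq_abs, abs_of_nonneg (gaussKernel_nonneg hσ.le _)]
  unfold gaussKernel
  refine mul_le_mul_of_nonneg_left ?_ (inv_nonneg.2 hσ.le)
  rw [gaussianPDFReal]
  simp only [NNReal.coe_one, mul_one, sub_zero]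
  refine mul_le_of_le_one_right (by positivity) ?_
  rw [Real.exp_le_one_iff]
  have : 0 ≤ (σ⁻¹ * x) ^ 2 := sq_nonneg _
  linarith

/-- The derivative of `σ ↦ E ℓ(X + σ Z)`. -/
theorem hasDerivAt_integral_smoothedLoss (Q : Measure ℝ) [IsProbabilityMeasure Q] {σ : ℝ}
    (hσ : 0 < σ) : HasDerivAt (fun s => ∫ x, smoothedLoss s x ∂Q)
      (σ * ((∫ x, smoothedLoss σ x ∂Q) - 2 * ∫ x, gaussKernel σ x ∂Q)) σ := by
  have hfst : Integrable (fun q : ℝ × ℝ => |q.2|) (Q.prod (gaussianReal 0 1)) :=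
    integrable_abs_gaussian.comp_snd Q
  -- For σ > 0 the Gaussian factor makes the kink a null event, whatever atoms Q may have.
  have hne : ∀ᵐ q ∂(Q.prod (gaussianReal 0 1)), q.1 + σ * q.2 ≠ 0 := by
    rw [Measure.ae_prod_iff_ae_ae (by measurability)]
    refine ae_of_all _ fun x => ?_
    have := nullSingletonClass_gaussianReal (μ := 0) (v := 1) one_ne_zero
    have : ∀ᵐ z ∂(gaussianReal 0 1), z ≠ -(σ⁻¹ * x) := by
      rw [ae_iff]; simp
    filter_upwards [this] with z hz h
    apply hz
    field_simp
    linarith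
  obtain ⟨hI, hD⟩ := hasDerivAt_integral_of_dominated_loc_of_lip (𝕜 := ℝ)
    (μ := Q.prod (gaussianReal 0 1)) (F := fun s q => expLoss (q.1 + s * q.2))
    (F' := fun q => expLossDeriv (q.1 + σ * q.2) * q.2) (bound := fun q => |q.2|) (x₀ := σ)
    (s := Set.univ) univ_mem
    (Eventually.of_forall fun s => (integrable_expLoss_comp (by fun_prop)).aestronglyMeasurable)
    (integrable_expLoss_comp (by fun_prop))
    ((measurable_expLossDeriv.comp (by fun_prop)).mul measurable_snd).aestronglyMeasurable
    (ae_of_all _ fun q => by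
      refine LipschitzOnWith.of_dist_le_mul fun s _ t _ => ?_
      simp only [Real.dist_eq, Real.coe_nnabs, abs_abs]
      refine (expLoss_sub_le _ _).trans_eq ?_
      rw [← abs_mul]; congr 1; ring)
    hfst
    (by
      filter_upwards [hne] with q hq
      have h1 : HasDerivAt (fun s : ℝ => q.1 + s * q.2) q.2 σ := by
        simpa using ((hasDerivAt_id σ).mul_const q.2).const_add q.1
      exact HasDerivAt.comp (h₂ := expLoss) σ (hasDerivAt_expLoss hq) h1)
  have e : (fun s => ∫ x, smoothedLoss s x ∂Q) =
      fun s => ∫ q, expLoss (q.1 + s * q.2) ∂(Q.prod (gaussianReal 0 1)) :=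
    funext fun s => (integral_prod_smoothedLoss Q s).symm
  rw [e]
  refine hD.congr_deriv ?_
  rw [integral_prod _ hI]
  simp_rw [integral_expLossDeriv_mul_gaussian hσ]
  rw [integral_const_mul, integral_sub (integrable_smoothedLoss Q σ)
    ((integrable_gaussKernel Q hσ).const_mul 2), integral_const_mul]

end

section

/-! ### Square root of the covariance and Gaussian marginals -/

section SqrtCovariance

open scoped MatrixOrder in
/-- The symmetric square root of a positive definite covariance matrix. -/
theorem exists_sqrt_of_posDef {d : ℕ} {S : Matrix (Fin d) (Fin d) ℝ} (hS : S.PosDef) :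
    ∃ B : Euc d →L[ℝ] Euc d, (∀ u v, ⟪B u, v⟫ = ⟪u, B v⟫) ∧
      (∀ v, ‖B v‖ ^ 2 = dotProduct v.ofLp (S.mulVec v.ofLp)) ∧
      ∃ c : ℝ, 0 < c ∧ ∀ v, c * ‖v‖ ≤ ‖B v‖ := by
  have hnn : (0 : Matrix (Fin d) (Fin d) ℝ) ≤ S := hS.posSemidef.nonneg
  have hsa : IsSelfAdjoint (Matrix.toEuclideanCLM (𝕜 := ℝ) (CFC.sqrt S)) :=
    (CFC.sqrt_nonneg S).isSelfAdjoint.map _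
  set B := Matrix.toEuclideanCLM (𝕜 := ℝ) (CFC.sqrt S) with hB
  have hsym : ∀ u v, ⟪B u, v⟫ = ⟪u, B v⟫ := fun u v => by
    rw [← ContinuousLinearMap.adjoint_inner_left, hsa.adjoint_eq]
  have hsq : ∀ v, ‖B v‖ ^ 2 = dotProduct v.ofLp (S.mulVec v.ofLp) := fun v => by
    rw [← real_inner_self_eq_norm_sq, hsym, ← Matrix.inner_toEuclideanCLM,
      ← ContinuousLinearMap.comp_apply, ← ContinuousLinearMap.mul_def, hB, ← map_mul,
      CFC.sqrt_mul_sqrt_self S hnn]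
  refine ⟨B, hsym, hsq, ?_⟩
  have hker : (B : Euc d →ₗ[ℝ] Euc d).ker = ⊥ := by
    rw [LinearMap.ker_eq_bot']
    intro v hv
    by_contra hne
    have h1 := hS.dotProduct_mulVec_pos (x := v.ofLp) (by simpa using hne)
    have h2 := hsq v
    have hv' : B v = 0 := hv
    rw [hv'] at h2
    simp only [star_trivial] at h1
    rw [← h2] at h1
    simp at h1
  obtain ⟨K, hK, hKl⟩ := LinearMap.exists_antilipschitzWith (B : Euc d →ₗ[ℝ] Euc d) hker
  refine ⟨(K : ℝ)⁻¹, by positivity, fun v => ?_⟩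
  have h := hKl.le_mul_dist v 0
  simp only [dist_zero_right, map_zero] at h
  rw [inv_mul_le_iff₀ (by exact_mod_cast hK)]
  exact h

theorem map_inner_multivariateGaussian {d : ℕ} {S : Matrix (Fin d) (Fin d) ℝ}
    (hS : S.PosSemidef) (v : Euc d) {σ : ℝ} (hσ : σ ^ 2 = dotProduct v.ofLp (S.mulVec v.ofLp)) :
    (multivariateGaussian 0 S).map (fun x => ⟪v, x⟫) = (gaussianReal 0 1).map (fun z => σ * z) := by
  have h := IsGaussian.map_eq_gaussianReal (μ := multivariateGaussian 0 S) (innerSL ℝ v)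
  have hv : Var[innerSL ℝ v; multivariateGaussian 0 S] = σ ^ 2 := by
    rw [hσ, ← covarianceBilin_multivariateGaussian (μ := 0) hS v v,
      covarianceBilin_self IsGaussian.memLp_two_id]
    rfl
  have hm : ∫ x, innerSL ℝ v x ∂(multivariateGaussian 0 S) = 0 := by
    have h0 := ContinuousLinearMap.integral_comp_comm (innerSL ℝ v)
      (IsGaussian.integrable_id (μ := multivariateGaussian 0 S))
    simp only [id_eq, integral_id_multivariateGaussian, map_zero] at h0
    exact h0
  rw [hv, hm] at h
  rw [gaussianReal_map_const_mul]
  simp only [mul_zero, mul_one]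
  refine h.trans ?_
  congr 1
  exact Real.toNNReal_of_nonneg (sq_nonneg σ)

end SqrtCovariance

/-! ### The population loss and the spurious part of its gradient -/

section Law

variable {d₁ d₂ : ℕ}

/-- The label only mixes the two laws of x₁ while x₂ has the same law under both, so forgetting the
label leaves x₁ and x₂ independent. -/
theorem inputLaw_eq_prod (Dpos Dneg : Measure (Euc d₁)) [IsProbabilityMeasure Dpos]
    [IsProbabilityMeasure Dneg] (S : Matrix (Fin d₂) (Fin d₂) ℝ) :
    inputLaw Dpos Dneg S =
      ((2⁻¹ : ℝ≥0∞) • Dpos + (2⁻¹ : ℝ≥0∞) • Dneg).prod (multivariateGaussian 0 S) := by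
  unfold inputLaw targetLaw
  rw [Measure.map_add _ _ measurable_fst, Measure.map_smul, Measure.map_smul, Measure.map_fst_prod,
    Measure.map_fst_prod]
  simp only [measure_univ, one_smul]
  have := Measure.prod_smul_left (μ := Dpos) (ν := multivariateGaussian 0 S) (2⁻¹ : ℝ≥0∞)
  have h2 := Measure.prod_smul_left (μ := Dneg) (ν := multivariateGaussian 0 S) (2⁻¹ : ℝ≥0∞)
  have hf : ∀ D : Measure (Euc d₁), IsProbabilityMeasure D → IsFiniteMeasure ((2⁻¹ : ℝ≥0∞) • D) :=
    fun D _ => ⟨by simp⟩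
  have := hf Dpos inferInstance
  have := hf Dneg inferInstance
  rw [Measure.add_prod]
  simp_all

theorem isProbabilityMeasure_half_add (Dpos Dneg : Measure (Euc d₁)) [IsProbabilityMeasure Dpos]
    [IsProbabilityMeasure Dneg] :
    IsProbabilityMeasure ((2⁻¹ : ℝ≥0∞) • Dpos + (2⁻¹ : ℝ≥0∞) • Dneg) :=
  ⟨by simp [ENNReal.inv_two_add_inv_two]⟩

theorem predict_eq (w : Weights d₁ d₂) (x : Euc d₁ × Euc d₂) :
    predict w x = ⟪w.fst, x.1⟫ + ⟪w.snd, x.2⟫ := by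
  simp [predict, WithLp.prod_inner_apply]

theorem continuous_predict (w : Weights d₁ d₂) : Continuous (predict w) := by
  have : predict w = fun x => ⟪w.fst, x.1⟫ + ⟪w.snd, x.2⟫ := funext (predict_eq w)
  rw [this]; fun_prop

variable {D : Measure (Euc d₁)} {G : Measure (Euc d₂)} {B : Euc d₂ →L[ℝ] Euc d₂}

theorem continuous_expLoss_add (a : ℝ) : Continuous fun t => expLoss (a + t) :=
  continuous_expLoss.comp (continuous_const_add a)

/-- The population loss as a function of `w₁` and of the standard deviation of `w₂ᵀ x₂`. -/
theorem popLoss_prod [IsProbabilityMeasure D] [IsProbabilityMeasure G]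
    (hG : ∀ v, G.map (fun x => ⟪v, x⟫) = (gaussianReal 0 1).map (fun z => ‖B v‖ * z))
    (w : Weights d₁ d₂) :
    popLoss (D.prod G) w = ∫ x, smoothedLoss ‖B w.snd‖ x ∂(D.map fun x => ⟪w.fst, x⟫) := by
  unfold popLoss
  rw [integral_prod _ (integrable_expLoss_comp (continuous_predict w).measurable),
    integral_map (by fun_prop) (measurable_smoothedLoss _).aestronglyMeasurable]
  refine integral_congr_ae (ae_of_all _ fun x₁ => ?_)
  have h1 : ∫ x₂, expLoss (predict w (x₁, x₂)) ∂G =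
      ∫ t, expLoss (⟪w.fst, x₁⟫ + t) ∂(G.map fun x => ⟪w.snd, x⟫) := by
    rw [integral_map (by fun_prop) (continuous_expLoss_add _).aestronglyMeasurable]
    simp [predict_eq]
  simp only [h1, hG, smoothedLoss]
  rw [integral_map (by fun_prop) (continuous_expLoss_add _).aestronglyMeasurable]

/-- The factor `r(w)` with `∇₂ L(w) = r(w) Σ₂ w₂`. -/
def shrinkRate (D : Measure (Euc d₁)) (B : Euc d₂ →L[ℝ] Euc d₂) (w : Weights d₁ d₂) : ℝ :=
  (∫ x, smoothedLoss ‖B w.snd‖ x ∂(D.map fun x => ⟪w.fst, x⟫)) -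
    2 * ∫ x, gaussKernel ‖B w.snd‖ x ∂(D.map fun x => ⟪w.fst, x⟫)

theorem hasDerivAt_line_of_differentiableAt {F : Type*} [NormedAddCommGroup F]
    [InnerProductSpace ℝ F] [CompleteSpace F] {f : F → ℝ} {w : F} (hd : DifferentiableAt ℝ f w)
    (u : F) : HasDerivAt (fun s : ℝ => f (w + s • u)) ⟪gradient f w, u⟫ 0 := by
  have hline : HasDerivAt (fun s : ℝ => w + s • u) u 0 := by
    simpa using ((hasDerivAt_id (0 : ℝ)).smul_const u).const_add w
  have hF : HasFDerivAt f ((InnerProductSpace.toDual ℝ F) (gradient f w)) (w + (0 : ℝ) • u) := by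
    simpa using hd.hasGradientAt.hasFDerivAt
  exact (hF.comp_hasDerivAt (0 : ℝ) hline).congr_deriv (by simp)

theorem hasDerivAt_norm_line {F : Type*} [NormedAddCommGroup F] [InnerProductSpace ℝ F] {a b : F}
    (ha : a ≠ 0) : HasDerivAt (fun s : ℝ => ‖a + s • b‖) (⟪a, b⟫ / ‖a‖) 0 := by
  have hl : HasDerivAt (fun s : ℝ => a + s • b) b 0 := by
    simpa using ((hasDerivAt_id (0 : ℝ)).smul_const b).const_add a
  have hpos : 0 < ‖a‖ := norm_pos_iff.2 ha
  have h2 := hl.norm_sq.sqrt (by simpa using ha)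
  refine (h2.congr_deriv ?_).congr_of_eventuallyEq (Eventually.of_forall fun s => ?_)
  · simp only [zero_smul, add_zero, Real.sqrt_sq (norm_nonneg _)]
    field_simp
  · simp only [Real.sqrt_sq (norm_nonneg _)]

theorem deriv_zero_of_even {f : ℝ → ℝ} {c : ℝ} (h : HasDerivAt f c 0) (he : ∀ s, f (-s) = f s) :
    c = 0 := by
  have h1 : HasDerivAt f c (-0) := by simpa using h
  have h3 := HasDerivAt.scomp (0 : ℝ) h1 (hasDerivAt_neg (0 : ℝ))
  have h4 : HasDerivAt f ((-1 : ℝ) • c) 0 :=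
    h3.congr_of_eventuallyEq (Eventually.of_forall fun s => (he s).symm)
  have := h.unique h4
  simp only [smul_eq_mul] at this
  linarith

/-- Chain rule through the norm when B w₂ ≠ 0. When B w₂ = 0 the norm is not differentiable, but the
function is even in s, so a derivative that exists must vanish. -/
theorem deriv_smoothedLoss_line [IsProbabilityMeasure D] {w : Weights d₁ d₂} {h : Euc d₂} {c : ℝ}
    (hc : HasDerivAt (fun s : ℝ => ∫ x, smoothedLoss ‖B w.snd + s • B h‖ x
      ∂(D.map fun x => ⟪w.fst, x⟫)) c 0) : c = shrinkRate D B w * ⟪B w.snd, B h⟫ := by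
  have : IsProbabilityMeasure (D.map fun x => ⟪w.fst, x⟫) :=
    Measure.isProbabilityMeasure_map (by fun_prop)
  by_cases hw : B w.snd = 0
  · rw [hw, inner_zero_left, mul_zero]
    refine deriv_zero_of_even hc fun s => ?_
    simp [hw]
  · have hpos : 0 < ‖B w.snd‖ := norm_pos_iff.2 hw
    have h2 : HasDerivAt (fun s => ∫ x, smoothedLoss s x ∂(D.map fun x => ⟪w.fst, x⟫))
        (‖B w.snd‖ * shrinkRate D B w) ‖B w.snd + (0 : ℝ) • B h‖ := by
      rw [zero_smul, add_zero]
      exact hasDerivAt_integral_smoothedLoss (D.map fun x => ⟪w.fst, x⟫) hpos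
    have h3 := HasDerivAt.comp (0 : ℝ) h2 (hasDerivAt_norm_line hw)
    rw [hc.unique h3]
    field_simp

theorem gradient_snd_popLoss [IsProbabilityMeasure D] [IsProbabilityMeasure G]
    (hG : ∀ v, G.map (fun x => ⟪v, x⟫) = (gaussianReal 0 1).map (fun z => ‖B v‖ * z))
    (hB : ∀ u v, ⟪B u, v⟫ = ⟪u, B v⟫) {w : Weights d₁ d₂}
    (hd : DifferentiableAt ℝ (popLoss (D.prod G)) w) :
    (gradient (popLoss (D.prod G)) w).snd = shrinkRate D B w • B (B w.snd) := by
  refine ext_inner_right ℝ fun h => ?_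
  rw [real_inner_smul_left, hB]
  -- Along directions (0, h) the law of w₁ᵀx₁ is frozen and only the noise level varies.
  have h1 := hasDerivAt_line_of_differentiableAt hd (WithLp.toLp 2 ((0 : Euc d₁), h))
  have e1 : ⟪gradient (popLoss (D.prod G)) w, (WithLp.toLp 2 ((0 : Euc d₁), h) : Weights d₁ d₂)⟫ =
      ⟪(gradient (popLoss (D.prod G)) w).snd, h⟫ := by
    rw [WithLp.prod_inner_apply]
    simp
  rw [e1] at h1
  refine deriv_smoothedLoss_line (h1.congr_of_eventuallyEq (Eventually.of_forall fun s => ?_))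
  simp only
  rw [popLoss_prod hG]
  simp

end Law

end

section

/-! ### Slices along arbitrary vectors and Gaussian tails -/

section Scaling

variable {α β r : ℝ} {p : ℝ → ℝ}

theorem deriv_log_scale (hp : HasLogHessian p) (hr : 0 < r) :
    (deriv fun t => Real.log (r⁻¹ * p (r⁻¹ * t))) =
      fun t => r⁻¹ * deriv (fun t => Real.log (p t)) (r⁻¹ * t) := by
  funext t
  have e : (fun t => Real.log (r⁻¹ * p (r⁻¹ * t))) =
      fun t => Real.log r⁻¹ + Real.log (p (r⁻¹ * t)) :=
    funext fun t => Real.log_mul (inv_ne_zero hr.ne') (hp.1 _).ne'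
  have h1 : HasDerivAt (fun t => r⁻¹ * t) r⁻¹ t := by
    simpa using (hasDerivAt_id t).const_mul r⁻¹
  have h2 := HasDerivAt.comp (h₂ := fun t => Real.log (p t)) t (hp.2.1 (r⁻¹ * t)).hasDerivAt h1
  rw [e]
  refine (h2.const_add (Real.log r⁻¹)).deriv.trans (mul_comm _ _)

theorem deriv2_log_scale (hp : HasLogHessian p) (hr : 0 < r) (t : ℝ) :
    deriv (deriv fun t => Real.log (r⁻¹ * p (r⁻¹ * t))) t =
      deriv (deriv fun t => Real.log (p t)) (r⁻¹ * t) / r ^ 2 := by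
  rw [deriv_log_scale hp hr]
  have h1 : HasDerivAt (fun t => r⁻¹ * t) r⁻¹ t := by
    simpa using (hasDerivAt_id t).const_mul r⁻¹
  have h2 := (HasDerivAt.comp (h₂ := deriv fun t => Real.log (p t)) t
    (hp.2.2 (r⁻¹ * t)).hasDerivAt h1).const_mul r⁻¹
  refine h2.deriv.trans ?_
  field_simp

theorem HasLogHessian.scale (hp : HasLogHessian p) (hr : 0 < r) :
    HasLogHessian fun t => r⁻¹ * p (r⁻¹ * t) := by
  refine ⟨fun t => mul_pos (inv_pos.2 hr) (hp.1 _), ?_, ?_⟩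
  · have e : (fun t => Real.log (r⁻¹ * p (r⁻¹ * t))) =
        fun t => Real.log r⁻¹ + Real.log (p (r⁻¹ * t)) :=
      funext fun t => Real.log_mul (inv_ne_zero hr.ne') (hp.1 _).ne'
    rw [e]
    exact (differentiable_const _).add (hp.2.1.comp (differentiable_id.const_mul r⁻¹))
  · rw [deriv_log_scale hp hr]
    exact (hp.2.2.comp (differentiable_id.const_mul r⁻¹)).const_mul _

theorem LogConcaveDensity.scale (hp : LogConcaveDensity α p) (hr : 0 < r) :
    LogConcaveDensity (α / r ^ 2) fun t => r⁻¹ * p (r⁻¹ * t) := by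
  refine ⟨hp.1.scale hr, fun t => ?_⟩
  rw [deriv2_log_scale hp.1 hr, ← neg_div]
  exact div_le_div_of_nonneg_right (hp.2 _) (sq_nonneg r)

theorem LogSmoothDensity.scale (hp : LogSmoothDensity β p) (hr : 0 < r) :
    LogSmoothDensity (β / r ^ 2) fun t => r⁻¹ * p (r⁻¹ * t) := by
  refine ⟨hp.1.scale hr, fun t => ?_⟩
  rw [deriv2_log_scale hp.1 hr, abs_div, abs_of_nonneg (sq_nonneg r)]
  exact div_le_div_of_nonneg_right (hp.2 _) (sq_nonneg r)

variable {d : ℕ} {μ : Measure (Euc d)}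

/-- The slice along w is the unit slice dilated by ‖w‖, which divides second derivatives of the
log-density by ‖w‖². -/
theorem SlicedLogConcaveSmooth.exists_density (hμ : SlicedLogConcaveSmooth α β μ) {w : Euc d}
    (hw : w ≠ 0) : ∃ q : ℝ → ℝ, LogConcaveDensity (α / ‖w‖ ^ 2) q ∧
      LogSmoothDensity (β / ‖w‖ ^ 2) q ∧ ∀ f : ℝ → ℝ, Measurable f →
        ∫ t, f t ∂(μ.map fun x => ⟪w, x⟫) = ∫ t, q t * f t := by
  have hr : 0 < ‖w‖ := norm_pos_iff.2 hw
  obtain ⟨p, hmap, hc, hs⟩ := hμ (‖w‖⁻¹ • w) (by rw [norm_smul]; simp [hr.ne'])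
  refine ⟨fun t => ‖w‖⁻¹ * p (‖w‖⁻¹ * t), hc.scale hr, hs.scale hr, fun f hf => ?_⟩
  have hpc := hc.1.continuous
  have e : (μ.map fun x => ⟪w, x⟫) = (μ.map fun x => ⟪‖w‖⁻¹ • w, x⟫).map fun t => ‖w‖ * t := by
    rw [Measure.map_map (by fun_prop) (by fun_prop)]
    congr 1
    funext x
    simp only [Function.comp_apply, real_inner_smul_left]
    field_simp
  rw [e, integral_map (by fun_prop) hf.aestronglyMeasurable, hmap,
    integral_withDensity_eq_integral_toReal_smul (by fun_prop) (by simp)]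
  have e2 : (fun t => ‖w‖⁻¹ * p (‖w‖⁻¹ * t) * f t) =
      fun t => ‖w‖⁻¹ * (fun s => p s * f (‖w‖ * s)) (‖w‖⁻¹ * t) := by
    funext t
    simp only [mul_inv_cancel_left₀ hr.ne']
    ring
  rw [e2, integral_const_mul, Measure.integral_comp_mul_left (fun s => p s * f (‖w‖ * s)),
    inv_inv, abs_of_pos hr, smul_eq_mul, inv_mul_cancel_left₀ hr.ne']
  refine integral_congr_ae (ae_of_all _ fun t => ?_)
  simp only [smul_eq_mul, ENNReal.toReal_ofReal (hc.1.1 t).le]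

theorem SlicedLogConcaveSmooth.le (hμ : SlicedLogConcaveSmooth α β μ) {v : Euc d} (hv : ‖v‖ = 1) :
    α ≤ β := by
  obtain ⟨p, -, hc, hs⟩ := hμ v hv
  have h1 := hc.2 0
  have h2 := (abs_le.1 (hs.2 0)).1
  linarith

theorem SlicedLogConcaveSmooth.integrable_exp_sq_inner (hμ : SlicedLogConcaveSmooth α β μ)
    (hα : 0 < α) {v : Euc d} (hv : ‖v‖ = 1) : Integrable (fun x => Real.exp (α / 8 * ⟪v, x⟫ ^ 2)) μ := by
  obtain ⟨p, hmap, hc, hs⟩ := hμ v hv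
  have h1 : Integrable (fun t : ℝ => Real.exp (α / 8 * t ^ 2)) (μ.map fun x => ⟪v, x⟫) := by
    have hpc := hc.1.continuous
    rw [hmap, integrable_withDensity_iff_integrable_smul' (by fun_prop) (by simp)]
    obtain ⟨m, hm, -⟩ := hc.exists_mode hα
    -- The exponents compare by completing a square: α/8 t² - α/2 (t - m)² equals -α/8 t² + α/2 m²
    -- minus α/4 (t - 2m)².
    refine ((integrable_exp_neg_mul_sq (b := α / 8) (by positivity)).const_mul
      (p m * Real.exp (α / 2 * m ^ 2))).mono' (Measurable.aestronglyMeasurable (by fun_prop)) (ae_of_all _ fun t => ?_)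
    simp only [smul_eq_mul, ENNReal.toReal_ofReal (hc.1.1 t).le, norm_mul, Real.norm_eq_abs,
      Real.abs_exp, abs_of_pos (hc.1.1 t)]
    have h2 := hc.le_exp t m
    rw [hm, zero_mul, zero_sub] at h2
    refine (mul_le_mul_of_nonneg_right h2 (Real.exp_pos _).le).trans ?_
    rw [mul_assoc, mul_assoc, ← Real.exp_add, ← Real.exp_add]
    refine mul_le_mul_of_nonneg_left (Real.exp_le_exp.2 ?_) (hc.1.1 m).le
    nlinarith [sq_nonneg (t - 2 * m)]
  exact h1.comp_measurable (by fun_prop)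

/-- Only one-dimensional slices are controlled, so ‖x‖² is bounded by d times its largest squared
coordinate, and the maximum of the exponentials by their sum. -/
theorem SlicedLogConcaveSmooth.integrable_exp_sq [IsProbabilityMeasure μ]
    (hμ : SlicedLogConcaveSmooth α β μ) (hα : 0 < α) (hd : 0 < d) :
    Integrable (fun x => Real.exp (α / (8 * d) * ‖x‖ ^ 2)) μ := by
  have hI : Integrable (fun x : Euc d => ∑ j, Real.exp (α / 8 * x j ^ 2)) μ := by
    refine integrable_finsetSum _ fun j _ => ?_
    have := hμ.integrable_exp_sq_inner hα (v := EuclideanSpace.single j 1) (by simp)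
    simpa [EuclideanSpace.inner_single_left] using this
  refine hI.mono' (by fun_prop) (ae_of_all _ fun x => ?_)
  rw [Real.norm_eq_abs, Real.abs_exp]
  have : Nonempty (Fin d) := ⟨⟨0, hd⟩⟩
  obtain ⟨k, hk⟩ := Finite.exists_max fun j => x j ^ 2
  have h1 : ‖x‖ ^ 2 ≤ d * x k ^ 2 := by
    rw [EuclideanSpace.norm_sq_eq]
    calc ∑ i, ‖x i‖ ^ 2 ≤ ∑ _i : Fin d, x k ^ 2 := Finset.sum_le_sum fun i _ => by
          simpa using hk i
      _ = _ := by simp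
  have hd' : (0 : ℝ) < d := by exact_mod_cast hd
  calc Real.exp (α / (8 * d) * ‖x‖ ^ 2) ≤ Real.exp (α / 8 * x k ^ 2) := by
        rw [Real.exp_le_exp]
        calc α / (8 * d) * ‖x‖ ^ 2 ≤ α / (8 * d) * (d * x k ^ 2) := by gcongr
          _ = _ := by field_simp
    _ ≤ _ := Finset.single_le_sum (f := fun j => Real.exp (α / 8 * x j ^ 2))
        (fun j _ => (Real.exp_pos _).le) (Finset.mem_univ k)

end Scaling

/-! ### Lower bound on the shrink rate -/

section Shrink

theorem kappaTilde_nonneg {ρ ν : ℝ} (hν : 0 ≤ ν) : 0 ≤ kappaTilde ρ ν := by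
  have h1 : 0 ≤ pStar ρ ν := by
    unfold pStar
    refine mul_nonneg (by positivity) (le_min zero_le_one ?_)
    exact mul_nonneg (by positivity) (Real.rpow_nonneg (by positivity) _)
  unfold kappaTilde
  refine le_min ?_ (by positivity)
  exact mul_nonneg (mul_nonneg (by positivity) (Real.rpow_nonneg h1 _))
    (Real.rpow_nonneg (by positivity) _)

theorem kappa_le_kappaTilde {α β a : ℝ} (hα : 0 ≤ α) (ha : a ∈ Set.Icc (1 : ℝ) 4) :
    kappa β α ≤ kappaTilde (a * β) (a * α) := by
  refine csInf_le ⟨0, ?_⟩ ⟨a, ha, rfl⟩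
  rintro _ ⟨b, hb, rfl⟩
  exact kappaTilde_nonneg (mul_nonneg (by linarith [hb.1]) hα)

theorem kappa_nonneg {α β : ℝ} (hα : 0 ≤ α) : 0 ≤ kappa β α := by
  refine le_csInf (Set.Nonempty.image _ ⟨1, by norm_num⟩) ?_
  rintro _ ⟨b, hb, rfl⟩
  exact kappaTilde_nonneg (mul_nonneg (by linarith [hb.1]) hα)

variable {d₁ d₂ K : ℕ} {α β : ℝ} {τ : Fin K → ℝ} {μ : Fin K → Measure (Euc d₁)}

/-- One component of the mixture: a small loss dominates the density of the output at `0`. -/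
theorem SlicedLogConcaveSmooth.kernel_le {μ : Measure (Euc d₁)} [IsProbabilityMeasure μ]
    (hμ : SlicedLogConcaveSmooth α β μ) (hα : 0 < α) {w : Euc d₁} (hw : 1 / 2 ≤ ‖w‖)
    (hw1 : ‖w‖ ≤ 1) {σ : ℝ} (hσ : 0 < σ)
    (hvar : σ ^ 2 ≤ 0.12 * min 1 (min (α / β ^ 2) β⁻¹) * ‖w‖ ^ 2)
    (hloss : ∫ x, smoothedLoss σ x ∂(μ.map fun x => ⟪w, x⟫) ≤ 2 * kappa β α) :
    2.2 * ∫ x, gaussKernel σ x ∂(μ.map fun x => ⟪w, x⟫) ≤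
      ∫ x, smoothedLoss σ x ∂(μ.map fun x => ⟪w, x⟫) := by
  have hw0 : 0 < ‖w‖ := by linarith
  have hβ : α ≤ β := by
    refine hμ.le (v := ‖w‖⁻¹ • w) ?_
    rw [norm_smul]; simp [hw0.ne']
  have hβ0 : 0 < β := by linarith
  obtain ⟨q, hc, hs, hq⟩ := hμ.exists_density (w := w) (norm_pos_iff.1 hw0)
  have hint : ∫ t, q t = 1 := by
    have := hq (fun _ => 1) measurable_const
    simp only [mul_one] at this
    rw [← this]
    have : IsProbabilityMeasure (μ.map fun x => ⟪w, x⟫) :=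
      Measure.isProbabilityMeasure_map (by fun_prop)
    simp
  rw [hq _ (measurable_gaussKernel σ), hq _ (measurable_smoothedLoss σ)]
  rw [hq _ (measurable_smoothedLoss σ)] at hloss
  have hr2 : ‖w‖ ^ 2 ≤ 1 := by nlinarith
  have hmin0 : 0 ≤ min 1 (min (α / β ^ 2) β⁻¹) :=
    le_min zero_le_one (le_min (by positivity) (by positivity))
  refine smoothed_zero_le_loss hc hs (by positivity) (by positivity) hint hσ ?_ ?_ ?_
  · have h1 : min 1 (min (α / β ^ 2) β⁻¹) ≤ 1 := min_le_left _ _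
    nlinarith
  · have h1 : min 1 (min (α / β ^ 2) β⁻¹) ≤ β⁻¹ := (min_le_right _ _).trans (min_le_right _ _)
    rw [inv_div, div_eq_mul_inv]
    have := mul_le_mul_of_nonneg_right h1 (sq_nonneg ‖w‖)
    linarith
  -- The rescaling factor ‖w‖⁻² ranges over [1, 4] because 1/2 ≤ ‖w‖ ≤ 1; this is why κ is a minimum
  -- over that interval.
  · have h1 : kappa β α ≤ kappaTilde ((‖w‖ ^ 2)⁻¹ * β) ((‖w‖ ^ 2)⁻¹ * α) := by
      refine kappa_le_kappaTilde hα.le ⟨(one_le_inv₀ (by positivity)).2 hr2, ?_⟩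
      rw [inv_le_comm₀ (by positivity) (by norm_num)]
      nlinarith
    rw [div_eq_inv_mul, div_eq_inv_mul]
    linarith

variable {D : Measure (Euc d₁)} {B : Euc d₂ →L[ℝ] Euc d₂}

theorem shrinkRate_le {w : Weights d₁ d₂} :
    shrinkRate D B w ≤ ∫ x, smoothedLoss ‖B w.snd‖ x ∂(D.map fun x => ⟪w.fst, x⟫) := by
  have : 0 ≤ ∫ x, gaussKernel ‖B w.snd‖ x ∂(D.map fun x => ⟪w.fst, x⟫) :=
    integral_nonneg fun x => gaussKernel_nonneg (norm_nonneg _) x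
  unfold shrinkRate
  linarith

/-- At small loss the shrink rate is at least a fixed fraction of the loss. -/
theorem loss_le_shrinkRate (hα : 0 < α) (hτ : ∀ i, 0 ≤ τ i)
    (hprob : ∀ i, IsProbabilityMeasure (μ i)) (hsl : ∀ i, SlicedLogConcaveSmooth α β (μ i))
    (hD : D = ∑ i, ENNReal.ofReal (τ i) • μ i) {w : Weights d₁ d₂} (hw : 1 / 2 ≤ ‖w.fst‖)
    (hw1 : ‖w.fst‖ ≤ 1) (hB : B w.snd ≠ 0)
    (hvar : ‖B w.snd‖ ^ 2 ≤ 0.12 * min 1 (min (α / β ^ 2) β⁻¹) * ‖w.fst‖ ^ 2)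
    (hloss : ∫ x, smoothedLoss ‖B w.snd‖ x ∂(D.map fun x => ⟪w.fst, x⟫) ≤
      2 * ((⨅ i, τ i) * kappa β α)) :
    (∫ x, smoothedLoss ‖B w.snd‖ x ∂(D.map fun x => ⟪w.fst, x⟫)) / 11 ≤ shrinkRate D B w := by
  set σ := ‖B w.snd‖ with hσdef
  have hσ : 0 < σ := norm_pos_iff.2 hB
  have hpm : ∀ i, IsProbabilityMeasure ((μ i).map fun x => ⟪w.fst, x⟫) := fun i =>
    Measure.isProbabilityMeasure_map (by fun_prop)
  have hmap : (D.map fun x => ⟪w.fst, x⟫) =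
      ∑ i, ENNReal.ofReal (τ i) • ((μ i).map fun x => ⟪w.fst, x⟫) := by
    rw [hD, Measure.map_finset_sum (by fun_prop)]
    simp only [Measure.map_smul]
  have hint : ∀ f : ℝ → ℝ, (∀ i, Integrable f ((μ i).map fun x => ⟪w.fst, x⟫)) →
      ∫ x, f x ∂(D.map fun x => ⟪w.fst, x⟫) =
        ∑ i, τ i * ∫ x, f x ∂((μ i).map fun x => ⟪w.fst, x⟫) := fun f hf => by
    rw [hmap, integral_finsetSum_measure fun i _ => (hf i).smul_measure (by simp)]
    refine Finset.sum_congr rfl fun i _ => ?_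
    rw [integral_smul_measure, ENNReal.toReal_ofReal (hτ i), smul_eq_mul]
  have h1 := hint (smoothedLoss σ) fun i => integrable_smoothedLoss _ _
  have h2 := hint (gaussKernel σ) fun i => integrable_gaussKernel _ hσ
  have hJ0 : ∀ i, 0 ≤ ∫ x, smoothedLoss σ x ∂((μ i).map fun x => ⟪w.fst, x⟫) := fun i =>
    integral_nonneg fun x => smoothedLoss_nonneg _ _
  have key : ∀ i, τ i * (2.2 * ∫ x, gaussKernel σ x ∂((μ i).map fun x => ⟪w.fst, x⟫)) ≤
      τ i * ∫ x, smoothedLoss σ x ∂((μ i).map fun x => ⟪w.fst, x⟫) := fun i => by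
    rcases (hτ i).eq_or_lt with h0 | h0
    · rw [← h0]; simp
    · refine mul_le_mul_of_nonneg_left ?_ (hτ i)
      have := hprob i
      refine (hsl i).kernel_le hα hw hw1 hσ hvar ?_
      -- The total loss dominates each weighted component loss, so the factor min τ in the threshold
      -- forces every component of positive weight below 2κ.
      have h3 : τ i * ∫ x, smoothedLoss σ x ∂((μ i).map fun x => ⟪w.fst, x⟫) ≤
          τ i * (2 * kappa β α) := by
        calc _ ≤ ∫ x, smoothedLoss σ x ∂(D.map fun x => ⟪w.fst, x⟫) := by
              rw [h1]
              exact Finset.single_le_sum (f := fun i => τ i * ∫ x, smoothedLoss σ x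
                ∂((μ i).map fun x => ⟪w.fst, x⟫))
                (fun i _ => mul_nonneg (hτ i) (hJ0 i)) (Finset.mem_univ i)
          _ ≤ 2 * ((⨅ i, τ i) * kappa β α) := hloss
          _ = (⨅ i, τ i) * (2 * kappa β α) := by ring
          _ ≤ _ := mul_le_mul_of_nonneg_right (ciInf_le (Set.finite_range τ).bddBelow i)
              (mul_nonneg zero_le_two (kappa_nonneg hα.le))
      exact le_of_mul_le_mul_left h3 h0
  have h4 := Finset.sum_le_sum fun i (_ : i ∈ Finset.univ) => key i
  have h5 : 2.2 * ∫ x, gaussKernel σ x ∂(D.map fun x => ⟪w.fst, x⟫) ≤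
      ∫ x, smoothedLoss σ x ∂(D.map fun x => ⟪w.fst, x⟫) := by
    rw [h1, h2, Finset.mul_sum]
    refine le_of_eq_of_le (Finset.sum_congr rfl fun i _ => ?_) h4
    ring
  -- From 2.2 K ≤ J, with K the density term and J the loss, follows J - 2K ≥ (1 - 1/1.1) J = J/11.
  unfold shrinkRate
  linarith

end Shrink

end

section

/-! ### Semiconcavity of the loss -/

section Semiconcave

theorem exp_neg_le_quadratic {u : ℝ} (hu : 0 ≤ u) : Real.exp (-u) ≤ 1 - u + u ^ 2 / 2 := by
  have h := Real.quadratic_le_exp_of_nonneg hu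
  rw [Real.exp_neg, inv_le_comm₀ (Real.exp_pos u) (by nlinarith [sq_nonneg (u - 1)])]
  refine le_trans ?_ h
  rw [inv_le_iff_one_le_mul₀ (by nlinarith [sq_nonneg (u - 1)])]
  nlinarith [sq_nonneg (u ^ 2)]

theorem one_sub_sq_le_exp_neg {v : ℝ} (hv : 0 ≤ v) : 1 - v ^ 2 / 2 ≤ (1 + v) * Real.exp (-v) := by
  have hd : ∀ x, HasDerivAt (fun x => (1 + x) * Real.exp (-x) + x ^ 2 / 2)
      (x - x * Real.exp (-x)) x := fun x => by
    have h1 : HasDerivAt (fun x : ℝ => Real.exp (-x)) (-Real.exp (-x)) x := by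
      simpa using (hasDerivAt_neg x).exp
    have h2 := (((hasDerivAt_id x).const_add 1).fun_mul h1).fun_add ((hasDerivAt_pow 2 x).div_const 2)
    refine h2.congr_deriv ?_
    simp; ring
  have hm : MonotoneOn (fun x => (1 + x) * Real.exp (-x) + x ^ 2 / 2) (Set.Ici 0) := by
    refine monotoneOn_of_deriv_nonneg (convex_Ici 0)
      (fun x _ => (hd x).continuousAt.continuousWithinAt)
      (fun x _ => (hd x).differentiableAt.differentiableWithinAt) fun x hx => ?_
    rw [interior_Ici] at hx
    rw [(hd x).deriv]
    have : Real.exp (-x) ≤ 1 := Real.exp_le_one_iff.2 (by linarith [Set.mem_Ioi.1 hx])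
    nlinarith [Set.mem_Ioi.1 hx]
  have := hm (Set.mem_Ici.2 le_rfl) (Set.mem_Ici.2 hv) hv
  simp at this
  linarith

theorem exp_neg_le_of_nonneg {s t : ℝ} (hs : 0 ≤ s) (ht : 0 ≤ t) :
    Real.exp (-t) ≤ Real.exp (-s) - Real.exp (-s) * (t - s) + (t - s) ^ 2 / 2 := by
  have hs1 : Real.exp (-s) ≤ 1 := Real.exp_le_one_iff.2 (by linarith)
  have hs0 := Real.exp_pos (-s)
  have ht1 : Real.exp (-t) ≤ 1 := Real.exp_le_one_iff.2 (by linarith)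
  have ht0 := Real.exp_pos (-t)
  rcases le_total s t with h | h
  · have h1 := exp_neg_le_quadratic (sub_nonneg.2 h)
    have e : Real.exp (-t) = Real.exp (-s) * Real.exp (-(t - s)) := by
      rw [← Real.exp_add]; ring_nf
    rw [e]
    nlinarith [mul_le_mul_of_nonneg_left h1 hs0.le, sq_nonneg (t - s)]
  · have h1 := one_sub_sq_le_exp_neg (sub_nonneg.2 h)
    have e : Real.exp (-s) = Real.exp (-t) * Real.exp (-(s - t)) := by
      rw [← Real.exp_add]; ring_nf
    rw [e]
    nlinarith [mul_le_mul_of_nonneg_left h1 ht0.le, sq_nonneg (t - s)]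

theorem expLoss_neg (t : ℝ) : expLoss (-t) = expLoss t := by simp [expLoss]

theorem expLossDeriv_neg (t : ℝ) : expLossDeriv (-t) = -expLossDeriv t := by
  simp [expLossDeriv, Left.sign_neg]

/-- `ℓ` is semiconcave with constant `1`, and `ℓ'` is a supergradient. -/
theorem expLoss_le_quadratic (s t : ℝ) :
    expLoss t ≤ expLoss s + expLossDeriv s * (t - s) + (t - s) ^ 2 / 2 := by
  have key : ∀ s t : ℝ, 0 < s →
      expLoss t ≤ expLoss s + expLossDeriv s * (t - s) + (t - s) ^ 2 / 2 := fun s t hs => by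
    have h := exp_neg_le_of_nonneg hs.le (abs_nonneg t)
    rw [expLossDeriv_of_pos hs]
    unfold expLoss
    rw [abs_of_pos hs]
    refine h.trans ?_
    -- For t < 0 the parabola based at s > 0 is larger at t than at |t|, while ℓ takes the same
    -- value there.
    rcases abs_cases t with ht | ht
    · rw [ht.1]; linarith
    · rw [ht.1]
      nlinarith [Real.exp_pos (-s)]
  rcases lt_trichotomy s 0 with h | h | h
  · have := key (-s) (-t) (by linarith)
    rw [expLoss_neg, expLoss_neg, expLossDeriv_neg] at this
    nlinarith
  · subst h
    have h1 : expLoss 0 = 1 := by simp [expLoss]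
    have h2 : expLossDeriv 0 = 0 := by simp [expLossDeriv]
    rw [h1, h2]
    nlinarith [expLoss_le_one t, sq_nonneg t]
  · exact key s t h

theorem expLossDeriv_mul_self_nonpos (t : ℝ) : expLossDeriv t * t ≤ 0 := by
  rcases lt_trichotomy t 0 with h | h | h
  · rw [expLossDeriv_of_neg h]; nlinarith [Real.exp_pos t]
  · simp [h]
  · rw [expLossDeriv_of_pos h]; nlinarith [Real.exp_pos (-t)]

theorem expLoss_mul_le {c : ℝ} (hc : 1 ≤ c) (t : ℝ) : expLoss (c * t) ≤ expLoss t := by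
  unfold expLoss
  rw [Real.exp_le_exp, abs_mul, abs_of_nonneg (by linarith)]
  nlinarith [abs_nonneg t]

end Semiconcave

/-- `g` is a field of supergradients of the `M`-semiconcave function `L` which, like the unlabelled
losses, decreases along rays. -/
structure IsDescentField {F : Type*} [NormedAddCommGroup F] [InnerProductSpace ℝ F]
    (M : ℝ) (L : F → ℝ) (g : F → F) : Prop where
  le_quadratic : ∀ w, w ≠ 0 → ∀ u, L u ≤ L w + ⟪g w, u - w⟫ + M / 2 * ‖u - w‖ ^ 2
  inner_nonpos : ∀ w, w ≠ 0 → ⟪g w, w⟫ ≤ 0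
  smul_le : ∀ w (c : ℝ), 1 ≤ c → L (c • w) ≤ L w

/-! ### Descent for semiconcave functions and stability of supergradients -/

section Descent

variable {F : Type*} [NormedAddCommGroup F] [InnerProductSpace ℝ F] {M η : ℝ} {L : F → ℝ}
  {g : F → F} {w : F}

/-- As ⟨g w, w⟩ ≤ 0, the step points outwards. Normalization after a step from the unit sphere
therefore never enlarges w₂. -/
theorem IsDescentField.norm_le (h : IsDescentField M L g) (hη : 0 ≤ η) (hw : w ≠ 0) :
    ‖w‖ ≤ ‖w - η • g w‖ := by
  rw [← sq_le_sq₀ (norm_nonneg _) (norm_nonneg _), norm_sub_sq_real, real_inner_smul_right,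
    real_inner_comm]
  have h1 := h.inner_nonpos w hw
  nlinarith [sq_nonneg ‖η • g w‖]

/-- A projected gradient step from the unit ball does not increase the loss. -/
theorem IsDescentField.step_le (h : IsDescentField M L g) (hη : 0 < η) (hM : η * M ≤ 2)
    (hw : w ≠ 0) (hw1 : ‖w‖ ≤ 1) : L (‖w - η • g w‖⁻¹ • (w - η • g w)) ≤ L w := by
  set u := w - η • g w with hu
  have hwpos : 0 < ‖w‖ := norm_pos_iff.2 hw
  have hupos : 0 < ‖u‖ := hwpos.trans_le (h.norm_le hη.le hw)
  have hg : η • g w = w - u := by rw [hu]; abel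
  -- If u lies in the unit ball, normalizing stretches it along its ray, which lowers the loss.
  -- Otherwise the normalization is the projection onto the ball, and its obtuse-angle property
  -- gives η⟨g w, v - w⟩ ≤ -‖v - w‖².
  rcases le_total ‖u‖ 1 with h1 | h1
  · refine (h.smul_le u _ ((one_le_inv₀ hupos).2 h1)).trans ?_
    have h2 := h.le_quadratic w hw u
    have e : u - w = -(η • g w) := by rw [hu]; abel
    rw [e, inner_neg_right, norm_neg, norm_smul, real_inner_smul_right,
      real_inner_self_eq_norm_sq, Real.norm_of_nonneg hη.le] at h2
    nlinarith [mul_nonneg (mul_nonneg hη.le (sub_nonneg.2 hM)) (sq_nonneg ‖g w‖)]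
  · set v := ‖u‖⁻¹ • u with hv
    have h2 := h.le_quadratic w hw v
    have hvn : ‖v‖ = 1 := by rw [hv, norm_smul]; simp [hupos.ne']
    have huv : u = ‖u‖ • v := by rw [hv, smul_smul, mul_inv_cancel₀ hupos.ne', one_smul]
    have e1 : η * ⟪g w, v - w⟫ = -‖v - w‖ ^ 2 - (‖u‖ - 1) * (1 - ⟪v, w⟫) := by
      rw [← real_inner_smul_left, hg]
      have : w - u = -(v - w) - (‖u‖ - 1) • v := by
        nth_rewrite 1 [huv]; rw [sub_smul, one_smul]; abel
      rw [this, inner_sub_left, inner_neg_left, real_inner_self_eq_norm_sq, real_inner_smul_left,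
        inner_sub_right, real_inner_self_eq_norm_sq, hvn]
      ring
    have h3 : ⟪v, w⟫ ≤ 1 := by
      refine (real_inner_le_norm v w).trans ?_
      rw [hvn, one_mul]; exact hw1
    have h4 : η * ⟪g w, v - w⟫ ≤ -‖v - w‖ ^ 2 := by
      rw [e1]; nlinarith [mul_nonneg (sub_nonneg.2 h1) (sub_nonneg.2 h3)]
    have h5 : 0 ≤ (2 - η * M) * ‖v - w‖ ^ 2 := mul_nonneg (by linarith) (sq_nonneg _)
    have h6 : η * (⟪g w, v - w⟫ + M / 2 * ‖v - w‖ ^ 2) ≤ 0 := by nlinarith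
    have h7 : ⟪g w, v - w⟫ + M / 2 * ‖v - w‖ ^ 2 ≤ 0 := by
      by_contra hcon
      push Not at hcon
      nlinarith [mul_pos hη hcon]
    linarith

/-- Supergradients of uniformly close functions are close where one of the functions is smooth. -/
theorem IsDescentField.norm_sub_le (h : IsDescentField M L g) {L' : F → ℝ} {g' : F}
    {M' θ : ℝ} (hθ : 0 < θ) (hw : w ≠ 0)
    (hsm : ∀ u, ‖u‖ ≤ θ → L' w + ⟪g', u⟫ - M' * ‖u‖ ^ 2 ≤ L' (w + u))
    (hclose : ∀ u, ‖u‖ ≤ θ → |(L (w + u) - L' (w + u)) - (L w - L' w)| ≤ θ * (‖u‖ + θ)) :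
    ‖g w - g'‖ ≤ (2 + M / 2 + M') * θ := by
  set e := g w - g' with he
  rcases eq_or_ne e 0 with h0 | h0
  -- The constants M and M' carry no sign here, so nonnegativity of the bound has to be extracted by
  -- testing any vector of norm θ.
  · have h1 := h.le_quadratic w hw w
    by_contra hcon
    push Not at hcon
    rw [h0, norm_zero] at hcon
    have hneg : 2 + M / 2 + M' < 0 := by
      by_contra hc; push Not at hc; exact absurd hcon (not_lt.2 (mul_nonneg hc hθ.le))
    rcases subsingleton_or_nontrivial F with hs | hs
    · exact hw (Subsingleton.elim _ _)
    · obtain ⟨u, hu⟩ := exists_norm_eq F hθ.le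
      have h2 := h.le_quadratic w hw (w + u)
      have h3 := hsm u hu.le
      have h4 := (abs_le.1 (hclose u hu.le)).1
      rw [add_sub_cancel_left, hu] at h2
      rw [hu] at h3 h4
      have h5 : ⟪g w, u⟫ = ⟪g', u⟫ := by
        rw [← sub_eq_zero, ← inner_sub_left, ← he, h0, inner_zero_left]
      nlinarith [sq_nonneg θ, mul_pos hθ hθ]
  · have hpos : 0 < ‖e‖ := norm_pos_iff.2 h0
    -- Moving by θ against the discrepancy e, the upper bound for L and the lower bound for L'
    -- differ by θ‖e‖ up to terms of order θ².
    set u := -(θ * ‖e‖⁻¹) • e with hu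
    have hun : ‖u‖ = θ := by
      rw [hu, norm_smul, norm_neg, Real.norm_of_nonneg (by positivity), mul_assoc,
        inv_mul_cancel₀ hpos.ne', mul_one]
    have h2 := h.le_quadratic w hw (w + u)
    have h3 := hsm u hun.le
    have h4 := (abs_le.1 (hclose u hun.le)).1
    rw [add_sub_cancel_left, hun] at h2
    rw [hun] at h3 h4
    have h5 : ⟪g w, u⟫ - ⟪g', u⟫ = -(θ * ‖e‖) := by
      rw [← inner_sub_left, ← he, hu, real_inner_smul_right, real_inner_self_eq_norm_sq]
      field_simp
    have h6 : θ * ‖e‖ ≤ θ * ((2 + M / 2 + M') * θ) := by nlinarith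
    exact le_of_mul_le_mul_left h6 hθ

end Descent

/-! ### The population and empirical losses as descent fields -/

section Losses

variable {d₁ d₂ : ℕ}

theorem predict_sub (w u : Weights d₁ d₂) (x : Euc d₁ × Euc d₂) :
    predict (w - u) x = predict w x - predict u x := inner_sub_left _ _ _

theorem predict_smul (c : ℝ) (w : Weights d₁ d₂) (x : Euc d₁ × Euc d₂) :
    predict (c • w) x = c * predict w x := real_inner_smul_left _ _ _

theorem abs_predict_le (w : Weights d₁ d₂) (x : Euc d₁ × Euc d₂) :
    |predict w x| ≤ ‖w‖ * ‖WithLp.toLp 2 x‖ := abs_real_inner_le_norm _ _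

theorem continuous_norm_toLp :
    Continuous fun x : Euc d₁ × Euc d₂ => ‖WithLp.toLp 2 x‖ :=
  continuous_norm.comp (WithLp.prod_continuous_toLp 2 _ _)

theorem norm_toLp_sq (x : Euc d₁ × Euc d₂) :
    ‖WithLp.toLp 2 x‖ ^ 2 = ‖x.1‖ ^ 2 + ‖x.2‖ ^ 2 := by
  rw [WithLp.prod_norm_sq_eq_of_L2]; rfl

theorem sq_predict_le (w : Weights d₁ d₂) (x : Euc d₁ × Euc d₂) :
    predict w x ^ 2 ≤ ‖w‖ ^ 2 * ‖WithLp.toLp 2 x‖ ^ 2 := by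
  rw [← mul_pow, ← sq_abs]
  exact pow_le_pow_left₀ (abs_nonneg _) (abs_predict_le w x) 2

theorem isDescentField_empLoss {n : ℕ} (X : Fin n → Euc d₁ × Euc d₂) {M : ℝ}
    (hM : (n : ℝ)⁻¹ * ∑ i, ‖WithLp.toLp 2 (X i)‖ ^ 2 ≤ M) :
    IsDescentField M (empLoss X) (empGrad X) := by
  have hn : (0 : ℝ) ≤ (n : ℝ)⁻¹ := by positivity
  have hinner : ∀ w u, ⟪empGrad X w, u⟫ =
      (n : ℝ)⁻¹ * ∑ i, expLossDeriv (predict w (X i)) * predict u (X i) := fun w u => by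
    unfold empGrad
    rw [real_inner_smul_left, sum_inner]
    refine congrArg _ (Finset.sum_congr rfl fun i _ => ?_)
    rw [real_inner_smul_left, real_inner_comm]
    rfl
  refine ⟨fun w _ u => ?_, fun w _ => ?_, fun w c hc => ?_⟩
  · have h1 : ∀ i, expLoss (predict u (X i)) ≤ expLoss (predict w (X i)) +
        expLossDeriv (predict w (X i)) * predict (u - w) (X i) +
        ‖u - w‖ ^ 2 / 2 * ‖WithLp.toLp 2 (X i)‖ ^ 2 := fun i => by
      have h := expLoss_le_quadratic (predict w (X i)) (predict u (X i))
      have h2 := sq_predict_le (u - w) (X i)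
      rw [predict_sub] at h2 ⊢
      linarith
    have h2 := mul_le_mul_of_nonneg_left (Finset.sum_le_sum fun i (_ : i ∈ Finset.univ) => h1 i) hn
    rw [Finset.sum_add_distrib, Finset.sum_add_distrib, ← Finset.mul_sum, mul_add, mul_add,
      ← hinner] at h2
    have h3 := mul_le_mul_of_nonneg_left hM (by positivity : 0 ≤ ‖u - w‖ ^ 2 / 2)
    unfold empLoss
    linarith
  · rw [hinner]
    exact mul_nonpos_of_nonneg_of_nonpos hn
      (Finset.sum_nonpos fun i _ => expLossDeriv_mul_self_nonpos _)
  · unfold empLoss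
    refine mul_le_mul_of_nonneg_left (Finset.sum_le_sum fun i _ => ?_) hn
    rw [predict_smul]
    exact expLoss_mul_le hc _

variable {P : Measure (Euc d₁ × Euc d₂)} [IsProbabilityMeasure P]

theorem integrable_deriv_mul_predict (hP : Integrable (fun x => ‖WithLp.toLp 2 x‖ ^ 2) P)
    (w u : Weights d₁ d₂) :
    Integrable (fun x => expLossDeriv (predict w x) * predict u x) P := by
  refine ((integrable_const (‖u‖ : ℝ)).add (hP.const_mul ‖u‖)).mono'
    ((measurable_expLossDeriv.comp (continuous_predict w).measurable).mul
      (continuous_predict u).measurable).aestronglyMeasurable (ae_of_all _ fun x => ?_)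
  rw [norm_mul, Real.norm_eq_abs, Real.norm_eq_abs, Pi.add_apply]
  calc |expLossDeriv (predict w x)| * |predict u x| ≤ 1 * (‖u‖ * ‖WithLp.toLp 2 x‖) :=
        mul_le_mul (abs_expLossDeriv_le _) (abs_predict_le u x) (abs_nonneg _) zero_le_one
    _ ≤ _ := by
        nlinarith [norm_nonneg u, mul_nonneg (norm_nonneg u) (sq_nonneg (‖WithLp.toLp 2 x‖ - 1))]

theorem integrable_expLoss_predict (w : Weights d₁ d₂) :
    Integrable (fun x => expLoss (predict w x)) P :=
  integrable_expLoss_comp (continuous_predict w).measurable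

theorem popLoss_le_quadratic (hP : Integrable (fun x => ‖WithLp.toLp 2 x‖ ^ 2) P)
    (w u : Weights d₁ d₂) :
    popLoss P u ≤ popLoss P w + (∫ x, expLossDeriv (predict w x) * predict (u - w) x ∂P) +
      (∫ x, ‖WithLp.toLp 2 x‖ ^ 2 ∂P) / 2 * ‖u - w‖ ^ 2 := by
  have hI := integrable_deriv_mul_predict hP w (u - w)
  have e : popLoss P w + (∫ x, expLossDeriv (predict w x) * predict (u - w) x ∂P) +
      (∫ x, ‖WithLp.toLp 2 x‖ ^ 2 ∂P) / 2 * ‖u - w‖ ^ 2 =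
      ∫ x, (expLoss (predict w x) + expLossDeriv (predict w x) * predict (u - w) x +
        ‖u - w‖ ^ 2 / 2 * ‖WithLp.toLp 2 x‖ ^ 2) ∂P := by
    rw [integral_add (f := fun x => _ + _) ((integrable_expLoss_predict w).add hI) (hP.const_mul _),
      integral_add (integrable_expLoss_predict w) hI, integral_const_mul]
    unfold popLoss
    ring
  rw [e]
  refine integral_mono (integrable_expLoss_predict u)
    (((integrable_expLoss_predict w).add hI).add (hP.const_mul _)) fun x => ?_
  have h := expLoss_le_quadratic (predict w x) (predict u x)
  have h2 := sq_predict_le (u - w) x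
  simp only
  rw [predict_sub] at h2 ⊢
  linarith

/-- At a point of differentiability the only supergradient is the gradient: along a line, the loss
minus its upper parabola is maximal at the base point. The kink may have positive mass under P
without affecting this argument. -/
theorem inner_gradient_popLoss (hP : Integrable (fun x => ‖WithLp.toLp 2 x‖ ^ 2) P)
    {w : Weights d₁ d₂} (hd : DifferentiableAt ℝ (popLoss P) w) (u : Weights d₁ d₂) :
    ⟪gradient (popLoss P) w, u⟫ = ∫ x, expLossDeriv (predict w x) * predict u x ∂P := by
  set M := ∫ x, ‖WithLp.toLp 2 x‖ ^ 2 ∂P with hM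
  set c := ∫ x, expLossDeriv (predict w x) * predict u x ∂P with hc
  have h1 := hasDerivAt_line_of_differentiableAt hd u
  have h2 : HasDerivAt (fun s : ℝ => popLoss P (w + s • u) - (s * c + M / 2 * ‖u‖ ^ 2 * s ^ 2))
      (⟪gradient (popLoss P) w, u⟫ - c) 0 := by
    have h3 : HasDerivAt (fun s : ℝ => s * c + M / 2 * ‖u‖ ^ 2 * s ^ 2) c 0 := by
      refine (((hasDerivAt_id (0 : ℝ)).mul_const c).fun_add
        ((hasDerivAt_pow 2 (0 : ℝ)).const_mul (M / 2 * ‖u‖ ^ 2))).congr_deriv ?_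
      simp
    exact h1.fun_sub h3
  have hmax : IsLocalMax (fun s : ℝ => popLoss P (w + s • u) -
      (s * c + M / 2 * ‖u‖ ^ 2 * s ^ 2)) 0 := by
    refine Eventually.of_forall fun s => ?_
    have h4 := popLoss_le_quadratic hP w (w + s • u)
    rw [add_sub_cancel_left, norm_smul, mul_pow, Real.norm_eq_abs, sq_abs, ← hM] at h4
    have h5 : ∫ x, expLossDeriv (predict w x) * predict (s • u) x ∂P = s * c := by
      rw [hc, ← integral_const_mul]
      refine integral_congr_ae (ae_of_all _ fun x => ?_)
      simp only [predict_smul]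
      ring
    rw [h5] at h4
    simp only [zero_smul, add_zero, zero_mul, ne_eq, OfNat.ofNat_ne_zero, not_false_eq_true,
      zero_pow, mul_zero, sub_zero]
    linarith
  have := hmax.hasDerivAt_eq_zero h2
  linarith

theorem isDescentField_popLoss (hP : Integrable (fun x => ‖WithLp.toLp 2 x‖ ^ 2) P)
    (hd : ∀ w, w ≠ 0 → DifferentiableAt ℝ (popLoss P) w) {M : ℝ}
    (hM : ∫ x, ‖WithLp.toLp 2 x‖ ^ 2 ∂P ≤ M) :
    IsDescentField M (popLoss P) (gradient (popLoss P)) := by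
  refine ⟨fun w hw u => ?_, fun w hw => ?_, fun w c hc => ?_⟩
  · rw [inner_gradient_popLoss hP (hd w hw)]
    refine (popLoss_le_quadratic hP w u).trans ?_
    gcongr
  · rw [inner_gradient_popLoss hP (hd w hw)]
    exact integral_nonpos fun x => expLossDeriv_mul_self_nonpos _
  · refine integral_mono (integrable_expLoss_predict _) (integrable_expLoss_predict _) fun x => ?_
    simp only [predict_smul]
    exact expLoss_mul_le hc _

end Losses

end

/-! ### The invariant region and the contraction of the spurious part -/

section

/-- Expanding the square, s‖B‖² ≤ 1 lets half of the cross term absorb the quadratic term. What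
remains is (1 - s b²)‖v‖², and 1 - x ≤ (1 - x/2)². -/
theorem norm_sub_smul_sq_le {F : Type*} [NormedAddCommGroup F] [InnerProductSpace ℝ F]
    {B : F →L[ℝ] F} (hB : ∀ u v, ⟪B u, v⟫ = ⟪u, B v⟫) {b s : ℝ} (hb : 0 ≤ b)
    (hbB : ∀ v, b * ‖v‖ ≤ ‖B v‖) (hs : 0 ≤ s) (hsB : s * ‖B‖ ^ 2 ≤ 1) (v : F) :
    ‖v - s • B (B v)‖ ≤ (1 - s * b ^ 2 / 2) * ‖v‖ := by
  rcases eq_or_ne v 0 with h0 | h0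
  · simp [h0]
  have hv : 0 < ‖v‖ := norm_pos_iff.2 h0
  have h1 : ‖B (B v)‖ ≤ ‖B‖ * ‖B v‖ := B.le_opNorm _
  have h2 : b ≤ ‖B‖ := le_of_mul_le_mul_right ((hbB v).trans (B.le_opNorm v)) hv
  have h3 : s * b ^ 2 ≤ 1 := le_trans (by gcongr) hsB
  have h4 : b ^ 2 * ‖v‖ ^ 2 ≤ ‖B v‖ ^ 2 := by rw [← mul_pow]; gcongr; exact hbB v
  have h5 : ‖B (B v)‖ ^ 2 ≤ ‖B‖ ^ 2 * ‖B v‖ ^ 2 := by rw [← mul_pow]; gcongr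
  refine le_of_sq_le_sq ?_ (mul_nonneg (by linarith) hv.le)
  rw [norm_sub_sq_real, real_inner_smul_right, ← hB, real_inner_self_eq_norm_sq, norm_smul, mul_pow,
    Real.norm_of_nonneg hs, mul_pow]
  have h6 : s ^ 2 * ‖B (B v)‖ ^ 2 ≤ s * ‖B v‖ ^ 2 := by
    calc s ^ 2 * ‖B (B v)‖ ^ 2 ≤ s ^ 2 * (‖B‖ ^ 2 * ‖B v‖ ^ 2) := by gcongr
      _ = s * (s * ‖B‖ ^ 2) * ‖B v‖ ^ 2 := by ring
      _ ≤ s * 1 * ‖B v‖ ^ 2 := by gcongr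
      _ = _ := by ring
  nlinarith [mul_le_mul_of_nonneg_left h4 hs, sq_nonneg (s * b ^ 2 / 2 * ‖v‖)]

variable {d₁ d₂ : ℕ} {B : Euc d₂ →L[ℝ] Euc d₂}

/-- The part of the unit ball where the signal dominates. -/
structure InRegion (B : Euc d₂ →L[ℝ] Euc d₂) (V : ℝ) (w : Weights d₁ d₂) : Prop where
  norm_le : ‖w‖ ≤ 1
  signal : 1 / 2 ≤ ‖w.fst‖
  variance : ‖B w.snd‖ ^ 2 ≤ V * ‖w.fst‖ ^ 2

theorem weights_norm_sq (w : Weights d₁ d₂) : ‖w‖ ^ 2 = ‖w.fst‖ ^ 2 + ‖w.snd‖ ^ 2 :=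
  WithLp.prod_norm_sq_eq_of_L2 w

theorem norm_fst_le (w : Weights d₁ d₂) : ‖w.fst‖ ≤ ‖w‖ :=
  le_of_sq_le_sq (by rw [weights_norm_sq]; linarith [sq_nonneg ‖w.snd‖]) (norm_nonneg _)

theorem norm_snd_le (w : Weights d₁ d₂) : ‖w.snd‖ ≤ ‖w‖ :=
  le_of_sq_le_sq (by rw [weights_norm_sq]; linarith [sq_nonneg ‖w.fst‖]) (norm_nonneg _)

theorem weights_inner (w u : Weights d₁ d₂) : ⟪w, u⟫ = ⟪w.fst, u.fst⟫ + ⟪w.snd, u.snd⟫ :=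
  WithLp.prod_inner_apply w u

theorem InRegion.ne_zero {V : ℝ} {w : Weights d₁ d₂} (h : InRegion B V w) : w ≠ 0 := by
  rintro rfl
  have := h.signal
  simp at this
  linarith

theorem norm_inv_smul_fst (u : Weights d₁ d₂) : ‖(‖u‖⁻¹ • u).fst‖ = ‖u.fst‖ / ‖u‖ := by
  rw [WithLp.smul_fst, norm_smul, norm_inv, norm_norm, div_eq_inv_mul]

theorem norm_inv_smul_snd (u : Weights d₁ d₂) : ‖(‖u‖⁻¹ • u).snd‖ = ‖u.snd‖ / ‖u‖ := by
  rw [WithLp.smul_snd, norm_smul, norm_inv, norm_norm, div_eq_inv_mul]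

theorem norm_map_inv_smul_snd (u : Weights d₁ d₂) :
    ‖B (‖u‖⁻¹ • u).snd‖ = ‖B u.snd‖ / ‖u‖ := by
  rw [WithLp.smul_snd, map_smul, norm_smul, norm_inv, norm_norm, div_eq_inv_mul]

/-- The variance condition is homogeneous, hence unaffected by normalization. The signal condition
survives since ‖u₂‖² ≤ ‖w₂‖² ≤ 3/4 ≤ 3‖u₁‖². -/
theorem InRegion.normalize {V : ℝ} {w u : Weights d₁ d₂} (h : InRegion B V w) (hV : 0 ≤ V)
    (hu : 0 < ‖u‖) (h2 : ‖u.snd‖ ≤ ‖w.snd‖) (hB2 : ‖B u.snd‖ ≤ ‖B w.snd‖)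
    (h1 : ‖w.fst‖ ≤ ‖u.fst‖) : InRegion B V (‖u‖⁻¹ • u) := by
  refine ⟨?_, ?_, ?_⟩
  · rw [norm_smul, norm_inv, norm_norm, inv_mul_cancel₀ hu.ne']
  · have h6 := weights_norm_sq w
    have h7 := weights_norm_sq u
    have h8 : ‖u‖ ^ 2 ≤ (2 * ‖u.fst‖) ^ 2 := by
      have := h.norm_le
      have := h.signal
      have h9 : ‖u.snd‖ ^ 2 ≤ ‖w.snd‖ ^ 2 := pow_le_pow_left₀ (norm_nonneg _) h2 2
      have h10 : ‖w.fst‖ ^ 2 ≤ ‖u.fst‖ ^ 2 := pow_le_pow_left₀ (norm_nonneg _) h1 2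
      nlinarith [norm_nonneg w]
    have h9 := le_of_sq_le_sq h8 (mul_nonneg zero_le_two (norm_nonneg _))
    rw [norm_inv_smul_fst, le_div_iff₀ hu]
    linarith
  · rw [norm_map_inv_smul_snd, norm_inv_smul_fst, div_pow, div_pow, ← mul_div_assoc]
    refine div_le_div_of_nonneg_right ?_ (sq_nonneg _)
    exact (pow_le_pow_left₀ (norm_nonneg _) hB2 2).trans (h.variance.trans
      (mul_le_mul_of_nonneg_left (pow_le_pow_left₀ (norm_nonneg _) h1 2) hV))

/-- Covers tiny spurious parts, where the gradient error may exceed the shrinkage and monotonicity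
arguments fail: a unit vector close to the signal space is in the region anyway. -/
theorem inRegion_of_norm_snd_le {V s₀ : ℝ} {v : Weights d₁ d₂} (hv : ‖v‖ = 1)
    (h : ‖v.snd‖ ≤ 2 * s₀) (hs₀1 : 4 * s₀ ^ 2 ≤ 3 / 4)
    (hs₀V : ‖B‖ ^ 2 * (4 * s₀ ^ 2) ≤ V * (1 / 4)) (hV : 0 ≤ V) : InRegion B V v := by
  have hsq := weights_norm_sq v
  rw [hv, one_pow] at hsq
  have h5 : ‖v.snd‖ ^ 2 ≤ 4 * s₀ ^ 2 :=
    (pow_le_pow_left₀ (norm_nonneg _) h 2).trans_eq (by ring)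
  have h6 : 1 / 4 ≤ ‖v.fst‖ ^ 2 := by linarith
  refine ⟨hv.le, le_of_sq_le_sq (by linarith) (norm_nonneg _), ?_⟩
  have h7 : ‖B v.snd‖ ^ 2 ≤ ‖B‖ ^ 2 * ‖v.snd‖ ^ 2 := by
    rw [← mul_pow]; exact pow_le_pow_left₀ (norm_nonneg _) (B.le_opNorm _) 2
  have h8 := mul_le_mul_of_nonneg_left h5 (sq_nonneg ‖B‖)
  have h9 := mul_le_mul_of_nonneg_left h6 hV
  linarith

section Step

variable {M V b c ξ s₀ η r : ℝ} {L : Weights d₁ d₂ → ℝ} {g : Weights d₁ d₂ → Weights d₁ d₂}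
  {w : Weights d₁ d₂} {e : Euc d₂}

/-- The unnormalized step contracts the spurious coordinates up to the gradient error. -/
theorem norm_snd_step_le (hB : ∀ u v, ⟪B u, v⟫ = ⟪u, B v⟫) (hb : 0 ≤ b)
    (hbB : ∀ v, b * ‖v‖ ≤ ‖B v‖) (hη : 0 ≤ η) (hηB : η * ‖B‖ ^ 2 ≤ 1) (hc : 0 ≤ c) (hcr : c ≤ r)
    (hr : r ≤ 1) (hg : (g w).snd = r • B (B w.snd) + e) (he : ‖e‖ ≤ ξ) :
    ‖(w - η • g w).snd‖ ≤ (1 - η * c * b ^ 2 / 2) * ‖w.snd‖ + η * ξ ∧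
    ‖B (w - η • g w).snd‖ ≤ (1 - η * c * b ^ 2 / 2) * ‖B w.snd‖ + η * (‖B‖ * ξ) := by
  have hsnd : (w - η • g w).snd = (w.snd - (η * r) • B (B w.snd)) - η • e := by
    rw [WithLp.sub_snd, WithLp.smul_snd, hg, smul_add, smul_smul]
    abel
  have hr0 : 0 ≤ r := hc.trans hcr
  have h1 : η * r * ‖B‖ ^ 2 ≤ 1 := by
    calc η * r * ‖B‖ ^ 2 ≤ η * 1 * ‖B‖ ^ 2 := by gcongr
      _ ≤ 1 := by rw [mul_one]; exact hηB
  have hcon : ∀ v, ‖v - (η * r) • B (B v)‖ ≤ (1 - η * c * b ^ 2 / 2) * ‖v‖ := fun v => by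
    refine (norm_sub_smul_sq_le hB hb hbB (by positivity) h1 v).trans ?_
    refine mul_le_mul_of_nonneg_right ?_ (norm_nonneg v)
    have : η * c * b ^ 2 ≤ η * r * b ^ 2 := by gcongr
    linarith
  have hηe : ‖η • e‖ ≤ η * ξ := by
    rw [norm_smul, Real.norm_of_nonneg hη]; gcongr
  rw [hsnd]
  refine ⟨(norm_sub_le _ _).trans (add_le_add (hcon _) hηe), ?_⟩
  -- B commutes with the step matrix, so the standard deviation ‖B w₂‖ contracts by the same factor;
  -- this preserves the variance condition.
  have hBe : B (w.snd - (η * r) • B (B w.snd) - η • e) =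
      (B w.snd - (η * r) • B (B (B w.snd))) - B (η • e) := by
    rw [map_sub, map_sub, map_smul]
  rw [hBe]
  refine (norm_sub_le _ _).trans (add_le_add (hcon _) ?_)
  calc ‖B (η • e)‖ ≤ ‖B‖ * ‖η • e‖ := B.le_opNorm _
    _ ≤ ‖B‖ * (η * ξ) := by gcongr
    _ = _ := by ring

/-- As long as the spurious part is not tiny, the step does not shrink the signal. -/
theorem norm_fst_le_step (hL : IsDescentField M L g) (hB : ∀ u v, ⟪B u, v⟫ = ⟪u, B v⟫)
    (hbB : ∀ v, b * ‖v‖ ≤ ‖B v‖) (hb : 0 ≤ b) (hη : 0 ≤ η) (hc : 0 ≤ c) (hcr : c ≤ r)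
    (hg : (g w).snd = r • B (B w.snd) + e) (he : ‖e‖ ≤ ξ) (hξ : ξ ≤ c * b ^ 2 * ‖w.snd‖)
    (hw : w ≠ 0) : ‖w.fst‖ ≤ ‖(w - η • g w).fst‖ := by
  have h1 := hL.inner_nonpos w hw
  rw [weights_inner, hg, inner_add_left, real_inner_smul_left, hB, real_inner_self_eq_norm_sq] at h1
  have h2 : -(‖w.snd‖ * ξ) ≤ ⟪e, w.snd⟫ := by
    have := (abs_le.1 (abs_real_inner_le_norm e w.snd)).1
    nlinarith [norm_nonneg w.snd]
  have h3 : b ^ 2 * ‖w.snd‖ ^ 2 ≤ ‖B w.snd‖ ^ 2 := by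
    rw [← mul_pow]; exact pow_le_pow_left₀ (by positivity) (hbB _) 2
  have h4 : c * (b ^ 2 * ‖w.snd‖ ^ 2) ≤ r * ‖B w.snd‖ ^ 2 :=
    mul_le_mul hcr h3 (by positivity) (hc.trans hcr)
  have h5 : ⟪(g w).fst, w.fst⟫ ≤ 0 := by nlinarith [norm_nonneg w.snd]
  have hfst : (w - η • g w).fst = w.fst - η • (g w).fst := by
    rw [WithLp.sub_fst, WithLp.smul_fst]
  rw [hfst]
  refine le_of_sq_le_sq ?_ (norm_nonneg _)
  rw [norm_sub_sq_real, real_inner_smul_right, real_inner_comm]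
  nlinarith [sq_nonneg ‖η • (g w).fst‖]

/-- Two regimes, separated by s₀. Above it, contraction beats the error: ‖w₂‖ and ‖B w₂‖ do not grow
and ‖w₁‖ does not shrink. Below it, the new spurious part is at most 2s₀ after normalization, since
‖u‖ ≥ 1/2. -/
theorem InRegion.step (h : InRegion B V w) (hL : IsDescentField M L g)
    (hB : ∀ u v, ⟪B u, v⟫ = ⟪u, B v⟫) (hbB : ∀ v, b * ‖v‖ ≤ ‖B v‖) (hb : 0 < b) (hη : 0 ≤ η)
    (hηB : η * ‖B‖ ^ 2 ≤ 1) (hc : 0 < c) (hcr : c ≤ r) (hr : r ≤ 1) (hηc : η * c * b ^ 2 ≤ 1)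
    (hg : (g w).snd = r • B (B w.snd) + e) (he : ‖e‖ ≤ ξ) (hs₀ : 0 < s₀)
    (hs₀1 : 4 * s₀ ^ 2 ≤ 3 / 4) (hs₀V : ‖B‖ ^ 2 * (4 * s₀ ^ 2) ≤ V * (1 / 4)) (hV : 0 ≤ V)
    (hξ : ξ ≤ c * b ^ 2 / 2 * s₀) (hξB : ‖B‖ * ξ ≤ c * b ^ 2 / 2 * (b * s₀)) :
    InRegion B V (projStep g η w) ∧ ‖projStep g η w‖ = 1 ∧
      ‖(projStep g η w).snd‖ ≤ ((1 - η * c * b ^ 2 / 2) * ‖w.snd‖ + η * ξ) / ‖w‖ := by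
  have hw := h.ne_zero
  have hwpos : 0 < ‖w‖ := norm_pos_iff.2 hw
  obtain ⟨h1, h2⟩ := norm_snd_step_le (g := g) hB hb.le hbB hη hηB hc.le hcr hr hg he
  have hu := hL.norm_le hη hw
  have hfst : c * b ^ 2 / 2 * s₀ ≤ c * b ^ 2 * ‖w.snd‖ → ‖w.fst‖ ≤ ‖(w - η • g w).fst‖ := fun hs =>
    norm_fst_le_step hL hB hbB hb.le hη hc.le hcr hg he (hξ.trans hs) hw
  have hstep : projStep g η w = ‖w - η • g w‖⁻¹ • (w - η • g w) := rfl
  rw [hstep]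
  generalize w - η • g w = u at *
  have hupos : 0 < ‖u‖ := hwpos.trans_le hu
  have hnorm : ‖‖u‖⁻¹ • u‖ = 1 := by
    rw [norm_smul, norm_inv, norm_norm, inv_mul_cancel₀ hupos.ne']
  have hηc0 : 0 ≤ 1 - η * c * b ^ 2 / 2 := by linarith
  have hcb : 0 ≤ η * (c * b ^ 2 / 2) := by positivity
  have hξη := mul_le_mul_of_nonneg_left hξ hη
  refine ⟨?_, hnorm, ?_⟩
  · rcases le_or_gt s₀ ‖w.snd‖ with hcase | hcase
    · refine h.normalize hV hupos ?_ ?_ (hfst ?_)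
      · have := mul_le_mul_of_nonneg_left hcase hcb
        linarith
      · have h5 := mul_le_mul_of_nonneg_left hξB hη
        have h6 : b * s₀ ≤ ‖B w.snd‖ := (mul_le_mul_of_nonneg_left hcase hb.le).trans (hbB w.snd)
        have := mul_le_mul_of_nonneg_left h6 hcb
        linarith
      · have h5 : c * b ^ 2 * s₀ ≤ c * b ^ 2 * ‖w.snd‖ :=
          mul_le_mul_of_nonneg_left hcase (by positivity)
        have h6 : 0 ≤ c * b ^ 2 * s₀ := by positivity
        linarith
    · refine inRegion_of_norm_snd_le hnorm ?_ hs₀1 hs₀V hV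
      have h3 : ‖u.snd‖ ≤ s₀ := by
        have := mul_le_mul_of_nonneg_left hcase.le hηc0
        linarith
      have hu2 : 1 / 2 ≤ ‖u‖ := (h.signal.trans (norm_fst_le w)).trans hu
      rw [norm_inv_smul_snd, div_le_iff₀ hupos]
      nlinarith
  · rw [norm_inv_smul_snd]
    exact div_le_div₀ ((norm_nonneg _).trans h1) h1 hwpos hu

end Step

/-- Iterates of a descent field whose spurious part is `r Σ w₂` up to an error `ξ` on the region
where the signal dominates and the loss is small: they stay in this region, and their spurious part
contracts to the scale of the error. -/
theorem norm_snd_iterate_le {M V b c ξ s₀ η : ℝ} {L : Weights d₁ d₂ → ℝ}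
    {g : Weights d₁ d₂ → Weights d₁ d₂} {ws : Weights d₁ d₂} (hws : InRegion B V ws)
    (hL : IsDescentField M L g)
    (hg : ∀ w, InRegion B V w → L w ≤ L ws →
      ∃ r e, c ≤ r ∧ r ≤ 1 ∧ ‖e‖ ≤ ξ ∧ (g w).snd = r • B (B w.snd) + e)
    (hB : ∀ u v, ⟪B u, v⟫ = ⟪u, B v⟫) (hbB : ∀ v, b * ‖v‖ ≤ ‖B v‖) (hb : 0 < b) (hη : 0 < η)
    (hηM : η * M ≤ 2) (hηB : η * ‖B‖ ^ 2 ≤ 1) (hc : 0 < c) (hηc : η * c * b ^ 2 ≤ 1)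
    (hs₀ : 0 < s₀) (hs₀1 : 4 * s₀ ^ 2 ≤ 3 / 4) (hs₀V : ‖B‖ ^ 2 * (4 * s₀ ^ 2) ≤ V * (1 / 4))
    (hV : 0 ≤ V) (hξ : ξ ≤ c * b ^ 2 / 2 * s₀) (hξB : ‖B‖ * ξ ≤ c * b ^ 2 / 2 * (b * s₀))
    (hξ0 : 0 ≤ ξ) (t : ℕ) :
    ‖(iterate g η ws (t + 1)).snd‖ ≤ (1 - η * c * b ^ 2 / 2) ^ t + 2 * ξ / (c * b ^ 2) := by
  have hstep : ∀ w, InRegion B V w → L w ≤ L ws → (InRegion B V (projStep g η w) ∧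
      ‖projStep g η w‖ = 1 ∧ ‖(projStep g η w).snd‖ ≤
        ((1 - η * c * b ^ 2 / 2) * ‖w.snd‖ + η * ξ) / ‖w‖) ∧ L (projStep g η w) ≤ L ws := by
    intro w hw hLw
    obtain ⟨r, e, hcr, hr, he, hge⟩ := hg w hw hLw
    exact ⟨hw.step hL hB hbB hb hη.le hηB hc hcr hr hηc hge he hs₀ hs₀1 hs₀V hV hξ hξB,
      (hL.step_le hη hηM hw.ne_zero hw.norm_le).trans hLw⟩
  have hinv : ∀ t, InRegion B V (iterate g η ws (t + 1)) ∧ ‖iterate g η ws (t + 1)‖ = 1 ∧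
      L (iterate g η ws (t + 1)) ≤ L ws := by
    intro t
    induction t with
    | zero =>
      obtain ⟨⟨h1, h2, -⟩, h3⟩ := hstep ws hws le_rfl
      exact ⟨h1, h2, h3⟩
    | succ t ih =>
      obtain ⟨⟨h1, h2, -⟩, h3⟩ := hstep _ ih.1 ih.2.2
      exact ⟨h1, h2, h3⟩
  have hρ0 : 0 ≤ 1 - η * c * b ^ 2 / 2 := by linarith
  induction t with
  -- The source need not have norm 1, so normalization may spoil the contraction of the first step.
  -- The count starts at iterate 1, a unit vector.
  | zero =>
    rw [pow_zero]
    have h1 := norm_snd_le (iterate g η ws (0 + 1))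
    rw [(hinv 0).2.1] at h1
    have : 0 ≤ 2 * ξ / (c * b ^ 2) := by positivity
    linarith
  | succ t ih =>
    obtain ⟨h1, h2, h3⟩ := hinv t
    have h4 := (hstep _ h1 h3).1.2.2
    rw [h2, div_one] at h4
    calc ‖(iterate g η ws (t + 1 + 1)).snd‖ ≤
        (1 - η * c * b ^ 2 / 2) * ‖(iterate g η ws (t + 1)).snd‖ + η * ξ := h4
      _ ≤ (1 - η * c * b ^ 2 / 2) * ((1 - η * c * b ^ 2 / 2) ^ t + 2 * ξ / (c * b ^ 2)) + η * ξ := by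
          gcongr
      _ = _ := by field_simp; ring

end

section

/-! ### Chernoff bounds for sums of independent samples -/

section Chernoff

variable {Ω : Type*} [MeasurableSpace Ω] {P : Measure Ω} [IsProbabilityMeasure P]

theorem measureReal_sum_nonneg_le {f : Ω → ℝ} {a : ℝ}
    (hI : Integrable (fun x => Real.exp (f x)) P)
    (h : ∫ x, Real.exp (f x) ∂P ≤ Real.exp (-a)) (n : ℕ) :
    (Measure.pi fun _ : Fin n => P).real {X | 0 ≤ ∑ i, f (X i)} ≤ Real.exp (-(n * a)) := by
  have hprod : ∀ X : Fin n → Ω, Real.exp (∑ i, f (X i)) = ∏ i, Real.exp (f (X i)) := fun X =>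
    Real.exp_sum _ _
  have h1 := mul_meas_ge_le_integral_of_nonneg (μ := Measure.pi fun _ : Fin n => P)
    (f := fun X => Real.exp (∑ i, f (X i))) (ae_of_all _ fun X => (Real.exp_pos _).le)
    (by simp_rw [hprod]; exact Integrable.fintype_prod fun _ => hI) 1
  simp only [Real.one_le_exp_iff, one_mul] at h1
  refine h1.trans ?_
  simp_rw [hprod]
  rw [integral_fintype_prod_eq_pow (fun x => Real.exp (f x)), Fintype.card_fin]
  calc _ ≤ Real.exp (-a) ^ n :=
        pow_le_pow_left₀ (integral_nonneg fun x => (Real.exp_pos _).le) h n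
    _ = _ := by rw [← Real.exp_nat_mul]; ring_nf

theorem exp_le_one_add_sq (v : ℝ) : Real.exp v ≤ 1 + v + v ^ 2 / 2 * Real.exp |v| := by
  rcases le_total 0 v with h | h
  · have h1 := mul_le_mul_of_nonneg_right (one_sub_sq_le_exp_neg h) (Real.exp_pos v).le
    rw [mul_assoc, ← Real.exp_add, neg_add_cancel, Real.exp_zero] at h1
    rw [abs_of_nonneg h]
    linarith
  · have h1 := exp_neg_le_quadratic (neg_nonneg.2 h)
    rw [neg_neg] at h1
    have h2 : (1 : ℝ) ≤ Real.exp |v| := Real.one_le_exp (abs_nonneg v)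
    nlinarith [sq_nonneg v]

/-- A moment generating function bound for a centred variable with an exponential moment. -/
theorem integral_exp_mul_le {Y W : Ω → ℝ} {A s : ℝ} (hY : Integrable Y P) (hY0 : ∫ x, Y x ∂P = 0)
    (hYW : ∀ x, |Y x| ≤ W x) (hW : Integrable (fun x => Real.exp (W x)) P)
    (hA : ∫ x, Real.exp (W x) ∂P ≤ A) (hs : 0 ≤ s) (hs1 : s ≤ 1 / 2) :
    Integrable (fun x => Real.exp (s * Y x)) P ∧
      ∫ x, Real.exp (s * Y x) ∂P ≤ Real.exp (4 * A * s ^ 2) := by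
  have hm : AEStronglyMeasurable (fun x => Real.exp (s * Y x)) P :=
    (Real.continuous_exp.comp_aestronglyMeasurable (hY.aestronglyMeasurable.const_mul s))
  have hI : Integrable (fun x => Real.exp (s * Y x)) P := by
    refine hW.mono' hm (ae_of_all _ fun x => ?_)
    rw [Real.norm_eq_abs, Real.abs_exp, Real.exp_le_exp]
    have h0 := abs_nonneg (Y x)
    nlinarith [le_abs_self (Y x), hYW x]
  refine ⟨hI, ?_⟩
  have hb : ∀ x, Real.exp (s * Y x) ≤ 1 + s * Y x + 4 * s ^ 2 * Real.exp (W x) := fun x => by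
    have h0 := abs_nonneg (Y x)
    have h1 := exp_le_one_add_sq (s * Y x)
    have h2 : Y x ^ 2 / 8 ≤ Real.exp (|Y x| / 2) := by
      have := Real.quadratic_le_exp_of_nonneg (show 0 ≤ |Y x| / 2 by positivity)
      have h3 : (|Y x| / 2) ^ 2 = Y x ^ 2 / 4 := by rw [div_pow, sq_abs]; norm_num
      rw [h3] at this
      linarith
    have h3 : Real.exp |s * Y x| ≤ Real.exp (|Y x| / 2) := by
      rw [Real.exp_le_exp, abs_mul, abs_of_nonneg hs]
      nlinarith
    have h4 : Real.exp (|Y x| / 2) * Real.exp (|Y x| / 2) ≤ Real.exp (W x) := by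
      rw [← Real.exp_add, Real.exp_le_exp, add_halves]
      exact hYW x
    have h5 : Y x ^ 2 / 8 * Real.exp |s * Y x| ≤ Real.exp (W x) :=
      (mul_le_mul h2 h3 (Real.exp_pos _).le (Real.exp_pos _).le).trans h4
    have h6 := mul_le_mul_of_nonneg_left h5 (by positivity : 0 ≤ 4 * s ^ 2)
    have h7 : (s * Y x) ^ 2 / 2 * Real.exp |s * Y x| =
      4 * s ^ 2 * (Y x ^ 2 / 8 * Real.exp |s * Y x|) := by ring
    linarith
  calc ∫ x, Real.exp (s * Y x) ∂P ≤ ∫ x, (1 + s * Y x + 4 * s ^ 2 * Real.exp (W x)) ∂P :=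
        integral_mono hI (((integrable_const _).add (hY.const_mul s)).add (hW.const_mul _)) hb
    _ = 1 + 4 * s ^ 2 * ∫ x, Real.exp (W x) ∂P := by
        rw [integral_add (f := fun x => _ + _) ((integrable_const _).add (hY.const_mul s))
          (hW.const_mul _), integral_add (integrable_const _) (hY.const_mul s), integral_const_mul,
          integral_const_mul, hY0]
        simp
    _ ≤ 1 + 4 * s ^ 2 * A := by gcongr
    _ ≤ Real.exp (4 * A * s ^ 2) := by
        linarith [Real.add_one_le_exp (4 * A * s ^ 2)]

theorem measureReal_sum_ge_le {Y W : Ω → ℝ} {A θ : ℝ} (hY : Integrable Y P)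
    (hY0 : ∫ x, Y x ∂P = 0) (hYW : ∀ x, |Y x| ≤ W x)
    (hW : Integrable (fun x => Real.exp (W x)) P) (hA : ∫ x, Real.exp (W x) ∂P ≤ A) (hA1 : 1 ≤ A)
    (hθ : 0 < θ) (hθ1 : θ ≤ 1) (n : ℕ) :
    (Measure.pi fun _ : Fin n => P).real {X | n * θ ≤ ∑ i, Y (X i)} ≤
      Real.exp (-(n * (θ ^ 2 / (16 * A)))) := by
  -- This minimizes 4As² - sθ, with value -θ²/(16A).
  set s := θ / (8 * A) with hs
  have hs0 : 0 < s := by positivity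
  have hs1 : s ≤ 1 / 2 := by
    rw [hs, div_le_iff₀ (by positivity)]; nlinarith
  obtain ⟨hI, hle⟩ := integral_exp_mul_le hY hY0 hYW hW hA hs0.le hs1
  have e : ∀ x, Real.exp (s * Y x - s * θ) = Real.exp (s * Y x) * Real.exp (-(s * θ)) := fun x => by
    rw [← Real.exp_add, sub_eq_add_neg]
  have h1 := measureReal_sum_nonneg_le (P := P) (f := fun x => s * Y x - s * θ)
    (a := θ ^ 2 / (16 * A)) (by simp_rw [e]; exact hI.mul_const _) (by
      simp_rw [e]
      rw [integral_mul_const]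
      refine (mul_le_mul_of_nonneg_right hle (Real.exp_pos _).le).trans_eq ?_
      rw [← Real.exp_add]
      congr 1
      rw [hs]; field_simp; ring) n
  refine le_trans (le_of_eq ?_) h1
  congr 1
  ext X
  simp only [Set.mem_ofPred_eq, Finset.sum_sub_distrib, ← Finset.mul_sum, Finset.sum_const,
    Finset.card_univ, Fintype.card_fin, nsmul_eq_mul]
  rw [sub_nonneg]
  exact (mul_le_mul_iff_right₀ hs0).symm

end Chernoff

/-! ### Nets in finite dimension -/

section Net

variable (F : Type*) [NormedAddCommGroup F] [NormedSpace ℝ F] [FiniteDimensional ℝ F]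

/-- Covering numbers of balls in finite dimension, by iterating a cover by half-balls. -/
theorem exists_net : ∃ N : ℕ, 1 ≤ N ∧ ∀ k : ℕ, ∃ T : Finset F, T.card ≤ N ^ k ∧
    ∀ w : F, ‖w‖ ≤ 1 → ∃ u ∈ T, ‖w - u‖ ≤ (2⁻¹ : ℝ) ^ k := by
  classical
  have : ProperSpace F := FiniteDimensional.proper ℝ F
  obtain ⟨t, -, htf, htc⟩ := (isCompact_closedBall (0 : F) 1).finite_cover_balls
    (show (0 : ℝ) < 2⁻¹ by norm_num)
  set S := htf.toFinset with hS
  have hcov : ∀ w : F, ‖w‖ ≤ 1 → ∃ u ∈ S, ‖w - u‖ ≤ 2⁻¹ := fun w hw => by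
    obtain ⟨u, hu, hwu⟩ := Set.mem_iUnion₂.1 (htc (mem_closedBall_zero_iff.2 hw))
    exact ⟨u, htf.mem_toFinset.2 hu, by rw [← dist_eq_norm]; exact (Metric.mem_ball.1 hwu).le⟩
  refine ⟨max S.card 1, le_max_right _ _, fun k => ?_⟩
  induction k with
  | zero => exact ⟨{0}, by simp, fun w hw => ⟨0, by simp, by simpa using hw⟩⟩
  | succ k ih =>
    obtain ⟨T, hT, hTc⟩ := ih
    refine ⟨(T ×ˢ S).image fun q => q.1 + (2⁻¹ : ℝ) ^ k • q.2, ?_, fun w hw => ?_⟩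
    · refine Finset.card_image_le.trans ?_
      rw [Finset.card_product, pow_succ]
      exact Nat.mul_le_mul hT (le_max_left _ _)
    · obtain ⟨u, hu, hwu⟩ := hTc w hw
      have hk : (0 : ℝ) < 2⁻¹ ^ k := by positivity
      obtain ⟨v, hv, hv2⟩ := hcov (((2⁻¹ : ℝ) ^ k)⁻¹ • (w - u)) (by
        rw [norm_smul, norm_inv, Real.norm_of_nonneg hk.le, inv_mul_le_iff₀ hk, mul_one]
        exact hwu)
      refine ⟨_, Finset.mem_image_of_mem _ (Finset.mk_mem_product hu hv), ?_⟩
      have e : w - (u + (2⁻¹ : ℝ) ^ k • v) =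
          (2⁻¹ : ℝ) ^ k • (((2⁻¹ : ℝ) ^ k)⁻¹ • (w - u) - v) := by
        rw [smul_sub, smul_smul, mul_inv_cancel₀ hk.ne', one_smul]; abel
      simp only
      rw [e, norm_smul, Real.norm_of_nonneg hk.le, pow_succ]
      exact mul_le_mul_of_nonneg_left hv2 hk.le

end Net

/-! ### Increments of the empirical loss: Lipschitz bounds and concentration for a pair -/

section Uniform

variable {d₁ d₂ : ℕ} {P : Measure (Euc d₁ × Euc d₂)} [IsProbabilityMeasure P]

theorem abs_expLoss_predict_sub_le (w u : Weights d₁ d₂) (x : Euc d₁ × Euc d₂) :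
    |expLoss (predict w x) - expLoss (predict u x)| ≤ ‖w - u‖ * ‖WithLp.toLp 2 x‖ := by
  refine (expLoss_sub_le _ _).trans ?_
  rw [← predict_sub]
  exact abs_predict_le _ _

theorem integrable_norm_of_sq (hP : Integrable (fun x => ‖WithLp.toLp 2 x‖ ^ 2) P) :
    Integrable (fun x : Euc d₁ × Euc d₂ => ‖WithLp.toLp 2 x‖) P := by
  refine ((integrable_const (1 : ℝ)).add hP).mono' continuous_norm_toLp.aestronglyMeasurable
    (ae_of_all _ fun x => ?_)
  rw [norm_norm, Pi.add_apply]
  nlinarith [sq_nonneg (‖WithLp.toLp 2 x‖ - 1)]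

theorem abs_popLoss_sub_le (hP : Integrable (fun x => ‖WithLp.toLp 2 x‖ ^ 2) P) {M : ℝ}
    (hM : ∫ x, ‖WithLp.toLp 2 x‖ ^ 2 ∂P ≤ M) (w u : Weights d₁ d₂) :
    |popLoss P w - popLoss P u| ≤ (1 + M) * ‖w - u‖ := by
  unfold popLoss
  rw [← integral_sub (integrable_expLoss_predict w) (integrable_expLoss_predict u)]
  refine (abs_integral_le_integral_abs).trans ?_
  calc _ ≤ ∫ x, ‖w - u‖ * (1 + ‖WithLp.toLp 2 x‖ ^ 2) ∂P := by
        refine integral_mono ((integrable_expLoss_predict w).sub (integrable_expLoss_predict u)).abs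
          (((integrable_const _).add hP).const_mul _) fun x => ?_
        refine (abs_expLoss_predict_sub_le w u x).trans ?_
        refine mul_le_mul_of_nonneg_left ?_ (norm_nonneg _)
        nlinarith [sq_nonneg (‖WithLp.toLp 2 x‖ - 1)]
    _ = ‖w - u‖ * (1 + ∫ x, ‖WithLp.toLp 2 x‖ ^ 2 ∂P) := by
        rw [integral_const_mul, integral_add (integrable_const _) hP]; simp
    _ ≤ ‖w - u‖ * (1 + M) := by gcongr
    _ = _ := mul_comm _ _

theorem abs_empLoss_sub_le {n : ℕ} (X : Fin n → Euc d₁ × Euc d₂) {M : ℝ}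
    (hM : (n : ℝ)⁻¹ * ∑ i, ‖WithLp.toLp 2 (X i)‖ ^ 2 ≤ M) (w u : Weights d₁ d₂) :
    |empLoss X w - empLoss X u| ≤ (1 + M) * ‖w - u‖ := by
  have hn : (0 : ℝ) ≤ (n : ℝ)⁻¹ := by positivity
  unfold empLoss
  rw [← mul_sub, ← Finset.sum_sub_distrib, abs_mul, abs_of_nonneg hn]
  have h1 : ∀ i, |expLoss (predict w (X i)) - expLoss (predict u (X i))| ≤
      ‖w - u‖ * (1 + ‖WithLp.toLp 2 (X i)‖ ^ 2) := fun i => by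
    refine (abs_expLoss_predict_sub_le w u _).trans ?_
    refine mul_le_mul_of_nonneg_left ?_ (norm_nonneg _)
    nlinarith [sq_nonneg (‖WithLp.toLp 2 (X i)‖ - 1)]
  have h2 := mul_le_mul_of_nonneg_left ((Finset.abs_sum_le_sum_abs _ _).trans
    (Finset.sum_le_sum fun i (_ : i ∈ Finset.univ) => h1 i)) hn
  refine h2.trans ?_
  rw [← Finset.mul_sum, Finset.sum_add_distrib, mul_left_comm, mul_add]
  have h3 : (n : ℝ)⁻¹ * ∑ _i : Fin n, (1 : ℝ) ≤ 1 := by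
    simp only [Finset.sum_const, Finset.card_univ, Fintype.card_fin, nsmul_eq_mul, mul_one]
    exact inv_mul_le_one
  rw [mul_comm (1 + M)]
  exact mul_le_mul_of_nonneg_left (by linarith) (norm_nonneg _)

/-- Concentration of the difference of the losses of two classifiers. -/
theorem measureReal_pair_le {A θ ρ : ℝ} (hP : Integrable (fun x => ‖WithLp.toLp 2 x‖ ^ 2) P)
    (hW : Integrable (fun x => Real.exp (‖WithLp.toLp 2 x‖ + ∫ y, ‖WithLp.toLp 2 y‖ ∂P)) P)
    (hA : ∫ x, Real.exp (‖WithLp.toLp 2 x‖ + ∫ y, ‖WithLp.toLp 2 y‖ ∂P) ∂P ≤ A) (hA1 : 1 ≤ A)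
    (hθ : 0 < θ) (hθ1 : θ ≤ 1) {n : ℕ} (hn : 0 < n) {w u : Weights d₁ d₂} (hρ : 0 < ρ)
    (hwu : ‖w - u‖ ≤ ρ) :
    (Measure.pi fun _ : Fin n => P).real
      {X | θ * ρ ≤ (empLoss X w - popLoss P w) - (empLoss X u - popLoss P u)} ≤
      Real.exp (-(n * (θ ^ 2 / (16 * A)))) := by
  set E := popLoss P w - popLoss P u with hE
  have hN := integrable_norm_of_sq hP
  have hD : Integrable (fun x => expLoss (predict w x) - expLoss (predict u x)) P :=
    (integrable_expLoss_predict w).sub (integrable_expLoss_predict u)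
  have hDE : ∫ x, (expLoss (predict w x) - expLoss (predict u x)) ∂P = E :=
    integral_sub (integrable_expLoss_predict w) (integrable_expLoss_predict u)
  have hDb : ∀ x, |expLoss (predict w x) - expLoss (predict u x)| ≤ ρ * ‖WithLp.toLp 2 x‖ := fun x =>
    (abs_expLoss_predict_sub_le w u x).trans (by gcongr)
  have hEb : |E| ≤ ρ * ∫ y, ‖WithLp.toLp 2 y‖ ∂P := by
    rw [← hDE, ← integral_const_mul]
    exact abs_integral_le_integral_abs.trans (integral_mono hD.abs (hN.const_mul _) hDb)
  -- Division by ρ makes the centred increment bounded by ‖x‖ + E‖x‖, an envelope independent of the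
  -- pair.
  have h := measureReal_sum_ge_le (P := P)
    (Y := fun x => ρ⁻¹ * ((expLoss (predict w x) - expLoss (predict u x)) - E))
    (W := fun x => ‖WithLp.toLp 2 x‖ + ∫ y, ‖WithLp.toLp 2 y‖ ∂P)
    ((hD.sub (integrable_const E)).const_mul _)
    (by rw [integral_const_mul, integral_sub hD (integrable_const E), hDE]; simp)
    (fun x => by
      rw [abs_mul, abs_of_pos (inv_pos.2 hρ), inv_mul_le_iff₀ hρ]
      refine (abs_sub _ _).trans ?_
      linarith [hDb x])
    hW hA hA1 hθ hθ1 n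
  refine le_trans (le_of_eq ?_) h
  congr 1
  ext X
  have hn' : (0 : ℝ) < n := by exact_mod_cast hn
  simp only [Set.mem_ofPred_eq]
  have e : ∑ i, ρ⁻¹ * ((expLoss (predict w (X i)) - expLoss (predict u (X i))) - E) =
      n * (ρ⁻¹ * ((empLoss X w - popLoss P w) - (empLoss X u - popLoss P u))) := by
    rw [← Finset.mul_sum, Finset.sum_sub_distrib, Finset.sum_sub_distrib]
    unfold empLoss
    simp only [Finset.sum_const, Finset.card_univ, Fintype.card_fin, nsmul_eq_mul, hE]
    field_simp
    ring
  rw [e, mul_le_mul_iff_right₀ hn', ← div_eq_inv_mul, le_div_iff₀ hρ]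

end Uniform

end

/-! ### Uniform deviation of increments -/

section

/-- Both points are replaced by net points, at a Lipschitz cost of θ²/2 each. The maximum with θ
gives nearby net points the tolerance θ², which the additive term of the conclusion absorbs. -/
theorem abs_sub_le_of_net {F : Type*} [NormedAddCommGroup F] {Δ : F → ℝ} {c r θ : ℝ}
    {T : Finset F} (hT : ∀ w, ‖w‖ ≤ 2 → ∃ u ∈ T, ‖w - u‖ ≤ r)
    (hLip : ∀ w u, |Δ w - Δ u| ≤ c * ‖w - u‖) (hc : 0 ≤ c) (hθ : 0 ≤ θ)
    (hpair : ∀ u ∈ T, ∀ v ∈ T, Δ u - Δ v ≤ θ * max ‖u - v‖ θ) (hr1 : c * r ≤ θ ^ 2 / 2)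
    (hr2 : r ≤ θ / 4) {w w' : F} (hw : ‖w‖ ≤ 2) (hw' : ‖w'‖ ≤ 2) :
    |Δ w - Δ w'| ≤ 2 * θ * (‖w - w'‖ + 2 * θ) := by
  have key : ∀ w w', ‖w‖ ≤ 2 → ‖w'‖ ≤ 2 → Δ w - Δ w' ≤ 2 * θ * (‖w - w'‖ + 2 * θ) := by
    intro w w' hw hw'
    obtain ⟨u, hu, hwu⟩ := hT w hw
    obtain ⟨v, hv, hwv⟩ := hT w' hw'
    have h1 : Δ w - Δ u ≤ θ ^ 2 / 2 :=
      (le_abs_self _).trans ((hLip w u).trans ((mul_le_mul_of_nonneg_left hwu hc).trans hr1))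
    have h2 : Δ v - Δ w' ≤ θ ^ 2 / 2 := by
      rw [← norm_neg, neg_sub] at hwv
      exact (le_abs_self _).trans
        ((hLip v w').trans ((mul_le_mul_of_nonneg_left hwv hc).trans hr1))
    have h3 : ‖u - v‖ ≤ ‖w - w'‖ + 2 * r := by
      have e : u - v = (w - w') - (w - u) + (w' - v) := by abel
      rw [e]
      linarith [norm_add_le ((w - w') - (w - u)) (w' - v), norm_sub_le (w - w') (w - u)]
    have h4 : max ‖u - v‖ θ ≤ ‖w - w'‖ + θ / 2 + θ :=
      max_le (by linarith) (by linarith [norm_nonneg (w - w')])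
    have h5 := (hpair u hu v hv).trans (mul_le_mul_of_nonneg_left h4 hθ)
    nlinarith [mul_nonneg hθ (norm_nonneg (w - w'))]
  rw [abs_le]
  have h := key w' w hw' hw
  rw [← norm_neg, neg_sub] at h
  exact ⟨by linarith, key w w' hw hw'⟩

variable {d₁ d₂ : ℕ} {P : Measure (Euc d₁ × Euc d₂)}

theorem integrable_sq_of_exp_sq {lam : ℝ} (hlam : 0 < lam)
    (hexp : Integrable (fun x => Real.exp (lam * ‖WithLp.toLp 2 x‖ ^ 2)) P) :
    Integrable (fun x : Euc d₁ × Euc d₂ => ‖WithLp.toLp 2 x‖ ^ 2) P := by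
  refine (hexp.const_mul lam⁻¹).mono' (continuous_norm_toLp.pow 2).aestronglyMeasurable
    (ae_of_all _ fun x => ?_)
  rw [Real.norm_of_nonneg (sq_nonneg _), ← div_eq_inv_mul, le_div_iff₀ hlam]
  linarith [Real.add_one_le_exp (lam * ‖WithLp.toLp 2 x‖ ^ 2)]

theorem integrable_exp_norm_of_exp_sq {lam : ℝ} (hlam : 0 < lam)
    (hexp : Integrable (fun x => Real.exp (lam * ‖WithLp.toLp 2 x‖ ^ 2)) P) (c : ℝ) :
    Integrable (fun x : Euc d₁ × Euc d₂ => Real.exp (‖WithLp.toLp 2 x‖ + c)) P := by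
  refine (hexp.const_mul (Real.exp (1 / (4 * lam) + c))).mono'
    (Real.continuous_exp.comp (continuous_norm_toLp.add_const c)).aestronglyMeasurable
    (ae_of_all _ fun x => ?_)
  rw [Real.norm_eq_abs, Real.abs_exp, ← Real.exp_add, Real.exp_le_exp]
  have h1 : 0 ≤ lam * (‖WithLp.toLp 2 x‖ - 1 / (2 * lam)) ^ 2 := by positivity
  have h2 : lam * (‖WithLp.toLp 2 x‖ - 1 / (2 * lam)) ^ 2 =
      lam * ‖WithLp.toLp 2 x‖ ^ 2 - ‖WithLp.toLp 2 x‖ + 1 / (4 * lam) := by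
    field_simp; ring
  linarith

variable [IsProbabilityMeasure P]

/-- The empirical second moment is bounded with exponentially large probability. -/
theorem exists_second_moment_bound {lam : ℝ} (hlam : 0 < lam)
    (hexp : Integrable (fun x => Real.exp (lam * ‖WithLp.toLp 2 x‖ ^ 2)) P) :
    ∃ M : ℝ, 0 ≤ M ∧ ∫ x, ‖WithLp.toLp 2 x‖ ^ 2 ∂P ≤ M ∧ ∀ n : ℕ, 0 < n →
      (Measure.pi fun _ : Fin n => P).real {X | M ≤ (n : ℝ)⁻¹ * ∑ i, ‖WithLp.toLp 2 (X i)‖ ^ 2} ≤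
        Real.exp (-n) := by
  set I := ∫ x, Real.exp (lam * ‖WithLp.toLp 2 x‖ ^ 2) ∂P with hI
  have hsq := integrable_sq_of_exp_sq hlam hexp
  have hI1 : 1 + lam * ∫ x, ‖WithLp.toLp 2 x‖ ^ 2 ∂P ≤ I := by
    have h1 : ∫ x, (1 + lam * ‖WithLp.toLp 2 x‖ ^ 2) ∂P =
        1 + lam * ∫ x, ‖WithLp.toLp 2 x‖ ^ 2 ∂P := by
      rw [integral_add (integrable_const _) (hsq.const_mul _), integral_const_mul]; simp
    rw [← h1]
    refine integral_mono ((integrable_const _).add (hsq.const_mul _)) hexp fun x => ?_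
    simp only
    linarith [Real.add_one_le_exp (lam * ‖WithLp.toLp 2 x‖ ^ 2)]
  have hm0 : 0 ≤ ∫ x, ‖WithLp.toLp 2 x‖ ^ 2 ∂P := integral_nonneg fun x => sq_nonneg _
  have hIpos : 1 ≤ I := by nlinarith
  have hmI : ∫ x, ‖WithLp.toLp 2 x‖ ^ 2 ∂P ≤ I / lam := by
    rw [le_div_iff₀ hlam]; linarith
  -- With this threshold the exponential moment of λ‖x‖² - I is I exp(-I) ≤ exp(-1).
  refine ⟨I / lam, by positivity, hmI, fun n hn => ?_⟩
  have hlog : 1 ≤ I - Real.log I := by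
    have := Real.log_le_sub_one_of_pos (show 0 < I by linarith)
    linarith
  have e : ∀ x : Euc d₁ × Euc d₂, Real.exp (lam * ‖WithLp.toLp 2 x‖ ^ 2 - I) =
      Real.exp (lam * ‖WithLp.toLp 2 x‖ ^ 2) * Real.exp (-I) := fun x => by
    rw [← Real.exp_add, sub_eq_add_neg]
  have h := measureReal_sum_nonneg_le (P := P) (a := 1)
    (f := fun x => lam * ‖WithLp.toLp 2 x‖ ^ 2 - I)
    (by simp_rw [e]; exact hexp.mul_const _) (by
      simp_rw [e]
      rw [integral_mul_const, ← hI]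
      nth_rewrite 1 [← Real.exp_log (show 0 < I by linarith)]
      rw [← Real.exp_add, Real.exp_le_exp]
      linarith) n
  rw [mul_one] at h
  refine le_trans (le_of_eq ?_) h
  congr 1
  ext X
  have hn' : (0 : ℝ) < n := by exact_mod_cast hn
  simp only [Set.mem_ofPred_eq, Finset.sum_sub_distrib, ← Finset.mul_sum, Finset.sum_const,
    Finset.card_univ, Fintype.card_fin, nsmul_eq_mul]
  rw [sub_nonneg, ← div_eq_inv_mul, le_div_iff₀ hn', div_mul_eq_mul_div, div_le_iff₀ hlam,
    mul_comm I, mul_comm lam]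

/-- Uniform concentration of the increments of the empirical loss, with a sample size free of
logarithms of the accuracy. -/
theorem exists_uniform_deviation {lam : ℝ} (hlam : 0 < lam)
    (hexp : Integrable (fun x => Real.exp (lam * ‖WithLp.toLp 2 x‖ ^ 2)) P) :
    ∃ M C : ℝ, 0 ≤ M ∧ 0 < C ∧ ∫ x, ‖WithLp.toLp 2 x‖ ^ 2 ∂P ≤ M ∧
      ∀ θ δ : ℝ, 0 < θ → θ ≤ 1 → 0 < δ → δ ≤ 1 / 2 → ∀ n : ℕ,
        C * (1 / θ ^ 4) * Real.log (1 / δ) ≤ n →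
        1 - δ ≤ (Measure.pi fun _ : Fin n => P).real
          {X | (n : ℝ)⁻¹ * ∑ i, ‖WithLp.toLp 2 (X i)‖ ^ 2 ≤ M ∧
            ∀ w w' : Weights d₁ d₂, ‖w‖ ≤ 2 → ‖w'‖ ≤ 2 →
              |(empLoss X w - popLoss P w) - (empLoss X w' - popLoss P w')| ≤
                2 * θ * (‖w - w'‖ + 2 * θ)} := by
  classical
  obtain ⟨M, hM0, hM, hMn⟩ := exists_second_moment_bound hlam hexp
  obtain ⟨N, hN1, hN⟩ := exists_net (Weights d₁ d₂)
  have hsq := integrable_sq_of_exp_sq hlam hexp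
  have hW := integrable_exp_norm_of_exp_sq hlam hexp (∫ y, ‖WithLp.toLp 2 y‖ ∂P)
  set A := max 1 (∫ x, Real.exp (‖WithLp.toLp 2 x‖ + ∫ y, ‖WithLp.toLp 2 y‖ ∂P) ∂P) with hAdef
  have hA1 : 1 ≤ A := le_max_left _ _
  set ℓ := Real.log N with hℓ
  have hℓ0 : 0 ≤ ℓ := Real.log_nonneg (by exact_mod_cast hN1)
  set k₀ := 16 * (1 + M) + 1 with hk₀
  have hk₀1 : 1 ≤ k₀ := by linarith
  refine ⟨M, 16 * A * (4 * ℓ * k₀ + 2), hM0, by positivity, hM, ?_⟩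
  intro θ δ hθ hθ1 hδ hδ1 n hn
  set Λ := Real.log (1 / δ) with hΛ
  have hδe : δ = Real.exp (-Λ) := by
    rw [hΛ, one_div, Real.log_inv, neg_neg, Real.exp_log hδ]
  have hΛ2 : Real.log 2 ≤ Λ := by
    rw [hΛ]; refine Real.log_le_log (by norm_num) ?_
    rw [le_div_iff₀ hδ]; linarith
  have hlog2 : 1 / 2 ≤ Real.log 2 := by linarith [Real.log_two_gt_d9]
  have hθ2 : 0 < θ ^ 2 := by positivity
  have hθ21 : θ ^ 2 ≤ 1 := pow_le_one₀ hθ.le hθ1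
  have hinv : 1 ≤ 1 / θ ^ 2 := by rw [le_div_iff₀ hθ2]; linarith
  have hinv4 : 1 / θ ^ 4 = 1 / θ ^ 2 * (1 / θ ^ 2) := by field_simp
  set z := 1 / θ ^ 2 with hz
  have hΛ0 : 0 < Λ := by linarith
  have hz0 : 0 < z := by linarith
  -- the scale of the net
  set k := ⌈16 * (1 + M) * z⌉₊ with hk
  have hk1 : 16 * (1 + M) * z ≤ k := Nat.le_ceil _
  have hk2 : (k : ℝ) ≤ k₀ * z := by
    have := (Nat.ceil_lt_add_one (show 0 ≤ 16 * (1 + M) * z by positivity)).le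
    rw [hk₀]; linarith
  have hkpos : (0 : ℝ) < k := lt_of_lt_of_le (by positivity) hk1
  have hpow : (2⁻¹ : ℝ) ^ k ≤ θ ^ 2 / (16 * (1 + M)) := by
    have h1 : (k : ℝ) ≤ 2 ^ k := by exact_mod_cast (Nat.lt_two_pow_self (n := k)).le
    calc (2⁻¹ : ℝ) ^ k = 1 / 2 ^ k := by rw [inv_pow, one_div]
      _ ≤ 1 / (16 * (1 + M) * z) := one_div_le_one_div_of_le (by positivity) (hk1.trans h1)
      _ = _ := by rw [hz]; field_simp
  obtain ⟨T₀, hT₀card, hT₀⟩ := hN k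
  set T := T₀.image fun u => (2 : ℝ) • u with hTdef
  have hTcard : (T.card : ℝ) ≤ Real.exp (k * ℓ) := by
    have : T.card ≤ N ^ k := Finset.card_image_le.trans hT₀card
    calc (T.card : ℝ) ≤ (N : ℝ) ^ k := by exact_mod_cast this
      _ = Real.exp (k * ℓ) := by
        rw [Real.exp_nat_mul, hℓ, Real.exp_log (by exact_mod_cast hN1)]
  have hT : ∀ w : Weights d₁ d₂, ‖w‖ ≤ 2 → ∃ u ∈ T, ‖w - u‖ ≤ θ ^ 2 / (8 * (1 + M)) := by
    intro w hw
    obtain ⟨u, hu, hwu⟩ := hT₀ ((2 : ℝ)⁻¹ • w) (by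
      rw [norm_smul, norm_inv, Real.norm_two]; linarith)
    refine ⟨(2 : ℝ) • u, Finset.mem_image_of_mem _ hu, ?_⟩
    have e : w - (2 : ℝ) • u = (2 : ℝ) • ((2 : ℝ)⁻¹ • w - u) := by
      rw [smul_sub, smul_smul, mul_inv_cancel₀ two_ne_zero, one_smul]
    rw [e, norm_smul, Real.norm_two]
    calc 2 * ‖(2 : ℝ)⁻¹ • w - u‖ ≤ 2 * (θ ^ 2 / (16 * (1 + M))) := by linarith
      _ = _ := by field_simp; norm_num
  -- the sample size
  have hn1 : 16 * A * ((4 * ℓ * k₀ + 2) * z * Λ) ≤ n * θ ^ 2 := by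
    have h1 := mul_le_mul_of_nonneg_right hn hθ2.le
    refine le_trans (le_of_eq ?_) h1
    rw [hinv4]
    have : z * θ ^ 2 = 1 := by rw [hz]; field_simp
    calc _ = 16 * A * (4 * ℓ * k₀ + 2) * z * Λ * 1 := by ring
      _ = _ := by rw [← this]; ring
  have hn2 : 2 * k * ℓ + 2 * Λ ≤ n * (θ ^ 2 / (16 * A)) := by
    rw [← mul_div_assoc, le_div_iff₀ (by positivity)]
    refine le_trans ?_ hn1
    rw [mul_comm]
    refine mul_le_mul_of_nonneg_left ?_ (by positivity)
    have h1 : 2 * k * ℓ ≤ 4 * ℓ * k₀ * z * Λ := by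
      calc 2 * k * ℓ ≤ 2 * (k₀ * z) * ℓ := by gcongr
        _ = 4 * ℓ * k₀ * z * (1 / 2) := by ring
        _ ≤ 4 * ℓ * k₀ * z * Λ := by gcongr; linarith
    have h2 : 2 * Λ ≤ 2 * z * Λ := by nlinarith
    linarith
  have hn3 : 2 * Λ ≤ n := by
    have h1 : n * (θ ^ 2 / (16 * A)) ≤ n * 1 := by
      gcongr
      rw [div_le_one (by positivity)]; linarith
    have h2 : 0 ≤ 2 * k * ℓ := by positivity
    linarith
  have hnpos : 0 < n := by
    have : (0 : ℝ) < n := by linarith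
    exact_mod_cast this
  set π := Measure.pi fun _ : Fin n => P with hπ
  set bad₁ : Set (Fin n → Euc d₁ × Euc d₂) :=
    {X | M ≤ (n : ℝ)⁻¹ * ∑ i, ‖WithLp.toLp 2 (X i)‖ ^ 2} with hbad₁
  set bad₂ : Weights d₁ d₂ × Weights d₁ d₂ → Set (Fin n → Euc d₁ × Euc d₂) := fun q =>
    {X | θ * max ‖q.1 - q.2‖ θ ≤
      (empLoss X q.1 - popLoss P q.1) - (empLoss X q.2 - popLoss P q.2)} with hbad₂
  have hp1 : π.real bad₁ ≤ δ / 2 := by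
    refine (hMn n hnpos).trans ?_
    rw [hδe]
    calc Real.exp (-n) ≤ Real.exp (-Λ - Real.log 2) := by rw [Real.exp_le_exp]; linarith
      _ = _ := by rw [Real.exp_sub, Real.exp_log two_pos]
  have hp2 : π.real (⋃ q ∈ T ×ˢ T, bad₂ q) ≤ δ / 2 := by
    refine (measureReal_biUnion_finset_le _ _).trans ?_
    have h1 : ∀ q ∈ T ×ˢ T, π.real (bad₂ q) ≤ Real.exp (-(n * (θ ^ 2 / (16 * A)))) := fun q _ =>
      measureReal_pair_le hsq hW (le_max_right _ _) hA1 hθ hθ1 hnpos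
        (lt_of_lt_of_le hθ (le_max_right _ _)) (le_max_left _ _)
    refine (Finset.sum_le_sum h1).trans ?_
    rw [Finset.sum_const, nsmul_eq_mul, Finset.card_product, Nat.cast_mul]
    calc (T.card : ℝ) * T.card * Real.exp (-(n * (θ ^ 2 / (16 * A)))) ≤
        Real.exp (k * ℓ) * Real.exp (k * ℓ) * Real.exp (-(n * (θ ^ 2 / (16 * A)))) :=
          mul_le_mul_of_nonneg_right (mul_le_mul hTcard hTcard (Nat.cast_nonneg _)
            (Real.exp_pos _).le) (Real.exp_pos _).le
      _ = Real.exp (2 * k * ℓ - n * (θ ^ 2 / (16 * A))) := by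
          rw [← Real.exp_add, ← Real.exp_add]; ring_nf
      _ ≤ Real.exp (-Λ - Real.log 2) := by rw [Real.exp_le_exp]; linarith
      _ = δ / 2 := by rw [Real.exp_sub, Real.exp_log two_pos, ← hδe]
  set good : Set (Fin n → Euc d₁ × Euc d₂) := {X | (n : ℝ)⁻¹ * ∑ i, ‖WithLp.toLp 2 (X i)‖ ^ 2 ≤ M ∧
    ∀ w w' : Weights d₁ d₂, ‖w‖ ≤ 2 → ‖w'‖ ≤ 2 →
      |(empLoss X w - popLoss P w) - (empLoss X w' - popLoss P w')| ≤
        2 * θ * (‖w - w'‖ + 2 * θ)} with hgood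
  -- A cover and subadditivity bound the outer measure of the good event from below, without
  -- measurability.
  have hcover : Set.univ ⊆ good ∪ (bad₁ ∪ ⋃ q ∈ T ×ˢ T, bad₂ q) := by
    intro X _
    by_contra hX
    simp only [Set.mem_union, not_or, Set.mem_iUnion, not_exists] at hX
    obtain ⟨hX1, hX2, hX3⟩ := hX
    have hm : (n : ℝ)⁻¹ * ∑ i, ‖WithLp.toLp 2 (X i)‖ ^ 2 ≤ M := (not_le.1 hX2).le
    refine hX1 ⟨hm, fun w w' hw hw' => ?_⟩
    refine abs_sub_le_of_net (Δ := fun w => empLoss X w - popLoss P w) (c := 2 * (1 + M)) hT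
      (fun w u => ?_) (by positivity) hθ.le (fun u hu v hv => ?_) ?_ ?_ hw hw'
    · have h1 := abs_empLoss_sub_le X hm w u
      have h2 := abs_popLoss_sub_le hsq hM w u
      calc |(empLoss X w - popLoss P w) - (empLoss X u - popLoss P u)| =
          |(empLoss X w - empLoss X u) - (popLoss P w - popLoss P u)| := by congr 1; ring
        _ ≤ _ := (abs_sub _ _).trans (by linarith)
    · exact (not_le.1 (hX3 (u, v) (Finset.mk_mem_product hu hv))).le
    · have h : 2 * (1 + M) * (θ ^ 2 / (8 * (1 + M))) = θ ^ 2 / 4 := by field_simp; norm_num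
      rw [h]
      linarith [sq_nonneg θ]
    · rw [div_le_iff₀ (by positivity)]
      nlinarith [mul_nonneg hθ.le hM0]
  have h1 : (1 : ℝ) ≤ π.real good + (π.real bad₁ + π.real (⋃ q ∈ T ×ˢ T, bad₂ q)) := by
    calc (1 : ℝ) = π.real Set.univ := probReal_univ.symm
      _ ≤ π.real (good ∪ (bad₁ ∪ ⋃ q ∈ T ×ˢ T, bad₂ q)) := measureReal_mono hcover
      _ ≤ _ := (measureReal_union_le _ _).trans (by gcongr; exact measureReal_union_le _ _)
  linarith

end

section

/-! ### Constants -/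

theorem eventually_mul_le_nhdsGT_zero (k : ℝ) {m : ℝ} (hm : 0 < m) :
    ∀ᶠ a in 𝓝[>] (0 : ℝ), a * k ≤ m := by
  have h : Tendsto (fun a : ℝ => a * k) (𝓝 0) (𝓝 (0 * k)) := tendsto_id.mul_const k
  rw [zero_mul] at h
  exact ((h.eventually (gt_mem_nhds hm)).filter_mono nhdsWithin_le_nhds).mono fun _ h => h.le

theorem exists_contraction_pow_le {r C ε : ℝ} (hr : 0 < r) (hr1 : r ≤ 1) (hC : 2 / r + 2 ≤ C)
    (hε : 0 < ε) (hε2 : ε ≤ 1 / 2) {T : ℕ} (hT : C * Real.log (1 / ε) ≤ T) :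
    ∃ t, T = t + 1 ∧ (1 - r) ^ t ≤ ε / 2 := by
  have hΛ : Real.log 2 ≤ Real.log (1 / ε) :=
    Real.log_le_log two_pos (by rw [le_div_iff₀ hε]; linarith)
  have hlog : (1 : ℝ) / 2 ≤ Real.log 2 := by linarith [Real.log_two_gt_d9]
  set Λ := Real.log (1 / ε) with hΛdef
  have h2 : 2 / r * Λ + 1 ≤ T := by
    have h3 : (2 / r + 2) * Λ ≤ C * Λ := mul_le_mul_of_nonneg_right hC (by linarith)
    linarith
  have hTpos : 0 < T := by
    have : 0 < 2 / r * Λ := by have : 0 < Λ := by linarith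
                               positivity
    have : (0 : ℝ) < T := by linarith
    exact_mod_cast this
  obtain ⟨t, rfl⟩ : ∃ t, T = t + 1 := ⟨T - 1, by omega⟩
  refine ⟨t, rfl, ?_⟩
  push_cast at h2
  have h3 : 2 * Λ ≤ r * t := by
    have h4 : 2 / r * Λ ≤ t := by linarith
    calc 2 * Λ = r * (2 / r * Λ) := by field_simp
      _ ≤ r * t := mul_le_mul_of_nonneg_left h4 hr.le
  calc (1 - r) ^ t ≤ Real.exp (-r) ^ t :=
        pow_le_pow_left₀ (by linarith) (by linarith [Real.add_one_le_exp (-r)]) t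
    _ = Real.exp (-(r * t)) := by rw [← Real.exp_nat_mul]; congr 1; ring
    _ ≤ Real.exp (-Λ - Real.log 2) := by rw [Real.exp_le_exp]; linarith
    _ = ε / 2 := by
        rw [Real.exp_sub, Real.exp_log two_pos, hΛdef, one_div, Real.log_inv, neg_neg,
          Real.exp_log hε]

/-! ### Smoothness away from the origin -/

/-- A function with locally Lipschitz gradient away from the origin has a uniform quadratic lower
bound on an annulus. -/
theorem exists_quadratic_lower_bound {F : Type*} [NormedAddCommGroup F] [InnerProductSpace ℝ F]
    [FiniteDimensional ℝ F] {L : F → ℝ} (hd : ∀ w, w ≠ 0 → DifferentiableAt ℝ L w)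
    (hl : LocallyLipschitzOn {0}ᶜ (gradient L)) :
    ∃ M, 0 ≤ M ∧ ∀ w u, 1 / 2 ≤ ‖w‖ → ‖w‖ ≤ 1 → ‖u‖ ≤ 1 / 4 →
      L w + ⟪gradient L w, u⟫ - M * ‖u‖ ^ 2 ≤ L (w + u) := by
  -- A compact annulus avoiding the origin that contains every segment from w to w + u.
  set A : Set F := {w | 1 / 4 ≤ ‖w‖ ∧ ‖w‖ ≤ 2} with hA
  have hne : ∀ w ∈ A, w ≠ 0 := fun w hw h => by
    have := hw.1
    rw [h, norm_zero] at this
    linarith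
  have hcpt : IsCompact A := by
    refine (isCompact_closedBall (0 : F) 2).of_isClosed_subset ?_ fun w hw => ?_
    · exact (isClosed_le continuous_const continuous_norm).inter
        (isClosed_le continuous_norm continuous_const)
    · simpa using hw.2
  obtain ⟨K, hK⟩ := (hl.mono fun w hw => hne w hw).exists_lipschitzOnWith_of_compact hcpt
  refine ⟨K, K.2, fun w u hw hw1 hu => ?_⟩
  have hmem : ∀ t ∈ Set.Icc (0 : ℝ) 1, w + t • u ∈ A := fun t ht => by
    have h1 : ‖t • u‖ ≤ 1 / 4 := by
      rw [norm_smul, Real.norm_of_nonneg ht.1]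
      calc t * ‖u‖ ≤ 1 * (1 / 4) := mul_le_mul ht.2 hu (norm_nonneg _) zero_le_one
        _ = _ := one_mul _
    have h2 := norm_sub_le_norm_add w (t • u)
    have h3 := norm_add_le w (t • u)
    exact ⟨by linarith, by linarith⟩
  have hder : ∀ t ∈ Set.Icc (0 : ℝ) 1,
      HasDerivAt (fun t => L (w + t • u)) ⟪gradient L (w + t • u), u⟫ t := fun t ht => by
    have h1 := (hd _ (hne _ (hmem t ht))).hasGradientAt.hasFDerivAt
    have h2 : HasDerivAt (fun t : ℝ => w + t • u) u t := by
      simpa using ((hasDerivAt_id t).smul_const u).const_add w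
    have h3 := h1.comp_hasDerivAt t h2
    exact h3.congr_deriv (InnerProductSpace.toDual_apply_apply ..)
  obtain ⟨t, ht, hslope⟩ := exists_hasDerivAt_eq_slope (fun t : ℝ => L (w + t • u))
    (fun t => ⟪gradient L (w + t • u), u⟫) zero_lt_one
    (fun t ht => (hder t ht).continuousAt.continuousWithinAt)
    (fun t ht => hder t (Set.Ioo_subset_Icc_self ht))
  simp only [one_smul, zero_smul, add_zero, sub_zero, div_one] at hslope
  have h0 : w ∈ A := by simpa using hmem 0 ⟨le_rfl, zero_le_one⟩
  have h1 := hK.norm_sub_le h0 (hmem t (Set.Ioo_subset_Icc_self ht))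
  have e1 : w - (w + t • u) = -(t • u) := by abel
  rw [e1, norm_neg, norm_smul, Real.norm_of_nonneg ht.1.le] at h1
  have h2 : ⟪gradient L w - gradient L (w + t • u), u⟫ ≤ K * ‖u‖ ^ 2 := by
    calc _ ≤ ‖gradient L w - gradient L (w + t • u)‖ * ‖u‖ := real_inner_le_norm _ _
      _ ≤ K * (t * ‖u‖) * ‖u‖ := mul_le_mul_of_nonneg_right h1 (norm_nonneg _)
      _ = K * ‖u‖ ^ 2 * t := by ring
      _ ≤ K * ‖u‖ ^ 2 * 1 := mul_le_mul_of_nonneg_left ht.2.le (by positivity)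
      _ = _ := mul_one _
  rw [inner_sub_left] at h2
  linarith

/-! ### The target distribution -/

variable {d₁ d₂ K : ℕ}

theorem exists_integrable_exp_sq_prod {D : Measure (Euc d₁)} {G : Measure (Euc d₂)}
    [IsProbabilityMeasure D] [IsGaussian G] {a : ℝ} (ha : 0 < a)
    (hD : Integrable (fun x => Real.exp (a * ‖x‖ ^ 2)) D) :
    ∃ lam, 0 < lam ∧ Integrable (fun x : Euc d₁ × Euc d₂ =>
      Real.exp (lam * ‖WithLp.toLp 2 x‖ ^ 2)) (D.prod G) := by
  obtain ⟨b, hb, hG⟩ := IsGaussian.exists_integrable_exp_sq G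
  refine ⟨min a b, lt_min ha hb, (hD.mul_prod hG).mono' ?_ (Eventually.of_forall fun x => ?_)⟩
  · exact (Real.continuous_exp.comp
      (continuous_const.mul (continuous_norm_toLp.pow 2))).aestronglyMeasurable
  · rw [Real.norm_of_nonneg (Real.exp_pos _).le, ← Real.exp_add, Real.exp_le_exp, norm_toLp_sq,
      mul_add]
    exact add_le_add (mul_le_mul_of_nonneg_right (min_le_left _ _) (sq_nonneg _))
      (mul_le_mul_of_nonneg_right (min_le_right _ _) (sq_nonneg _))

theorem integrable_exp_sq_mixture {α β : ℝ} {τ : Fin K → ℝ} {μ : Fin K → Measure (Euc d₁)}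
    (hα : 0 < α) (hd : 0 < d₁) (hprob : ∀ i, IsProbabilityMeasure (μ i))
    (hsl : ∀ i, SlicedLogConcaveSmooth α β (μ i)) :
    Integrable (fun x => Real.exp (α / (8 * d₁) * ‖x‖ ^ 2))
      (∑ i, ENNReal.ofReal (τ i) • μ i) := by
  rw [integrable_finsetSum_measure]
  intro i _
  have := hprob i
  exact ((hsl i).integrable_exp_sq hα hd).smul_measure ENNReal.ofReal_ne_top

/-- On the unit ball |wᵀx| ≤ ‖x‖, so E exp(-‖x‖) is a lower bound. It turns a shrink rate
proportional to the loss into a uniform one. -/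
theorem exists_popLoss_lower_bound (P : Measure (Euc d₁ × Euc d₂)) [IsProbabilityMeasure P] :
    ∃ l, 0 < l ∧ l ≤ 1 ∧ ∀ w : Weights d₁ d₂, ‖w‖ ≤ 1 → l ≤ popLoss P w := by
  have hint : Integrable (fun x : Euc d₁ × Euc d₂ => Real.exp (-‖WithLp.toLp 2 x‖)) P := by
    refine (integrable_const (1 : ℝ)).mono' ?_ (Eventually.of_forall fun x => ?_)
    · exact (Real.continuous_exp.comp continuous_norm_toLp.neg).aestronglyMeasurable
    · rw [Real.norm_of_nonneg (Real.exp_pos _).le, Real.exp_le_one_iff, neg_nonpos]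
      exact norm_nonneg _
  refine ⟨∫ x, Real.exp (-‖WithLp.toLp 2 x‖) ∂P, integral_exp_pos hint, ?_, fun w hw => ?_⟩
  · calc _ ≤ ∫ _, (1 : ℝ) ∂P := integral_mono hint (integrable_const _) fun x => by
          simp only [Real.exp_le_one_iff, neg_nonpos]
          exact norm_nonneg _
      _ = 1 := by simp
  · refine integral_mono hint (integrable_expLoss_predict w) fun x => ?_
    simp only [expLoss, Real.exp_le_exp, neg_le_neg_iff]
    exact (abs_predict_le w x).trans (mul_le_of_le_one_left (norm_nonneg _) hw)

/-- In the invariant region the population gradient shrinks the spurious part of the classifier. -/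
theorem exists_shrink_rate {α β l : ℝ} {τ : Fin K → ℝ} {μ : Fin K → Measure (Euc d₁)}
    {D : Measure (Euc d₁)} {G : Measure (Euc d₂)} {B : Euc d₂ →L[ℝ] Euc d₂}
    [IsProbabilityMeasure D] [IsProbabilityMeasure G]
    (hG : ∀ v, G.map (fun x => ⟪v, x⟫) = (gaussianReal 0 1).map (fun z => ‖B v‖ * z))
    (hB : ∀ u v, ⟪B u, v⟫ = ⟪u, B v⟫) (hα : 0 < α) (hτ : ∀ i, 0 ≤ τ i)
    (hprob : ∀ i, IsProbabilityMeasure (μ i)) (hsl : ∀ i, SlicedLogConcaveSmooth α β (μ i))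
    (hD : D = ∑ i, ENNReal.ofReal (τ i) • μ i)
    (hd : ∀ w, w ≠ 0 → DifferentiableAt ℝ (popLoss (D.prod G)) w) (hl1 : l ≤ 1)
    (hl : ∀ w : Weights d₁ d₂, ‖w‖ ≤ 1 → l ≤ popLoss (D.prod G) w) {w : Weights d₁ d₂}
    (hw : InRegion B (0.12 * min 1 (min (α / β ^ 2) β⁻¹)) w)
    (hloss : popLoss (D.prod G) w ≤ 2 * ((⨅ i, τ i) * kappa β α)) :
    ∃ r, l / 11 ≤ r ∧ r ≤ 1 ∧ (gradient (popLoss (D.prod G)) w).snd = r • B (B w.snd) := by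
  have hgrad := gradient_snd_popLoss hG hB (hd w hw.ne_zero)
  rcases eq_or_ne (B w.snd) 0 with h0 | h0
  -- The gradient part vanishes together with B w₂, so any rate in [l/11, 1] serves.
  · refine ⟨1, by linarith, le_rfl, ?_⟩
    rw [hgrad, h0, map_zero, smul_zero, smul_zero]
  · refine ⟨shrinkRate D B w, ?_, ?_, hgrad⟩
    · have h1 := hl w hw.norm_le
      rw [popLoss_prod hG] at hloss h1
      have h2 := loss_le_shrinkRate hα hτ hprob hsl hD hw.signal
        ((norm_fst_le w).trans hw.norm_le) h0 hw.variance hloss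
      linarith
    · refine shrinkRate_le.trans ?_
      rw [← popLoss_prod hG]
      calc popLoss (D.prod G) w ≤ ∫ _, (1 : ℝ) ∂(D.prod G) :=
            integral_mono (integrable_expLoss_predict w) (integrable_const _) fun x => expLoss_le_one _
        _ = 1 := by simp

end

/-! ### Step size, sample size and the two convergence statements -/

section

variable {d₁ d₂ : ℕ} {P : Measure (Euc d₁ × Euc d₂)}
  {B : Euc d₂ →L[ℝ] Euc d₂}

/-- Projected gradient descent on the empirical loss follows the population dynamics when the two
losses are uniformly close. -/
theorem norm_snd_iterate_empGrad_le {n : ℕ} {X : Fin n → Euc d₁ × Euc d₂}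
    {M M' V b c s₀ η θ l q : ℝ} {ws : Weights d₁ d₂} (hws : InRegion B V ws)
    (hX : (n : ℝ)⁻¹ * ∑ i, ‖WithLp.toLp 2 (X i)‖ ^ 2 ≤ M)
    (hdev : ∀ w w' : Weights d₁ d₂, ‖w‖ ≤ 2 → ‖w'‖ ≤ 2 →
      |(empLoss X w - popLoss P w) - (empLoss X w' - popLoss P w')| ≤ θ * (‖w - w'‖ + θ))
    (hlow : ∀ w u : Weights d₁ d₂, 1 / 2 ≤ ‖w‖ → ‖w‖ ≤ 1 → ‖u‖ ≤ 1 / 4 →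
      popLoss P w + ⟪gradient (popLoss P) w, u⟫ - M' * ‖u‖ ^ 2 ≤ popLoss P (w + u))
    (hgrad : ∀ w, InRegion B V w → popLoss P w ≤ 2 * q →
      ∃ r, c ≤ r ∧ r ≤ 1 ∧ (gradient (popLoss P) w).snd = r • B (B w.snd))
    (hl : ∀ w : Weights d₁ d₂, ‖w‖ ≤ 1 → l ≤ popLoss P w) (hwq : popLoss P ws ≤ q)
    (hθ : 0 < θ) (hθ4 : θ ≤ 1 / 4) (hθl : θ * 4 ≤ l)
    (hB : ∀ u v, ⟪B u, v⟫ = ⟪u, B v⟫) (hbB : ∀ v, b * ‖v‖ ≤ ‖B v‖) (hb : 0 < b) (hη : 0 < η)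
    (hηM : η * M ≤ 2) (hηB : η * ‖B‖ ^ 2 ≤ 1) (hc : 0 < c) (hηc : η * c * b ^ 2 ≤ 1)
    (hs₀ : 0 < s₀) (hs₀1 : 4 * s₀ ^ 2 ≤ 3 / 4) (hs₀V : ‖B‖ ^ 2 * (4 * s₀ ^ 2) ≤ V * (1 / 4))
    (hV : 0 ≤ V) (hN : 0 ≤ 2 + M / 2 + M') (hξ : (2 + M / 2 + M') * θ ≤ c * b ^ 2 / 2 * s₀)
    (hξB : ‖B‖ * ((2 + M / 2 + M') * θ) ≤ c * b ^ 2 / 2 * (b * s₀)) (t : ℕ) :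
    ‖(iterate (empGrad X) η ws (t + 1)).snd‖ ≤
      (1 - η * c * b ^ 2 / 2) ^ t + 2 * ((2 + M / 2 + M') * θ) / (c * b ^ 2) := by
  have hdesc := isDescentField_empLoss X hX
  refine norm_snd_iterate_le hws hdesc (fun w hw hle => ?_) hB hbB hb hη hηM hηB hc hηc hs₀ hs₀1
    hs₀V hV hξ hξB (mul_nonneg hN hθ.le) t
  have h1 := (abs_le.1 (hdev w ws (hw.norm_le.trans one_le_two) (hws.norm_le.trans one_le_two))).1
  have h2 : ‖w - ws‖ ≤ 2 := (norm_sub_le _ _).trans (by linarith [hw.norm_le, hws.norm_le])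
  -- The empirical loss decreases, so the population loss exceeds its initial value by at most 4θ ≤
  -- l ≤ q. This is the slack behind the threshold 2q.
  have h3 : θ * (‖w - ws‖ + θ) ≤ θ * 4 := mul_le_mul_of_nonneg_left (by linarith) hθ.le
  have h4 := hl ws hws.norm_le
  obtain ⟨r, hcr, hr, hgr⟩ := hgrad w hw (by linarith)
  refine ⟨r, (empGrad X w - gradient (popLoss P) w).snd, hcr, hr, (norm_snd_le _).trans ?_, ?_⟩
  · refine hdesc.norm_sub_le hθ hw.ne_zero
      (fun u hu => hlow w u (hw.signal.trans (norm_fst_le w)) hw.norm_le (hu.trans hθ4))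
      fun u hu => ?_
    have h5 := hdev (w + u) w ((norm_add_le _ _).trans (by linarith [hw.norm_le]))
      (hw.norm_le.trans one_le_two)
    rwa [add_sub_cancel_left] at h5
  · rw [← hgr, WithLp.sub_snd]
    abel

/-- Self-training removes the spurious part of the classifier whenever the population gradient
shrinks it throughout the region of low loss. -/
theorem exists_stepSize_sampleSize [IsProbabilityMeasure P] {lam M' V b c l q : ℝ} (hlam : 0 < lam)
    (hexp : Integrable (fun x => Real.exp (lam * ‖WithLp.toLp 2 x‖ ^ 2)) P)
    (hd : ∀ w, w ≠ 0 → DifferentiableAt ℝ (popLoss P) w) (hM' : 0 ≤ M')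
    (hlow : ∀ w u : Weights d₁ d₂, 1 / 2 ≤ ‖w‖ → ‖w‖ ≤ 1 → ‖u‖ ≤ 1 / 4 →
      popLoss P w + ⟪gradient (popLoss P) w, u⟫ - M' * ‖u‖ ^ 2 ≤ popLoss P (w + u))
    (hgrad : ∀ w, InRegion B V w → popLoss P w ≤ 2 * q →
      ∃ r, c ≤ r ∧ r ≤ 1 ∧ (gradient (popLoss P) w).snd = r • B (B w.snd))
    (hl0 : 0 < l) (hl : ∀ w : Weights d₁ d₂, ‖w‖ ≤ 1 → l ≤ popLoss P w)
    (hB : ∀ u v, ⟪B u, v⟫ = ⟪u, B v⟫) (hbB : ∀ v, b * ‖v‖ ≤ ‖B v‖) (hb : 0 < b) (hc : 0 < c)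
    (hV : 0 < V) :
    ∃ η₀ : ℝ, 0 < η₀ ∧ ∀ η : ℝ, 0 < η → η ≤ η₀ → ∃ C : ℝ, 0 < C ∧
      ∀ ws : Weights d₁ d₂, InRegion B V ws → popLoss P ws ≤ q →
        (∀ ε : ℝ, 0 < ε → ε ≤ 1 / 2 → ∀ t : ℕ, C * Real.log (1 / ε) ≤ t →
          ‖(iterate (gradient (popLoss P)) η ws t).snd‖ ≤ ε) ∧
        (∀ ε δ : ℝ, 0 < ε → ε ≤ 1 / 2 → 0 < δ → δ ≤ 1 / 2 →
          ∀ n : ℕ, C * (1 / ε ^ 4) * Real.log (1 / δ) ≤ n →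
            1 - δ ≤ (Measure.pi fun _ : Fin n => P).real
              {X | ∀ t : ℕ, C * Real.log (1 / ε) ≤ t →
                ‖(iterate (empGrad X) η ws t).snd‖ ≤ ε}) := by
  obtain ⟨M, Cd, hM0, hCd, hM, hdev⟩ := exists_uniform_deviation hlam hexp
  have hρ : 0 < c * b ^ 2 := by positivity
  obtain ⟨s₀, ⟨hs1, hs2⟩, hs₀⟩ := (((eventually_mul_le_nhdsGT_zero 4 one_pos).and
    (eventually_mul_le_nhdsGT_zero (4 * ‖B‖) (Real.sqrt_pos.2 hV))).and
      self_mem_nhdsWithin).exists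
  have hs₀ : 0 < s₀ := hs₀
  have hs₀1 : 4 * s₀ ^ 2 ≤ 3 / 4 := by nlinarith
  have hs₀V : ‖B‖ ^ 2 * (4 * s₀ ^ 2) ≤ V * (1 / 4) := by
    have h1 := pow_le_pow_left₀ (by positivity) hs2 2
    rw [Real.sq_sqrt hV.le] at h1
    linarith
  set N := 2 + M / 2 + M' with hNdef
  have hN : 0 ≤ N := by positivity
  -- The ratio a = θ/ε is fixed before ε. The condition with 4N makes the residual error at most
  -- ε/2; the others are linear in θ and hold for all ε ≤ 1/2.
  obtain ⟨a, ⟨ha1, ha2, ha3, ha4, ha5⟩, ha⟩ :=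
    (((eventually_mul_le_nhdsGT_zero N (m := c * b ^ 2 / 2 * s₀) (by positivity)).and
    ((eventually_mul_le_nhdsGT_zero (‖B‖ * N) (m := c * b ^ 2 / 2 * (b * s₀)) (by positivity)).and
    ((eventually_mul_le_nhdsGT_zero (4 * N) hρ).and
    ((eventually_mul_le_nhdsGT_zero 4 one_pos).and
    (eventually_mul_le_nhdsGT_zero 4 hl0))))).and self_mem_nhdsWithin).exists
  have ha : 0 < a := ha
  obtain ⟨η₀, ⟨hη1, hη2, hη3⟩, hη₀⟩ :=
    (((eventually_mul_le_nhdsGT_zero M two_pos).and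
    ((eventually_mul_le_nhdsGT_zero (‖B‖ ^ 2) one_pos).and
    (eventually_mul_le_nhdsGT_zero (c * b ^ 2) one_pos))).and self_mem_nhdsWithin).exists
  refine ⟨η₀, hη₀, fun η hη hηle => ?_⟩
  have hηM : η * M ≤ 2 := (mul_le_mul_of_nonneg_right hηle hM0).trans hη1
  have hηB : η * ‖B‖ ^ 2 ≤ 1 := (mul_le_mul_of_nonneg_right hηle (sq_nonneg _)).trans hη2
  have hηc : η * c * b ^ 2 ≤ 1 := by
    rw [mul_assoc]
    exact (mul_le_mul_of_nonneg_right hηle hρ.le).trans hη3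
  set r := η * c * b ^ 2 / 2 with hrdef
  have hr : 0 < r := by positivity
  have hr1 : r ≤ 1 := by linarith
  set C := (2 / r + 2) + Cd * (2 / a) ^ 4 with hCdef
  have hC1 : 2 / r + 2 ≤ C := le_add_of_nonneg_right (by positivity)
  have hC2 : Cd * (2 / a) ^ 4 ≤ C := le_add_of_nonneg_left (by positivity)
  refine ⟨C, by positivity, fun ws hws hwq => ⟨fun ε hε hε2 T hT => ?_,
    fun ε δ hε hε2 hδ hδ2 n hn => ?_⟩⟩
  · obtain ⟨t, rfl, ht⟩ := exists_contraction_pow_le hr hr1 hC1 hε hε2 hT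
    have hpop := isDescentField_popLoss (integrable_sq_of_exp_sq hlam hexp) hd hM
    have h1 := norm_snd_iterate_le (ξ := 0) hws hpop (fun w hw hle => by
      have h0 := (hl ws hws.norm_le)
      obtain ⟨r, hcr, hr, hgr⟩ := hgrad w hw (by linarith)
      exact ⟨r, 0, hcr, hr, norm_zero.le, by rw [hgr, add_zero]⟩) hB hbB hb hη hηM hηB hc hηc hs₀
      hs₀1 hs₀V hV.le (by positivity) (by rw [mul_zero]; positivity) le_rfl t
    rw [mul_zero, zero_div, add_zero] at h1
    linarith
  · have hΛ : 0 ≤ Real.log (1 / δ) := Real.log_nonneg (by rw [le_div_iff₀ hδ]; linarith)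
    have hεa : a * ε / 2 ≤ 1 := by nlinarith
    have hsize : Cd * (1 / (a * ε / 2) ^ 4) * Real.log (1 / δ) ≤ n := by
      refine le_trans ?_ hn
      have e : Cd * (1 / (a * ε / 2) ^ 4) = Cd * (2 / a) ^ 4 * (1 / ε ^ 4) := by field_simp
      rw [e]
      exact mul_le_mul_of_nonneg_right (mul_le_mul_of_nonneg_right hC2 (by positivity)) hΛ
    -- Half of aε is used since the deviation bound reads 2θ(‖w - w'‖ + 2θ).
    refine (hdev (a * ε / 2) δ (by positivity) hεa hδ hδ2 n hsize).trans
      (measureReal_mono fun X hX T hT => ?_)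
    obtain ⟨hX1, hX2⟩ := hX
    obtain ⟨t, rfl, ht⟩ := exists_contraction_pow_le hr hr1 hC1 hε hε2 hT
    have e2 : 2 * (a * ε / 2) = a * ε := by ring
    rw [e2] at hX2
    have hscale : ∀ {k m : ℝ}, a * k ≤ m → 0 ≤ m → a * ε * k ≤ m := fun {k m} h hm => by
      calc a * ε * k = a * k * ε := by ring
        _ ≤ m * ε := mul_le_mul_of_nonneg_right h hε.le
        _ ≤ m * 1 := mul_le_mul_of_nonneg_left (by linarith) hm
        _ = m := mul_one m
    have hξ1 : N * (a * ε) ≤ c * b ^ 2 / 2 * s₀ := by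
      have := hscale ha1 (by positivity)
      linarith
    have hξ2 : ‖B‖ * (N * (a * ε)) ≤ c * b ^ 2 / 2 * (b * s₀) := by
      have := hscale ha2 (by positivity)
      linarith
    have h1 := norm_snd_iterate_empGrad_le (θ := a * ε) hws hX1 hX2 hlow hgrad hl hwq (by positivity)
      (by linarith [hscale ha4 zero_le_one]) (hscale ha5 hl0.le) hB hbB hb hη hηM hηB hc hηc hs₀
      hs₀1 hs₀V hV.le hN hξ1 hξ2 t
    have h2 : 2 * (N * (a * ε)) / (c * b ^ 2) ≤ ε / 2 := by
      rw [div_le_iff₀ hρ]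
      have h3 := mul_le_mul_of_nonneg_right ha3 hε.le
      linarith
    linarith

end

end SelfTraining

end

open SelfTraining in
theorem theorem1 {d₁ d₂ K : ℕ} (α β : ℝ) (hα : 0 < α)
    (Dpos Dneg : Measure (SelfTraining.Euc d₁)) (hpos : IsProbabilityMeasure Dpos)
    (hneg : IsProbabilityMeasure Dneg)
    (S₂ : Matrix (Fin d₂) (Fin d₂) ℝ) (hS₂ : S₂.PosDef)
    (P : Measure (SelfTraining.Euc d₁ × SelfTraining.Euc d₂))
    (hP : P = SelfTraining.inputLaw Dpos Dneg S₂)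
    (τ : Fin K → ℝ) (μ : Fin K → Measure (SelfTraining.Euc d₁))
    (hsep : SelfTraining.SeparationAssumption P α β τ μ)
    (hsmooth : SelfTraining.SmoothLoss (SelfTraining.popLoss P)) :
    ∃ η₀ : ℝ, 0 < η₀ ∧ ∀ η : ℝ, 0 < η → η ≤ η₀ → ∃ C : ℝ, 0 < C ∧
      ∀ ws : SelfTraining.Weights d₁ d₂,
        SelfTraining.SourceAssumption P S₂ α β (⨅ i, τ i) ws →
        -- population version
        (∀ ε : ℝ, 0 < ε → ε ≤ 1 / 2 → ∀ t : ℕ, C * Real.log (1 / ε) ≤ t →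
          ‖(SelfTraining.iterate (gradient (SelfTraining.popLoss P)) η ws t).snd‖ ≤ ε) ∧
        -- finite-sample version
        (∀ ε δ : ℝ, 0 < ε → ε ≤ 1 / 2 → 0 < δ → δ ≤ 1 / 2 →
          ∀ n : ℕ, C * (1 / ε ^ 4) * Real.log (1 / δ) ≤ n →
            1 - δ ≤ (Measure.pi fun _ : Fin n => P).real
              {X | ∀ t : ℕ, C * Real.log (1 / ε) ≤ t →
                ‖(SelfTraining.iterate (SelfTraining.empGrad X) η ws t).snd‖ ≤ ε}) := by
  -- Without signal coordinates no source classifier can have ‖w₁‖ ≥ 1/2. Otherwise a unit vector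
  -- exists, which gives α ≤ β and hence β > 0.
  rcases Nat.eq_zero_or_pos d₁ with rfl | hd₁
  · refine ⟨1, one_pos, fun η _ _ => ⟨1, one_pos, fun ws hws => absurd hws.signal ?_⟩⟩
    rw [Subsingleton.elim ws.fst 0, norm_zero]
    norm_num
  have hK : Nonempty (Fin K) := by
    by_contra h
    rw [not_nonempty_iff] at h
    have := hsep.weight_sum
    rw [Finset.univ_eq_empty, Finset.sum_empty] at this
    exact zero_ne_one this
  have hαβ : α ≤ β := by
    obtain ⟨i⟩ := hK
    have := hsep.prob i
    exact (hsep.sliced i).le (v := EuclideanSpace.single ⟨0, hd₁⟩ 1) (by simp)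
  have hβ : 0 < β := hα.trans_le hαβ
  obtain ⟨B, hB, hBS, b, hb, hbB⟩ := exists_sqrt_of_posDef hS₂
  have hG : ∀ v : Euc d₂, (multivariateGaussian 0 S₂).map (fun x => inner ℝ v x) =
      (gaussianReal 0 1).map (fun z => ‖B v‖ * z) := fun v =>
    map_inner_multivariateGaussian hS₂.posSemidef v (hBS v)
  rw [inputLaw_eq_prod] at hP
  have hDprob := isProbabilityMeasure_half_add Dpos Dneg
  set D := (2⁻¹ : ℝ≥0∞) • Dpos + (2⁻¹ : ℝ≥0∞) • Dneg
  subst hP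
  have hD : D = ∑ i, ENNReal.ofReal (τ i) • μ i := by
    have h := hsep.mixture
    rwa [Measure.map_fst_prod, measure_univ, one_smul] at h
  have hint := integrable_exp_sq_mixture (τ := τ) hα hd₁ hsep.prob hsep.sliced
  rw [← hD] at hint
  obtain ⟨lam, hlam, hexp⟩ := exists_integrable_exp_sq_prod (G := multivariateGaussian 0 S₂)
    (by positivity) hint
  obtain ⟨M', hM', hlow⟩ := exists_quadratic_lower_bound hsmooth.1 hsmooth.2
  obtain ⟨l, hl0, hl1, hl⟩ := exists_popLoss_lower_bound (D.prod (multivariateGaussian 0 S₂))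
  have hm : 0 < min 1 (min (α / β ^ 2) β⁻¹) :=
    lt_min one_pos (lt_min (by positivity) (by positivity))
  obtain ⟨η₀, hη₀, h⟩ := exists_stepSize_sampleSize
    (V := 0.12 * min 1 (min (α / β ^ 2) β⁻¹)) (c := l / 11) hlam hexp hsmooth.1 hM' hlow
    (fun w hw hloss => exists_shrink_rate hG hB hα hsep.weight_nonneg hsep.prob hsep.sliced hD
      hsmooth.1 hl1 hl hw hloss) hl0 hl hB hbB hb (by positivity) (by positivity)
  refine ⟨η₀, hη₀, fun η hη hηle => ?_⟩
  obtain ⟨C, hC, hmain⟩ := h η hη hηle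
  refine ⟨C, hC, fun ws hws => hmain ws ⟨hws.norm_le, hws.signal, ?_⟩ hws.loss⟩
  rw [hBS]
  refine hws.variance.trans ?_
  -- The constant 0.03 of the source assumption is 0.12 times this 1/4.
  have h4 : (1 : ℝ) / 4 ≤ ‖ws.fst‖ ^ 2 := by nlinarith [hws.signal]
  have h5 := mul_le_mul_of_nonneg_left h4 hm.le
  linarith
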